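/- **Setting.** Let $Y_n$ be one of the types $A_n$ ($n\ge 1$), $B_n$ ($n\ge 2$), $C_n$ ($n\ge 3$), $D_n$ ($n\ge 4$), let $\mathbb F_q$ be a finite field of characteristic $p$, and assume $p>2$ if the type is $B_n$ or $C_n$. Let $\Phi^+$ be the standard set of positive roots: $e_i-e_j$ ($1\le i<j\le n+1$) in type $A_n$; $e_i\pm e_j$ ($1\le i<j\le n$) in type $D_n$; these together with the $e_i$ in type $B_n$, respectively the $2e_i$ in type $C_n$. Let $UY_n=UY_n(q)=\langle x_\alpha(t)\mid \alpha\in\Phi^+,\ t\in\mathbb F_q\rangle$ be the corresponding Sylow $p$-subgroup of the Chevalley group of type $Y_n$ over $\mathbb F_q$, where $x_\alpha(t)=\exp(te_\alpha)$ for the root vector $e_\alpha$ of a Chevalley basis (realized in the natural representation), and let $X_\alpha=\langle x_\alpha(t)\mid t\in\mathbb F_q\rangle$. A subset $S\subseteq\Phi^+$ is a *closed pattern* if $\alpha,\beta\in S$ and $\alpha+\beta\in\Phi^+$ imply $\alpha+\beta\in S$; a subset $N\subseteq S$ is *normal* in $S$ if $\alpha\in S$, $\beta\in N$ and $\alpha+\beta\in\Phi^+$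 imply $\alpha+\beta\in N$. Put $P(S)=\langle X_\alpha\mid\alpha\in S\rangle$. Let $\operatorname{Irr}(G)$ be the set of complex irreducible characters of $G$ and $\operatorname{Irr}(G)^*=\operatorname{Irr}(G)\setminus\{\mathbf 1_G\}$. For $\chi\in\operatorname{Irr}(UY_n)$ let $\operatorname{rs}(\chi)$ be the set of $\beta\in\Phi^+$ with $X_\beta\subseteq Z(\chi)$ and $X_\beta\not\subseteq\operatorname{Ker}(\chi)$, and put $\operatorname{Irr}(UY_n)_\alpha=\{\chi\in\operatorname{Irr}(UY_n)\mid\operatorname{rs}(\chi)=\{\alpha\}\}$. For $\alpha\in\Phi^+$ define $n_0(\alpha)=\{\alpha\}$, $n_i(\alpha)=(n_{i-1}(\alpha)+\Phi^+)\cap\Phi^+$ and $k_0(\alpha)=\bigcup_{i\ge1}n_i(\alpha)$. For $i\ge1$ let $k_i(\alpha)$ be the union of $k_{i-1}(\alpha)$ and the set of all $\beta\in\Phi^+\setminus\{\alpha\}$ such that, for every $\gamma\in\Phi^+$, $\beta+\gamma\notin\Phi^+$ or $\beta+\gamma\in k_{i-1}(\alpha)$. Put $k(\alpha)=\bigcup_i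 k_i(\alpha)$. Let $h(\alpha)=\{\gamma\in\Phi^+\mid\alpha-\gamma\in\Phi^+\cup\{0\}\}$ be the hook of $\alpha$. Define the arm $a(\alpha)$ by - $a(e_i-e_j)=\{e_i-e_s\mid i<s<j\}$; - $a(e_k+e_i)=\Phi^+\cap\big(\{e_k-e_s\mid k<s<i\}\cup\{e_i\pm e_s\mid i<s\le n\}\cup\{e_i,2e_i\}\big)$ for $k<i$; - $a(e_k)=\{e_s\mid k<s\le n\}$ (type $B_n$); - $a(2e_k)=\{e_k-e_s\mid k<s\le n\}$ (type $C_n$). Put $\ell(\alpha)=h(\alpha)\setminus(\{\alpha\}\cup a(\alpha))$ (the leg), $s(\alpha)=\Phi^+\setminus a(\alpha)$ (the source) and $S_\alpha=P(s(\alpha))$. **Theorem.** For every $\alpha\in\Phi^+$ the following hold. 1. $a(\alpha)\subseteq h(\alpha)\setminus\{\alpha\}$, $|a(\alpha)|=|\ell(\alpha)|$, and for each $\beta\in a(\alpha)$ there is a unique $\gamma\in\ell(\alpha)$ with $\beta+\gamma=\alpha$. 2. $s(\alpha)$ is a closed pattern, and $\ell(\alpha)\cup k(\alpha)$ is contained and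 normal in $s(\alpha)$. 3. $P(\{\alpha\}\cup\ell(\alpha)\cup k(\alpha))\cap S_\alpha$ is normal in $S_\alpha$ (in fact $P(\{\alpha\}\cup\ell(\alpha)\cup k(\alpha))\subseteq S_\alpha$, by 2), so that $\overline T_\alpha:=S_\alpha/P(\{\alpha\}\cup\ell(\alpha)\cup k(\alpha))$ is defined. There is a (necessarily unique) homomorphism $\pi\colon S_\alpha\to X_\alpha$ that is the identity on $X_\alpha$ and trivial on $P(s(\alpha)\setminus\{\alpha\})$; write $\operatorname{infl}_{X_\alpha}^{S_\alpha}\lambda=\lambda\circ\pi$. 4. The map $$\Psi\colon\operatorname{Irr}(\overline T_\alpha)\times\operatorname{Irr}(X_\alpha)^*\to\operatorname{Irr}(UY_n)_\alpha,\qquad(\mu,\lambda)\mapsto\big(\operatorname{infl}_{\overline T_\alpha}^{S_\alpha}\mu\cdot\operatorname{infl}_{X_\alpha}^{S_\alpha}\lambda\big)^{UY_n}$$ is well defined and bijective. 5. $\Psi(\mu,\lambda)(1)=q^{|a(\alpha)|}\,\mu(1)$ for all $\mu\in\operatorname{Irr}(\overline T_\alpha)$, $\lambda\in\operatorname{Irr}(X_\alpha)^*$.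 -/

import Mathlib

noncomputable section

namespace ClassicalUnipotent

/-! ## Characters of finite groups -/

/-- The set of complex irreducible characters of a group `G`, as functions `G → ℂ`. Every
finite-dimensional representation is isomorphic to one on some `ℂ ^ d`. -/
def Irr (G : Type*) [Group G] : Set (G → ℂ) :=
  {χ | ∃ (d : ℕ) (ρ : Representation ℂ G (Fin d → ℂ)), ρ.IsIrreducible ∧ ρ.character = χ}

open Classical in
/-- The class function of the finite group `G` induced by a class function `φ` of a subgroup `H`:
`φ^G(g) = |H|⁻¹ ∑_{x ∈ G, x⁻¹ g x ∈ H} φ(x⁻¹ g x)`. -/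
def induced {G : Type*} [Group G] (H : Subgroup G) (φ : H → ℂ) (g : G) : ℂ :=
  (Nat.card H : ℂ)⁻¹ * ∑ᶠ x : G, if h : x⁻¹ * g * x ∈ H then φ ⟨x⁻¹ * g * x, h⟩ else 0

/-- The kernel `{g | χ(g) = χ(1)}` of a character. -/
def charKernel {G : Type*} [Group G] (χ : G → ℂ) : Set G := {g | χ g = χ 1}

/-- The center `Z(χ) = {g | |χ(g)| = χ(1)}` of a character. -/
def charCenter {G : Type*} [Group G] (χ : G → ℂ) : Set G := {g | (‖χ g‖ : ℂ) = χ 1}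

/-! ## The classical root systems -/

/-- The four classical families. -/
inductive Family
  | A
  | B
  | C
  | D

/-- The ranks that are considered: `A_n` (`n ≥ 1`), `B_n` (`n ≥ 2`), `C_n` (`n ≥ 3`),
`D_n` (`n ≥ 4`). -/
def Family.RankOK : Family → ℕ → Prop
  | .A, n => 1 ≤ n
  | .B, n => 2 ≤ n
  | .C, n => 3 ≤ n
  | .D, n => 4 ≤ n

/-- The condition on the characteristic: `p > 2` if the Dynkin diagram has a double edge. -/
def Family.PrimeOK : Family → ℕ → Prop
  | .A, _ => True
  | .B, p => 2 < p
  | .C, p => 2 < p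
  | .D, _ => True

/-- The number of coordinates: the root system of type `A_n` lives in `ℤ^(n+1)`, those of type
`B_n`, `C_n`, `D_n` live in `ℤ^n`. -/
def Family.dim : Family → ℕ → ℕ
  | .A, n => n + 1
  | .B, n => n
  | .C, n => n
  | .D, n => n

/-- Names for the vectors `e_i - e_j`, `e_i + e_j`, `e_i`, `2 e_i`. -/
inductive RootName (m : ℕ)
  | diff (i j : Fin m)
  | sum (i j : Fin m)
  | short (i : Fin m)
  | long (i : Fin m)

/-- The vector in `ℤ^m` with a given name. -/
def RootName.vec {m : ℕ} : RootName m → (Fin m → ℤ)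
  | .diff i j => Pi.single i 1 - Pi.single j 1
  | .sum i j => Pi.single i 1 + Pi.single j 1
  | .short i => Pi.single i 1
  | .long i => Pi.single i 2

/-- The positive roots:
type `A_n`: `e_i - e_j` (`i < j`);
type `B_n`: `e_i ± e_j` (`i < j`) and `e_i`;
type `C_n`: `e_i ± e_j` (`i < j`) and `2 e_i`;
type `D_n`: `e_i ± e_j` (`i < j`). -/
def Family.IsPositive {m : ℕ} : Family → RootName m → Prop
  | _, .diff i j => i < j
  | .A, .sum _ _ => False
  | _, .sum i j => i < j
  | .B, .short _ => True
  | _, .short _ => False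
  | .C, .long _ => True
  | _, .long _ => False

/-- The set `Φ⁺` of positive roots of the root system of type `Y_n`. -/
def PosRoot (Y : Family) (n : ℕ) : Type := {r : RootName (Y.dim n) // Y.IsPositive r}

section Roots

variable {Y : Family} {n : ℕ}

/-- A positive root as a vector. -/
def PosRoot.vec (α : PosRoot Y n) : Fin (Y.dim n) → ℤ := α.1.vec

/-- `IsSum α β γ`: the vector `α + β` is the positive root `γ`. -/
def IsSum (α β γ : PosRoot Y n) : Prop := α.vec + β.vec = γ.vec

/-- Closed patterns. -/
def IsClosedPattern (S : Set (PosRoot Y n)) : Prop :=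
  ∀ α ∈ S, ∀ β ∈ S, ∀ γ, IsSum α β γ → γ ∈ S

/-- `M` normalizes `N`. -/
def Normalizes (M N : Set (PosRoot Y n)) : Prop :=
  ∀ α ∈ M, ∀ β ∈ N, ∀ γ, IsSum α β γ → γ ∈ N

/-- `N` is a normal subpattern of the closed pattern `S`. -/
def IsNormalPattern (N S : Set (PosRoot Y n)) : Prop := N ⊆ S ∧ Normalizes S N

/-- `n_0(α) = {α}` and `n_i(α) = (n_{i-1}(α) + Φ⁺) ∩ Φ⁺`. -/
def nStep (α : PosRoot Y n) : ℕ → Set (PosRoot Y n)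
  | 0 => {α}
  | i + 1 => {δ | ∃ β ∈ nStep α i, ∃ γ, IsSum β γ δ}

/-- The root center of the quotient pattern group `UY_n / P(N)`, for `N` normal in `Φ⁺`. -/
def rootCenter (N : Set (PosRoot Y n)) : Set (PosRoot Y n) :=
  {α | ∀ γ δ, IsSum α γ δ → δ ∈ N} \ N

/-- `k_0(α) = n(α) = ⋃_{i ≥ 1} n_i(α)`, and
`k_i(α) = (rz(UY_n / P(k_{i-1}(α))) \ {α}) ∪ k_{i-1}(α)`. -/
def kStep (α : PosRoot Y n) : ℕ → Set (PosRoot Y n)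
  | 0 => ⋃ i : ℕ, nStep α (i + 1)
  | i + 1 => (rootCenter (kStep α i) \ {α}) ∪ kStep α i

/-- The normal closed pattern `k(α) = ⋃_i k_i(α)`. -/
def kPattern (α : PosRoot Y n) : Set (PosRoot Y n) := ⋃ i : ℕ, kStep α i

/-- The hook `h(α) = {γ | α - γ ∈ Φ⁺ ∪ {0}}`. -/
def hook (α : PosRoot Y n) : Set (PosRoot Y n) := {γ | γ = α ∨ ∃ β, IsSum γ β α}

/-- The leg `h(α) \ ({α} ∪ a)` that belongs to a subset `a` of the hook. -/
def legOf (α : PosRoot Y n) (a : Set (PosRoot Y n)) : Set (PosRoot Y n) :=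
  hook α \ ({α} ∪ a)

/-- `a` is an arm of the hook of `α`. -/
def IsArm (α : PosRoot Y n) (a : Set (PosRoot Y n)) : Prop :=
  a ⊆ hook α \ {α} ∧ a.ncard = (legOf α a).ncard ∧
    ∀ β ∈ a, ∃! γ, γ ∈ legOf α a ∧ IsSum β γ α

/-- The chosen arms, on names (in types without short respectively long names the corresponding
elements are absent):
`a(e_i - e_j) = {e_i - e_s | i < s < j}`,
`a(e_k + e_i) = {e_k - e_s | k < s < i} ∪ {e_i ± e_s | i < s} ∪ {e_i, 2 e_i}` for `k < i`,
`a(e_k) = {e_s | k < s}`,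
`a(2 e_k) = {e_k - e_s | k < s}`. -/
def armNames {m : ℕ} : RootName m → Set (RootName m)
  | .diff i j => {β | ∃ s, i < s ∧ s < j ∧ β = .diff i s}
  | .sum k i =>
      {β | (∃ s, k < s ∧ s < i ∧ β = .diff k s) ∨
        (∃ s, i < s ∧ (β = .diff i s ∨ β = .sum i s)) ∨ β = .short i ∨ β = .long i}
  | .short k => {β | ∃ s, k < s ∧ β = .short s}
  | .long k => {β | ∃ s, k < s ∧ β = .diff k s}

/-- The arm `a(α)`. -/
def arm (α : PosRoot Y n) : Set (PosRoot Y n) := {β | β.1 ∈ armNames α.1}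

/-- The leg `ℓ(α)`. -/
def leg (α : PosRoot Y n) : Set (PosRoot Y n) := legOf α (arm α)

/-- The source `s(α) = Φ⁺ \ a(α)`. -/
def source (α : PosRoot Y n) : Set (PosRoot Y n) := (arm α)ᶜ

end Roots

/-! ## The groups `UY_n(q)`

The root subgroups of the Chevalley group of type `Y_n` are realized in the natural representation
of the classical Lie algebra of type `Y_n`: `sl_{n+1}`, `so_{2n+1}`, `sp_{2n}`, `so_{2n}`. The
root element is `x_α(t) = exp(t e_α) = 1 + t e_α + t² (e_α² / 2)` for the root vector `e_α` of a
Chevalley basis. -/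

/-- The index set of the basis `v_1, …, v_m, v_0, v_{-1}, …, v_{-m}`. Type `A_n` acts on
`v_1, …, v_{n+1}`, type `B_n` on all basis vectors, types `C_n` and `D_n` on all but `v_0`; the
remaining basis vectors are fixed by the whole group. -/
abbrev Idx (m : ℕ) : Type := Fin m ⊕ (Unit ⊕ Fin m)

section Groups

variable (R : Type*) [CommRing R]

/-- The matrix unit `E_{i,j}`. -/
def unitPP {m : ℕ} (i j : Fin m) : Matrix (Idx m) (Idx m) R :=
  Matrix.single (.inl i) (.inl j) 1

/-- The matrix unit `E_{i,-j}`. -/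
def unitPN {m : ℕ} (i j : Fin m) : Matrix (Idx m) (Idx m) R :=
  Matrix.single (.inl i) (.inr (.inr j)) 1

/-- The matrix unit `E_{-i,-j}`. -/
def unitNN {m : ℕ} (i j : Fin m) : Matrix (Idx m) (Idx m) R :=
  Matrix.single (.inr (.inr i)) (.inr (.inr j)) 1

/-- The matrix unit `E_{i,0}`. -/
def unitPZ {m : ℕ} (i : Fin m) : Matrix (Idx m) (Idx m) R :=
  Matrix.single (.inl i) (.inr (.inl ())) 1

/-- The matrix unit `E_{0,-i}`. -/
def unitZN {m : ℕ} (i : Fin m) : Matrix (Idx m) (Idx m) R :=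
  Matrix.single (.inr (.inl ())) (.inr (.inr i)) 1

/-- The root vector `e_α`. For type `B_n` the quadratic form is `x_0² + ∑ x_i x_{-i}`, for type
`D_n` it is `∑ x_i x_{-i}`, for type `C_n` the symplectic form is
`∑ (x_i y_{-i} - x_{-i} y_i)`. -/
def rootVector {m : ℕ} : Family → RootName m → Matrix (Idx m) (Idx m) R
  | .A, .diff i j => unitPP R i j
  | _, .diff i j => unitPP R i j - unitNN R j i
  | .C, .sum i j => unitPN R i j + unitPN R j i
  | _, .sum i j => unitPN R i j - unitPN R j i
  | _, .short i => (2 : R) • unitPZ R i - unitZN R i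
  | _, .long i => unitPN R i i

/-- The divided square `e_α² / 2`: it is `-E_{i,-i}` for a short root `e_i` of type `B_n`, and `0`
for all other roots. -/
def rootVectorSq {m : ℕ} : RootName m → Matrix (Idx m) (Idx m) R
  | .short i => -unitPN R i i
  | _ => 0

/-- `rootVectorSq` is half the square of `rootVector`, and `e_α³ = 0`. -/
theorem rootVector_relations {Y : Family} {n : ℕ} (α : PosRoot Y n) :
    rootVector R Y α.1 * rootVector R Y α.1 = (2 : R) • rootVectorSq R α.1 ∧
    rootVector R Y α.1 * rootVectorSq R α.1 = 0 ∧
    rootVectorSq R α.1 * rootVector R Y α.1 = 0 ∧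
    rootVectorSq R α.1 * rootVectorSq R α.1 = 0 := by
  obtain ⟨r, hr⟩ := α
  cases r with
  | diff i j =>
    have hij : i < j := by cases Y <;> exact hr
    cases Y <;>
      simp [rootVector, rootVectorSq, unitPP, unitNN, mul_sub, sub_mul, hij.ne, hij.ne']
  | sum i j =>
    cases Y <;> simp [rootVector, rootVectorSq, unitPN, mul_sub, sub_mul, mul_add, add_mul]
  | short i =>
    cases Y <;>
      simp [rootVector, rootVectorSq, unitPN, unitPZ, unitZN, mul_sub, sub_mul]
  | long i =>
    cases Y <;> simp [rootVector, rootVectorSq, unitPN]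

/-- The matrix `x_α(t) = exp(t e_α)`. -/
def rootMatrix {Y : Family} {n : ℕ} (α : PosRoot Y n) (t : R) : Matrix (Idx (Y.dim n)) (Idx (Y.dim n)) R :=
  1 + t • rootVector R Y α.1 + t ^ 2 • rootVectorSq R α.1

theorem rootMatrix_mul_neg {Y : Family} {n : ℕ} (α : PosRoot Y n) (t : R) :
    rootMatrix R α t * rootMatrix R α (-t) = 1 := by
  obtain ⟨h1, h2, h3, h4⟩ := rootVector_relations R α
  simp only [rootMatrix, mul_add, add_mul, smul_mul_assoc, mul_smul_comm, h1, h2, h3, h4,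
    mul_one, one_mul, smul_zero]
  module

variable {R}

/-- The root element `x_α(t)` as an invertible matrix. -/
def rootElement {Y : Family} {n : ℕ} (α : PosRoot Y n) (t : R) : GL (Idx (Y.dim n)) R where
  val := rootMatrix R α t
  inv := rootMatrix R α (-t)
  val_inv := rootMatrix_mul_neg R α t
  inv_val := by simpa using rootMatrix_mul_neg R α (-t)

variable (R) in
/-- The group `UY_n`, generated by all `x_α(t)` with `α ∈ Φ⁺`. -/
def UY (Y : Family) (n : ℕ) : Subgroup (GL (Idx (Y.dim n)) R) :=
  Subgroup.closure {g | ∃ (α : PosRoot Y n) (t : R), g = rootElement α t}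

variable {Y : Family} {n : ℕ}

variable (R) in
/-- The root subgroup `X_α = ⟨x_α(t) | t⟩` of `UY_n`. -/
def rootSubgroup (α : PosRoot Y n) : Subgroup (UY R Y n) :=
  Subgroup.closure {g | ∃ t : R, (g : GL (Idx (Y.dim n)) R) = rootElement α t}

variable (R) in
/-- The pattern subgroup `P(S) = ⟨X_α | α ∈ S⟩` of `UY_n`. -/
def patternSubgroup (S : Set (PosRoot Y n)) : Subgroup (UY R Y n) :=
  ⨆ α ∈ S, rootSubgroup R α

/-- The central root support `rs(χ)`: the roots `α` with `X_α ⊆ Z(χ)` and not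
`X_α ⊆ Ker(χ)`. -/
def rootSupport (χ : UY R Y n → ℂ) : Set (PosRoot Y n) :=
  {α | (rootSubgroup R α : Set (UY R Y n)) ⊆ charCenter χ ∧
    ¬ (rootSubgroup R α : Set (UY R Y n)) ⊆ charKernel χ}

variable (R) in
/-- The single root characters `Irr(UY_n)_α = {χ ∈ Irr(UY_n) | rs(χ) = {α}}`. -/
def singleRootIrr (α : PosRoot Y n) : Set (UY R Y n → ℂ) :=
  {χ | χ ∈ Irr (UY R Y n) ∧ rootSupport χ = {α}}

variable (R) in
/-- The source group `S_α = P(s(α))`. -/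
def sourceGroup (α : PosRoot Y n) : Subgroup (UY R Y n) := patternSubgroup R (source α)

variable (R) in
/-- `P({α} ∪ ℓ(α) ∪ k(α))`, as a subgroup of the source group. -/
def sourceKernel (α : PosRoot Y n) : Subgroup (sourceGroup R α) :=
  (patternSubgroup R ({α} ∪ leg α ∪ kPattern α)).subgroupOf (sourceGroup R α)

variable (R) in
/-- The group `T̄_α = S_α / P({α} ∪ ℓ(α) ∪ k(α))`. -/
abbrev TBar (α : PosRoot Y n) : Type _ := sourceGroup R α ⧸ sourceKernel R α

/-- `π` is the projection of `S_α` onto `X_α`: the homomorphism that is the identity on `X_α` and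
trivial on `P(s(α) \ {α})`. There is at most one, as these two subgroups generate `S_α`. It
identifies `X_α` with the quotient `S_α / P(s(α) \ {α})`. -/
def IsRootProjection (α : PosRoot Y n) (π : sourceGroup R α →* rootSubgroup R α) : Prop :=
  (∀ u : sourceGroup R α, (u : UY R Y n) ∈ rootSubgroup R α → (π u : UY R Y n) = u) ∧
  (∀ u : sourceGroup R α, (u : UY R Y n) ∈ patternSubgroup R (source α \ {α}) → π u = 1)

/-- The map `(μ, λ) ↦ (infl μ · infl λ)^{UY_n}`, where `infl μ` is the inflation of `μ` from
`T̄_α` to `S_α` and `infl λ` the inflation of `λ` from `X_α` to `S_α` along `π`. -/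
def Psi (α : PosRoot Y n) (π : sourceGroup R α →* rootSubgroup R α)
    (φ : (TBar R α → ℂ) × (rootSubgroup R α → ℂ)) : UY R Y n → ℂ :=
  induced (sourceGroup R α) (fun u => φ.1 (QuotientGroup.mk u) * φ.2 (π u))

end Groups

end ClassicalUnipotent

end

open ClassicalUnipotent

/-!
Write `V = P({α} ∪ ℓ(α) ∪ k(α))` and `S = S_α = P(s(α))`. The theorem is an instance of Clifford
theory for the normal subgroup `V` of `UY_n`.

*Roots.* Adding a positive root to an element of `{α} ∪ ℓ(α) ∪ k(α)` leads back into that set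
(`normalizes_hook_kPattern`), and the source is closed (`isClosedPattern_source`). Of two positive
roots with sum `α`, exactly one lies in the arm (`IsSum.arm_dichotomy`); so the arm and the leg
are matched by `β + γ = α`.

*Groups.* The commutator formula `RootSum.commutator` makes `V` normal in `UY_n`. The entry of a
matrix at the position of `e_α` is additive on `S` and gives the projection `rootProj : S → X_α`
that is trivial on the other root subgroups of `S`. Hence a linear character `λ ≠ 1` of `X_α` has
an extension `λ ∘ π` to `S`, and a restriction `hookChar λ` of that extension to `V`.

*The inertia group.* `S` fixes `hookChar λ`. Modulo `P(k(α))`, the commutators of `x_β(t)` and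
`x_γ(s)` for `β` in the arm and `γ` in the leg with `β + γ = α` fill the central subgroup `X_α`.
If `β` is the lowest root of a product of arm root elements, then the other factors commute with
`x_γ(s)` modulo `P(k(α))`, because a sum with
`γ` that is at least as high as `α` is `α` itself or lies in `k(α)`. So the
product can fix `hookChar λ` only if its exponent at `β` is zero, and induction on the number of
factors shows that `S` is exactly the inertia group and that the products of arm root elements are
a transversal (`isInertia_hookChar`, `index_sourceGroup`). This gives the factor `q ^ |a(α)|`.

*Characters.* An irreducible character has central root support `{α}` if and only if its
representation is trivial on `P(k(α))` and `X_α` acts by a linear character `λ ≠ 1`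
(`rootSupport_eq_iff`). Then the same lowest root argument, with arm and leg exchanged, shows that
on `V` the character vanishes wherever the representation is not the scalar `hookChar λ`, so
`hookChar λ` is a constituent of the restriction to `V` (`charProj_hookChar_ne_zero`). Clifford's
correspondence (`exists_inertia_representation`, `exists_induced_representation`) says that
induction is a bijection from the irreducible characters of `S` that restrict to multiples of
`hookChar λ` to the irreducible characters of `UY_n` over `hookChar λ`. As `hookChar λ` extends to
`S`, the former are the products of `λ ∘ π` with the inflated characters of `S / V`
(`exists_twisted_inflation`, `exists_twisted_deflation`).
-/

namespace ClassicalUnipotent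

/-! ### Sums of positive roots -/

/-- `RootSum Y r s u`: the root named `r` plus the root named `s` is the root named `u`. Each sum of
two positive roots is listed in one of the two possible orders of the summands. -/
inductive RootSum {m : ℕ} : Family → RootName m → RootName m → RootName m → Prop
  | diff_diff {Y : Family} {i j l : Fin m} (hij : i < j) (hjl : j < l) :
      RootSum Y (.diff i j) (.diff j l) (.diff i l)
  | diff_sum {Y : Family} {i j l : Fin m} (hY : Y ≠ .A) (hij : i < j) (hjl : j < l) :
      RootSum Y (.diff i j) (.sum j l) (.sum i l)
  | diff_sum' {Y : Family} {i j l : Fin m} (hY : Y ≠ .A) (hil : i < l) (hlj : l < j) :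
      RootSum Y (.diff i j) (.sum l j) (.sum i l)
  | diff_sum'' {Y : Family} {i j l : Fin m} (hY : Y ≠ .A) (hli : l < i) (hij : i < j) :
      RootSum Y (.diff i j) (.sum l j) (.sum l i)
  | diff_sum_long {i j : Fin m} (hij : i < j) : RootSum .C (.diff i j) (.sum i j) (.long i)
  | diff_long {i j : Fin m} (hij : i < j) : RootSum .C (.diff i j) (.long j) (.sum i j)
  | diff_short {i j : Fin m} (hij : i < j) : RootSum .B (.diff i j) (.short j) (.short i)
  | short_short {i j : Fin m} (hij : i < j) : RootSum .B (.short i) (.short j) (.sum i j)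

/-- The coordinates of a root, by cases on its name. -/
def RootName.coord {m : ℕ} : RootName m → Fin m → ℤ
  | .diff i j, x => (if x = i then 1 else 0) - (if x = j then 1 else 0)
  | .sum i j, x => (if x = i then 1 else 0) + (if x = j then 1 else 0)
  | .short i, x => if x = i then 1 else 0
  | .long i, x => if x = i then 2 else 0

theorem RootName.vec_apply {m : ℕ} (r : RootName m) (x : Fin m) : r.vec x = r.coord x := by
  cases r <;> simp [RootName.vec, RootName.coord, Pi.single_apply]

/-- The sum of the coordinates of a root. -/
def RootName.total {m : ℕ} : RootName m → ℤ
  | .diff _ _ => 0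
  | .sum _ _ => 2
  | .short _ => 1
  | .long _ => 2

theorem RootName.sum_vec {m : ℕ} (r : RootName m) : ∑ x, r.vec x = r.total := by
  cases r <;> simp [RootName.vec, RootName.total, Finset.sum_add_distrib, Finset.sum_sub_distrib]

theorem RootSum.vec_add {m : ℕ} {Y : Family} {r s u : RootName m} (h : RootSum Y r s u) :
    r.vec + s.vec = u.vec := by
  ext x
  simp only [Pi.add_apply, RootName.vec_apply]
  cases h <;> simp only [RootName.coord] <;> grind

set_option maxHeartbeats 4000000 in
theorem rootSum_of_vec_add {m : ℕ} {Y : Family} {r s u : RootName m} (hr : Y.IsPositive r)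
    (hs : Y.IsPositive s) (hu : Y.IsPositive u) (h : r.vec + s.vec = u.vec) :
    RootSum Y r s u ∨ RootSum Y s r u := by
  have H := congrFun h
  -- The sums of the coordinates exclude most combinations of names.
  have T : r.total + s.total = u.total := by
    simp only [← RootName.sum_vec, ← Finset.sum_add_distrib, ← h, Pi.add_apply]
  clear h
  simp only [Pi.add_apply, RootName.vec_apply] at H
  rcases r with ⟨i, j⟩ | ⟨i, j⟩ | i | i <;> rcases s with ⟨k, l⟩ | ⟨k, l⟩ | k | k <;>
    rcases u with ⟨a, b⟩ | ⟨a, b⟩ | a | a <;>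
    first | (exfalso; simp [RootName.total] at T; done) | skip
  all_goals cases Y <;> first | (exact hr.elim) | (exact hs.elim) | (exact hu.elim) | skip
  all_goals (clear T; simp only [Family.IsPositive, RootName.coord] at hr hs hu H)
  all_goals
    have h1 := H i
    have h2 := H k
    have h3 := H a
    try have h4 := H j
    try have h5 := H l
    try have h6 := H b
    clear H
    grind [RootSum.diff_diff, RootSum.diff_sum, RootSum.diff_sum', RootSum.diff_sum'',
      RootSum.diff_sum_long, RootSum.diff_long, RootSum.diff_short, RootSum.short_short]

variable {Y : Family} {n : ℕ}

theorem isSum_iff {β γ δ : PosRoot Y n} :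
    IsSum β γ δ ↔ RootSum Y β.1 γ.1 δ.1 ∨ RootSum Y γ.1 β.1 δ.1 := by
  refine ⟨rootSum_of_vec_add β.2 γ.2 δ.2, ?_⟩
  rintro (h | h)
  · exact h.vec_add
  · exact (add_comm _ _).trans h.vec_add

theorem IsSum.symm {β γ δ : PosRoot Y n} (h : IsSum β γ δ) : IsSum γ β δ :=
  (add_comm _ _).trans h

set_option maxHeartbeats 1000000 in
theorem PosRoot.vec_injective : Function.Injective (PosRoot.vec : PosRoot Y n → _) := by
  rintro ⟨r, hr⟩ ⟨s, hs⟩ h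
  have T : r.total = s.total := by
    simp only [← RootName.sum_vec]
    exact congrArg (fun v => ∑ x, v x) h
  have H : ∀ x, r.coord x = s.coord x := fun x => by
    simpa only [RootName.vec_apply, PosRoot.vec] using congrFun h x
  clear h
  congr 1
  rcases r with ⟨i, j⟩ | ⟨i, j⟩ | i | i <;> rcases s with ⟨k, l⟩ | ⟨k, l⟩ | k | k <;>
    first | (exfalso; simp [RootName.total] at T; done) | skip
  all_goals cases Y <;> first | (exact hr.elim) | (exact hs.elim) | skip
  all_goals
    simp only [Family.IsPositive, RootName.coord] at hr hs H
    have h1 := H i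
    have h2 := H k
    try have h3 := H j
    try have h4 := H l
    clear H T
    grind

theorem IsSum.right_unique {β γ γ' δ : PosRoot Y n} (h : IsSum β γ δ) (h' : IsSum β γ' δ) :
    γ = γ' :=
  PosRoot.vec_injective (add_left_cancel (Eq.trans h (Eq.symm h')))

instance : Finite (PosRoot Y n) := by
  have : Function.Injective (fun r : RootName (Y.dim n) => match r with
      | .diff i j => (Sum.inl (i, j) : (Fin (Y.dim n) × Fin (Y.dim n)) ⊕
          (Fin (Y.dim n) × Fin (Y.dim n)) ⊕ Fin (Y.dim n) ⊕ Fin (Y.dim n))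
      | .sum i j => .inr (.inl (i, j))
      | .short i => .inr (.inr (.inl i))
      | .long i => .inr (.inr (.inr i))) := by
    rintro (⟨i, j⟩ | ⟨i, j⟩ | i | i) (⟨k, l⟩ | ⟨k, l⟩ | k | k) h <;> simp_all
  have := Finite.of_injective _ this
  exact Subtype.finite

/-! ### Heights -/

/-- A height function: the pairing of a root with the strictly dominant vector
`(m, m - 1, …, 1)`. -/
def RootName.height {m : ℕ} : RootName m → ℕ
  | .diff i j => j - i
  | .sum i j => (m - i) + (m - j)
  | .short i => m - i
  | .long i => 2 * (m - i)

/-- The height of a positive root. -/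
def PosRoot.height (β : PosRoot Y n) : ℕ := β.1.height

theorem PosRoot.height_pos (β : PosRoot Y n) : 0 < β.height := by
  obtain ⟨r, hr⟩ := β
  rcases r with ⟨i, j⟩ | ⟨i, j⟩ | i | i <;> cases Y <;>
    simp only [Family.IsPositive] at hr <;>
    simp only [PosRoot.height, RootName.height] <;> omega

theorem RootSum.height_add {m : ℕ} {r s u : RootName m} (h : RootSum Y r s u) :
    u.height = r.height + s.height := by
  cases h <;> simp only [RootName.height] <;> omega

theorem IsSum.height_add {β γ δ : PosRoot Y n} (h : IsSum β γ δ) :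
    δ.height = β.height + γ.height := by
  rcases isSum_iff.1 h with h | h
  · exact h.height_add
  · exact h.height_add.trans (add_comm _ _)

theorem IsSum.height_lt {β γ δ : PosRoot Y n} (h : IsSum β γ δ) : β.height < δ.height := by
  have := h.height_add
  have := γ.height_pos
  omega

/-! ### Hooks and arms -/

/-- A necessary condition for the root named `u` to be obtained from the root named `r` by
successively adding positive roots. -/
def RootName.Below {m : ℕ} : RootName m → RootName m → Prop
  | .diff i j, .diff k l => k ≤ i ∧ j ≤ l
  | .diff i _, .sum k _ => k ≤ i
  | .diff i _, .short k => k ≤ i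
  | .diff i _, .long k => k ≤ i
  | .sum i j, .sum k l => k ≤ i ∧ l ≤ j
  | .sum i _, .long k => k ≤ i
  | .short i, .short k => k ≤ i
  | .short i, .sum k _ => k ≤ i
  | .short i, .long k => k ≤ i
  | .long i, .long k => k ≤ i
  | .long i, .sum k l => k ≤ i ∧ l ≤ i
  | _, _ => False

theorem RootName.Below.refl {m : ℕ} (r : RootName m) : r.Below r := by
  cases r <;> simp [RootName.Below]

set_option maxHeartbeats 1000000 in
theorem RootSum.below {m : ℕ} {r s u a : RootName m} (h : RootSum Y r s u) (hu : u.Below a) :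
    r.Below a ∧ s.Below a := by
  cases h <;> rcases a with ⟨k, l⟩ | ⟨k, l⟩ | k | k <;>
    simp only [RootName.Below] at hu ⊢ <;> omega

theorem IsSum.below {β γ δ : PosRoot Y n} {a : RootName (Y.dim n)} (h : IsSum β γ δ)
    (hδ : δ.1.Below a) : β.1.Below a := by
  rcases isSum_iff.1 h with h | h
  · exact (h.below hδ).1
  · exact (h.below hδ).2

variable {α : PosRoot Y n}

theorem armNames_dichotomy {m : ℕ} {r s u : RootName m} (h : RootSum Y r s u) :
    (r ∈ armNames u ∧ s ∉ armNames u) ∨ (r ∉ armNames u ∧ s ∈ armNames u) := by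
  cases h <;> simp [armNames] <;> grind

/-- If a sum of two roots lies in an arm, then so does a summand. -/
theorem armNames_sum {m : ℕ} {r s u a : RootName m} (h : RootSum Y r s u) (hu : u ∈ armNames a) :
    r ∈ armNames a ∨ s ∈ armNames a := by
  cases h <;> rcases a with ⟨k, l⟩ | ⟨k, l⟩ | k | k <;> simp [armNames] at hu ⊢ <;> grind

/-- Two roots that add up to `α` lie one in the arm and one outside of it. -/
theorem IsSum.arm_dichotomy {β γ : PosRoot Y n} (h : IsSum β γ α) :
    (β ∈ arm α ∧ γ ∉ arm α) ∨ (β ∉ arm α ∧ γ ∈ arm α) := by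
  rcases isSum_iff.1 h with h | h
  · exact armNames_dichotomy h
  · have := armNames_dichotomy h
    simp only [arm, Set.mem_ofPred_eq]
    tauto

theorem isClosedPattern_source : IsClosedPattern (source α) := by
  intro β hβ γ hγ δ h hδ
  rcases isSum_iff.1 h with h | h <;> rcases armNames_sum h hδ with h' | h'
  exacts [hβ h', hγ h', hγ h', hβ h']

theorem exists_isSum_of_mem_arm {β : PosRoot Y n} (hβ : β ∈ arm α) : ∃ γ, IsSum β γ α := by
  obtain ⟨r, hr⟩ := β
  obtain ⟨a, ha⟩ := α
  suffices ∃ s, Y.IsPositive s ∧ (RootSum Y r s a ∨ RootSum Y s r a) by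
    obtain ⟨s, hs, h⟩ := this
    exact ⟨⟨s, hs⟩, isSum_iff.2 h⟩
  change r ∈ armNames a at hβ
  rcases a with ⟨k, i⟩ | ⟨k, i⟩ | k | k
  · obtain ⟨s, h1, h2, rfl⟩ := hβ
    exact ⟨.diff s i, by cases Y <;> exact h2, .inl (.diff_diff h1 h2)⟩
  · have hki : Y ≠ .A ∧ k < i := by cases Y <;> simp_all [Family.IsPositive]
    rcases hβ with ⟨s, h1, h2, rfl⟩ | ⟨s, h1, rfl | rfl⟩ | rfl | rfl
    · exact ⟨.sum s i, by cases Y <;> simp_all [Family.IsPositive], .inl (.diff_sum hki.1 h1 h2)⟩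
    · exact ⟨.sum k s, by cases Y <;> simp_all [Family.IsPositive] <;> omega,
        .inl (.diff_sum'' hki.1 hki.2 h1)⟩
    · exact ⟨.diff k s, by cases Y <;> simp_all [Family.IsPositive] <;> omega,
        .inr (.diff_sum' hki.1 hki.2 h1)⟩
    · cases Y <;> first | exact hr.elim | exact ⟨.short k, trivial, .inr (.short_short hki.2)⟩
    · cases Y <;> first | exact hr.elim | exact ⟨.diff k i, hki.2, .inr (.diff_long hki.2)⟩
  · obtain ⟨s, h1, rfl⟩ := hβ
    cases Y <;> first | exact hr.elim | exact ⟨.diff k s, h1, .inr (.diff_short h1)⟩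
  · obtain ⟨s, h1, rfl⟩ := hβ
    cases Y <;> first | exact ha.elim | exact ⟨.sum k s, h1, .inl (.diff_sum_long h1)⟩

/-- The legs of the hooks, on names. -/
def legNames {m : ℕ} (Y : Family) : RootName m → Set (RootName m)
  | .diff i j => {γ | ∃ s, i < s ∧ s < j ∧ γ = .diff s j}
  | .sum k i =>
      {γ | (∃ s, k < s ∧ s < i ∧ γ = .sum s i) ∨
        (∃ s, i < s ∧ (γ = .diff k s ∨ γ = .sum k s)) ∨ (Y = .B ∧ γ = .short k) ∨
          (Y = .C ∧ γ = .diff k i)}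
  | .short k => {γ | ∃ s, k < s ∧ γ = .diff k s}
  | .long k => {γ | ∃ s, k < s ∧ γ = .sum k s}

theorem mem_legNames_of_sum {m : ℕ} {r s u : RootName m} (h : RootSum Y r s u) :
    (r ∉ armNames u → r ∈ legNames Y u) ∧ (s ∉ armNames u → s ∈ legNames Y u) := by
  cases h <;> simp [armNames, legNames] <;> grind

theorem mem_leg_iff_isSum {γ : PosRoot Y n} : γ ∈ leg α ↔ γ ∉ arm α ∧ ∃ β, IsSum γ β α := by
  simp only [leg, legOf, hook, Set.mem_sdiff, Set.mem_union, Set.mem_singleton_iff, Set.mem_ofPred_eq]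
  constructor
  · rintro ⟨h | h, h'⟩ <;> tauto
  · rintro ⟨h, β, hβ⟩
    refine ⟨.inr ⟨β, hβ⟩, ?_⟩
    rintro (rfl | h')
    · exact hβ.height_lt.false
    · exact h h'

theorem mem_legNames_of_mem_leg {γ : PosRoot Y n} (h : γ ∈ leg α) : γ.1 ∈ legNames Y α.1 := by
  obtain ⟨h1, β, h2⟩ := mem_leg_iff_isSum.1 h
  rcases isSum_iff.1 h2 with h | h
  · exact (mem_legNames_of_sum h).1 h1
  · exact (mem_legNames_of_sum h).2 h1

theorem mem_leg_of_mem_legNames {γ : PosRoot Y n} (h : γ.1 ∈ legNames Y α.1) : γ ∈ leg α := by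
  rw [mem_leg_iff_isSum]
  obtain ⟨r, hr⟩ := γ
  obtain ⟨a, ha⟩ := α
  suffices r ∉ armNames a ∧ ∃ s, Y.IsPositive s ∧ (RootSum Y r s a ∨ RootSum Y s r a) by
    obtain ⟨h, s, hs, h'⟩ := this
    exact ⟨h, ⟨s, hs⟩, isSum_iff.2 h'⟩
  change r ∈ legNames Y a at h
  rcases a with ⟨k, i⟩ | ⟨k, i⟩ | k | k
  · obtain ⟨s, h1, h2, rfl⟩ := h
    refine ⟨by simp [armNames], .diff k s, by cases Y <;> exact h1, .inr (.diff_diff h1 h2)⟩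
  · have hki : Y ≠ .A ∧ k < i := by cases Y <;> simp_all [Family.IsPositive]
    rcases h with ⟨s, h1, h2, rfl⟩ | ⟨s, h1, rfl | rfl⟩ | ⟨rfl, rfl⟩ | ⟨rfl, rfl⟩
    · exact ⟨by simp [armNames], .diff k s, by cases Y <;> exact h1,
        .inr (.diff_sum hki.1 h1 h2)⟩
    · exact ⟨by simp [armNames]; omega, .sum i s, by cases Y <;> simp_all [Family.IsPositive],
        .inl (.diff_sum' hki.1 hki.2 h1)⟩
    · exact ⟨by simp [armNames]; omega, .diff i s, by cases Y <;> exact h1,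
        .inr (.diff_sum'' hki.1 hki.2 h1)⟩
    · exact ⟨by simp [armNames, hki.2.ne], .short i, trivial, .inl (.short_short hki.2)⟩
    · exact ⟨by simp [armNames], .long i, trivial, .inl (.diff_long hki.2)⟩
  · obtain ⟨s, h1, rfl⟩ := h
    cases Y <;> first
      | exact ha.elim
      | exact ⟨by simp [armNames], .short s, trivial, .inl (.diff_short h1)⟩
  · obtain ⟨s, h1, rfl⟩ := h
    cases Y <;> first
      | exact ha.elim
      | exact ⟨by simp [armNames], .diff k s, h1, .inr (.diff_sum_long h1)⟩

set_option maxHeartbeats 1000000 in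
/-- On names, a leg is stable under addition of positive roots, as long as the sum can still be
extended to the root at the corner of the hook. -/
theorem legNames_sum {m : ℕ} {r s u a : RootName m} (ha : Y.IsPositive a) (h : RootSum Y r s u)
    (hu : u.Below a) (hua : u ≠ a) (hr : r ∈ legNames Y a ∨ s ∈ legNames Y a) :
    u ∈ legNames Y a := by
  rcases a with ⟨k, i⟩ | ⟨k, i⟩ | k | k
  · have : k < i := by cases Y <;> exact ha
    cases h <;> simp [legNames, RootName.Below] at hr hu hua ⊢; grind
  · have hki : k < i := by cases Y <;> first | exact ha | exact ha.elim
    cases h <;> simp [legNames, RootName.Below] at hr hu hua ⊢ <;> grind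
  · cases h <;> simp [legNames, RootName.Below] at hr hu hua ⊢ <;> grind
  · cases h <;> simp [legNames, RootName.Below] at hr hu hua ⊢ <;> grind

theorem isArm_arm : IsArm α (arm α) := by
  have key : ∀ β ∈ arm α, ∃ γ ∈ leg α, IsSum β γ α := by
    intro β hβ
    obtain ⟨γ, h⟩ := exists_isSum_of_mem_arm hβ
    refine ⟨γ, mem_leg_iff_isSum.2 ⟨?_, β, h.symm⟩, h⟩
    rcases h.arm_dichotomy with h | h
    exacts [h.2, (h.1 hβ).elim]
  refine ⟨fun β hβ => ?_, ?_, fun β hβ => ?_⟩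
  · obtain ⟨γ, -, h⟩ := key β hβ
    refine ⟨.inr ⟨γ, h⟩, ?_⟩
    rintro rfl
    exact h.height_lt.false
  · choose f hf hf' using key
    refine Set.ncard_congr f (fun β hβ => hf β hβ) ?_ ?_
    · intro β β' hβ hβ' h
      have h1 := (hf' β' hβ').symm
      rw [← h] at h1
      exact (hf' β hβ).symm.right_unique h1
    · intro γ hγ
      obtain ⟨h1, β, h2⟩ := mem_leg_iff_isSum.1 hγ
      have hβ : β ∈ arm α := by
        rcases h2.arm_dichotomy with h | h
        exacts [(h1 h.1).elim, h.2]
      exact ⟨β, hβ, (hf' β hβ).right_unique h2.symm⟩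
  · obtain ⟨γ, h1, h2⟩ := key β hβ
    exact ⟨γ, ⟨h1, h2⟩, fun γ' h => h.2.right_unique h2⟩

theorem exists_leg_of_mem_arm {β : PosRoot Y n} (hβ : β ∈ arm α) : ∃ γ ∈ leg α, IsSum β γ α := by
  obtain ⟨γ, h, -⟩ := isArm_arm.2.2 β hβ
  exact ⟨γ, h⟩

theorem exists_arm_of_mem_leg {γ : PosRoot Y n} (hγ : γ ∈ leg α) : ∃ β ∈ arm α, IsSum β γ α := by
  obtain ⟨h1, β, h2⟩ := mem_leg_iff_isSum.1 hγ
  rcases h2.arm_dichotomy with h | h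
  exacts [(h1 h.1).elim, ⟨β, h.2, h2.symm⟩]

/-! ### The normal pattern `k(α)` -/

theorem normalizes_kStep (i : ℕ) : Normalizes Set.univ (kStep α i) := by
  induction i with
  | zero =>
    intro γ _ β hβ δ h
    obtain ⟨i, hi⟩ := Set.mem_iUnion.1 hβ
    exact Set.mem_iUnion.2 ⟨i + 1, β, hi, γ, h.symm⟩
  | succ i ih =>
    intro γ _ β hβ δ h
    rcases hβ with hβ | hβ
    · exact .inr (hβ.1.1 γ δ h.symm)
    · exact .inr (ih γ trivial β hβ δ h)

theorem normalizes_kPattern : Normalizes Set.univ (kPattern α) := by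
  intro γ _ β hβ δ h
  obtain ⟨i, hi⟩ := Set.mem_iUnion.1 hβ
  exact Set.mem_iUnion.2 ⟨i, normalizes_kStep i γ trivial β hi δ h⟩

theorem mem_kPattern_of_isSum {β δ : PosRoot Y n} (h : IsSum α β δ) : δ ∈ kPattern α :=
  Set.mem_iUnion.2 ⟨0, Set.mem_iUnion.2 ⟨0, α, rfl, β, h⟩⟩

theorem height_lt_of_mem_nStep {i : ℕ} {β : PosRoot Y n} (h : β ∈ nStep α (i + 1)) :
    α.height < β.height := by
  induction i generalizing β with
  | zero =>
    obtain ⟨_, rfl, γ, h⟩ := h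
    exact h.height_lt
  | succ i ih =>
    obtain ⟨β', h', γ, h⟩ := h
    exact (ih h').trans h.height_lt

theorem notMem_kStep_self (i : ℕ) : α ∉ kStep α i := by
  induction i with
  | zero =>
    intro h
    obtain ⟨i, hi⟩ := Set.mem_iUnion.1 h
    exact (height_lt_of_mem_nStep hi).false
  | succ i ih =>
    rintro (h | h)
    exacts [h.2 rfl, ih h]

theorem notMem_kPattern_self : α ∉ kPattern α := fun h => by
  obtain ⟨i, hi⟩ := Set.mem_iUnion.1 h
  exact notMem_kStep_self i hi

/-- Roots of the hook of `α` do not lie in `k(α)`. -/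
theorem notMem_kPattern_of_isSum {β γ : PosRoot Y n} (h : IsSum β γ α) : β ∉ kPattern α :=
  fun hβ => notMem_kPattern_self (normalizes_kPattern γ trivial β hβ α h.symm)

theorem kStep_mono : Monotone (kStep α) :=
  monotone_nat_of_le_succ fun _ => Set.subset_union_right

/-- A root is central modulo `P(k(α))` only if it is `α` or lies in `k(α)`. -/
theorem exists_isSum_notMem_kPattern {β : PosRoot Y n} (hβ : β ∉ kPattern α) (hne : β ≠ α) :
    ∃ γ δ, IsSum β γ δ ∧ δ ∉ kPattern α := by
  by_contra! H
  have H' : ∀ δ : PosRoot Y n, ∃ i, δ ∈ kPattern α → δ ∈ kStep α i := by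
    intro δ
    by_cases h : δ ∈ kPattern α
    · obtain ⟨i, hi⟩ := Set.mem_iUnion.1 h
      exact ⟨i, fun _ => hi⟩
    · exact ⟨0, fun h' => (h h').elim⟩
  choose N hN using H'
  obtain ⟨M, hM⟩ := (Set.finite_range N).bddAbove
  refine hβ (Set.mem_iUnion.2 ⟨M + 1, .inl ⟨⟨fun γ δ h => ?_, ?_⟩, hne⟩⟩)
  · exact kStep_mono (hM ⟨δ, rfl⟩) (hN δ (H γ δ h))
  · exact fun h => hβ (Set.mem_iUnion.2 ⟨M, h⟩)

/-- A property of `α` that is inherited by the summands of a sum of two roots holds for all roots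
outside of `k(α)`: such a root can be turned into `α` by successively adding positive roots. -/
theorem of_notMem_kPattern {p : PosRoot Y n → Prop} (hα : p α)
    (hp : ∀ β γ δ, IsSum β γ δ → p δ → p β) {β : PosRoot Y n} (hβ : β ∉ kPattern α) : p β := by
  obtain ⟨M, hM⟩ := (Set.finite_range (PosRoot.height (Y := Y) (n := n))).bddAbove
  obtain ⟨d, hd⟩ : ∃ d, M - β.height = d := ⟨_, rfl⟩
  induction d using Nat.strong_induction_on generalizing β with
  | _ d ih =>
    by_cases hne : β = α
    · exact hne ▸ hα
    · obtain ⟨γ, δ, h, hδ⟩ := exists_isSum_notMem_kPattern hβ hne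
      have h1 := h.height_lt
      have h2 : δ.height ≤ M := hM ⟨δ, rfl⟩
      exact hp β γ δ h (ih (M - δ.height) (by omega) hδ rfl)

theorem below_of_notMem_kPattern {β : PosRoot Y n} (hβ : β ∉ kPattern α) : β.1.Below α.1 :=
  of_notMem_kPattern (p := fun β => β.1.Below α.1) (RootName.Below.refl _)
    (fun _ _ _ h => h.below) hβ

/-- The leg is stable under addition of positive roots, up to `α` and the roots in `k(α)`. -/
theorem mem_leg_or_mem_kPattern {β γ δ : PosRoot Y n} (hγ : γ ∈ leg α) (h : IsSum β γ δ)
    (hne : δ ≠ α) : δ ∈ leg α ∨ δ ∈ kPattern α := by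
  by_cases hδ : δ ∈ kPattern α
  · exact .inr hδ
  · have hne' : δ.1 ≠ α.1 := fun h => hne (Subtype.ext h)
    refine .inl (mem_leg_of_mem_legNames ?_)
    rcases isSum_iff.1 h with h | h
    · exact legNames_sum α.2 h (below_of_notMem_kPattern hδ) hne'
        (.inr (mem_legNames_of_mem_leg hγ))
    · exact legNames_sum α.2 h (below_of_notMem_kPattern hδ) hne'
        (.inl (mem_legNames_of_mem_leg hγ))

theorem height_lt_of_mem_leg {γ : PosRoot Y n} (hγ : γ ∈ leg α) : γ.height < α.height := by
  obtain ⟨-, β, h⟩ := mem_leg_iff_isSum.1 hγ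
  exact h.height_lt

/-- A sum with a root of the leg that is at least as high as `α` is either `α` itself or lies in
`k(α)`. -/
theorem mem_kPattern_of_height_le {β γ δ : PosRoot Y n} (hγ : γ ∈ leg α) (h : IsSum β γ δ)
    (hne : δ ≠ α) (hle : α.height ≤ δ.height) : δ ∈ kPattern α := by
  rcases mem_leg_or_mem_kPattern hγ h hne with h | h
  · exact absurd (height_lt_of_mem_leg h) hle.not_gt
  · exact h

theorem normalizes_hook_kPattern : Normalizes Set.univ ({α} ∪ leg α ∪ kPattern α) := by
  rintro γ - β ((rfl | hβ) | hβ) δ h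
  · exact .inr (mem_kPattern_of_isSum h.symm)
  · by_cases hne : δ = α
    · exact .inl (.inl hne)
    · rcases mem_leg_or_mem_kPattern hβ h hne with h | h
      exacts [.inl (.inr h), .inr h]
  · exact .inr (normalizes_kPattern γ trivial β hβ δ h)

theorem notMem_arm_self : α ∉ arm α := fun h => by
  obtain ⟨γ, h⟩ := exists_isSum_of_mem_arm h
  exact h.height_lt.false

theorem leg_union_kPattern_subset : leg α ∪ kPattern α ⊆ source α \ {α} := by
  rintro γ (hγ | hγ)
  · exact ⟨fun h => (mem_leg_iff_isSum.1 hγ).1 h, fun h => hγ.2 (.inl h)⟩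
  · refine ⟨fun h => ?_, fun h => notMem_kPattern_self (h ▸ hγ)⟩
    obtain ⟨β, h⟩ := exists_isSum_of_mem_arm h
    exact notMem_kPattern_of_isSum h hγ

theorem isNormalPattern_leg_union_kPattern :
    IsNormalPattern (leg α ∪ kPattern α) (source α) := by
  refine ⟨leg_union_kPattern_subset.trans Set.sdiff_subset, ?_⟩
  rintro β hβ γ (hγ | hγ) δ h
  · by_cases hne : δ = α
    · subst hne
      rcases h.arm_dichotomy with h' | h'
      exacts [(hβ h'.1).elim, ((mem_leg_iff_isSum.1 hγ).1 h'.2).elim]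
    · exact mem_leg_or_mem_kPattern hγ h hne
  · exact .inr (normalizes_kPattern β trivial γ hγ δ h)

/-! ### Commutator relations of root elements -/

section Matrices

variable {R : Type*} [CommRing R] {Y : Family} {m : ℕ}

variable (R) in
/-- The matrix `exp(t e_r)` for the root named `r`. -/
def nameMatrix (Y : Family) (r : RootName m) (t : R) : Matrix (Idx m) (Idx m) R :=
  1 + t • rootVector R Y r + t ^ 2 • rootVectorSq R r

theorem RootSum.isPositive {r s u : RootName m} (h : RootSum Y r s u) (hr : Y.IsPositive r)
    (hs : Y.IsPositive s) : Y.IsPositive u := by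
  cases Y <;> cases h <;> simp_all [Family.IsPositive] <;> omega

theorem commute_nameMatrix_aux {r s : RootName m} {t t' : R}
    (h1 : Commute (rootVector R Y r) (rootVector R Y s))
    (h2 : Commute (rootVector R Y r) (rootVectorSq R s))
    (h3 : Commute (rootVectorSq R r) (rootVector R Y s))
    (h4 : Commute (rootVectorSq R r) (rootVectorSq R s)) :
    Commute (nameMatrix R Y r t) (nameMatrix R Y s t') := by
  have key : ∀ X : Matrix (Idx m) (Idx m) R, Commute X (rootVector R Y s) →
      Commute X (rootVectorSq R s) → Commute X (nameMatrix R Y s t') := fun X ha hb =>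
    ((Commute.one_right X).add_right (ha.smul_right _)).add_right (hb.smul_right _)
  exact ((Commute.one_left _).add_left ((key _ h1 h2).smul_left _)).add_left
    ((key _ h3 h4).smul_left _)

set_option maxHeartbeats 4000000 in
theorem commute_nameMatrix {r s : RootName m} (hr : Y.IsPositive r) (hs : Y.IsPositive s)
    (h : ∀ u, ¬ RootSum Y r s u) (h' : ∀ u, ¬ RootSum Y s r u) (t t' : R) :
    Commute (nameMatrix R Y r t) (nameMatrix R Y s t') := by
  have diff_sum : ∀ {i j k l : Fin m}, Y.IsPositive (.diff i j) → Y.IsPositive (.sum k l) →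
      (∀ u, ¬ RootSum Y (.diff i j) (.sum k l) u) → ∀ t t' : R,
      Commute (nameMatrix R Y (.diff i j) t) (nameMatrix R Y (.sum k l) t') := by
    intro i j k l hr hs h t t'
    have hA : Y ≠ .A := by rintro rfl; exact hs
    have hij : i < j := by cases Y <;> exact hr
    have hkl : k < l := by cases Y <;> first | exact hs | exact hs.elim
    have h1 : j ≠ k := by rintro rfl; exact h _ (.diff_sum hA hij hkl)
    by_cases h2 : j = l
    · subst h2
      obtain h3 | rfl | h3 := lt_trichotomy i k
      · exact (h _ (.diff_sum' hA h3 hkl)).elim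
      · cases Y with
        | A => exact hs.elim
        | C => exact (h _ (.diff_sum_long hij)).elim
        | B | D =>
          apply commute_nameMatrix_aux <;> simp [rootVectorSq, Commute, SemiconjBy, rootVector,
            unitPP, unitNN, unitPN, mul_sub, sub_mul, hij.ne, hij.ne']
      · exact (h _ (.diff_sum'' hA h3 hij)).elim
    · apply commute_nameMatrix_aux <;> cases Y <;> first
        | exact hs.elim
        | simp [rootVectorSq, Commute, SemiconjBy, rootVector,
            unitPP, unitNN, unitPN, mul_sub, sub_mul, mul_add, add_mul, h1, h1.symm, h2, Ne.symm h2]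
  have diff_long : ∀ {i j k : Fin m}, Y.IsPositive (.diff i j) → Y.IsPositive (.long k) →
      (∀ u, ¬ RootSum Y (.diff i j) (.long k) u) → ∀ t t' : R,
      Commute (nameMatrix R Y (.diff i j) t) (nameMatrix R Y (.long k) t') := by
    intro i j k hr hs h t t'
    cases Y <;> first | exact hs.elim | skip
    have h1 : j ≠ k := by rintro rfl; exact h _ (.diff_long hr)
    apply commute_nameMatrix_aux <;> simp [rootVectorSq, Commute, SemiconjBy, rootVector,
      unitPP, unitNN, unitPN, mul_sub, sub_mul, h1, h1.symm]
  have diff_short : ∀ {i j k : Fin m}, Y.IsPositive (.diff i j) → Y.IsPositive (.short k) →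
      (∀ u, ¬ RootSum Y (.diff i j) (.short k) u) → ∀ t t' : R,
      Commute (nameMatrix R Y (.diff i j) t) (nameMatrix R Y (.short k) t') := by
    intro i j k hr hs h t t'
    cases Y <;> first | exact hs.elim | skip
    have h1 : j ≠ k := by rintro rfl; exact h _ (.diff_short hr)
    apply commute_nameMatrix_aux <;> simp [rootVectorSq, Commute, SemiconjBy, rootVector,
      unitPP, unitNN, unitPN, unitPZ, unitZN, mul_sub, sub_mul, h1, h1.symm]
  rcases r with ⟨i, j⟩ | ⟨i, j⟩ | i | i <;> rcases s with ⟨k, l⟩ | ⟨k, l⟩ | k | k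
  · have hij : i < j := by cases Y <;> exact hr
    have hkl : k < l := by cases Y <;> exact hs
    have h1 : j ≠ k := by rintro rfl; exact h _ (.diff_diff hij hkl)
    have h2 : l ≠ i := by rintro rfl; exact h' _ (.diff_diff hkl hij)
    apply commute_nameMatrix_aux <;> cases Y <;> simp [rootVectorSq, Commute, SemiconjBy,
      rootVector, unitPP, unitNN, mul_sub, sub_mul, h1, h1.symm, h2, h2.symm]
  · exact diff_sum hr hs h t t'
  · exact diff_short hr hs h t t'
  · exact diff_long hr hs h t t'
  · exact (diff_sum hs hr h' t' t).symm
  · apply commute_nameMatrix_aux <;> cases Y <;> simp [rootVectorSq, Commute, SemiconjBy,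
      rootVector, unitPN, mul_sub, sub_mul, mul_add, add_mul]
  · apply commute_nameMatrix_aux <;> cases Y <;> simp [rootVectorSq, Commute, SemiconjBy,
      rootVector, unitPN, unitPZ, unitZN, mul_sub, sub_mul, mul_add, add_mul]
  · apply commute_nameMatrix_aux <;> cases Y <;> simp [rootVectorSq, Commute, SemiconjBy,
      rootVector, unitPN, mul_sub, sub_mul, mul_add, add_mul]
  · exact (diff_short hs hr h' t' t).symm
  · apply commute_nameMatrix_aux <;> cases Y <;> simp [rootVectorSq, Commute, SemiconjBy,
      rootVector, unitPN, unitPZ, unitZN, mul_sub, sub_mul, mul_add, add_mul]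
  · cases Y <;> first | exact hs.elim | skip
    obtain h3 | rfl | h3 := lt_trichotomy i k
    · exact (h _ (.short_short h3)).elim
    · apply commute_nameMatrix_aux <;> simp [rootVectorSq, Commute, SemiconjBy,
        rootVector, unitPN, unitPZ, unitZN, mul_sub, sub_mul]
    · exact (h' _ (.short_short h3)).elim
  · cases Y <;> first | exact hs.elim | exact hr.elim
  · exact (diff_long hs hr h' t' t).symm
  · apply commute_nameMatrix_aux <;> cases Y <;> simp [rootVectorSq, Commute, SemiconjBy,
      rootVector, unitPN, mul_sub, sub_mul, mul_add, add_mul]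
  · cases Y <;> first | exact hs.elim | exact hr.elim
  · apply commute_nameMatrix_aux <;> cases Y <;> simp [rootVectorSq, Commute, SemiconjBy,
      rootVector, unitPN]

/-- The structure constants of the commutator relations. -/
def RootSum.IsConst (Y : Family) (c : R) : Prop :=
  c = 1 ∨ c = -1 ∨ (Y = .B ∨ Y = .C) ∧ (c = 2 ∨ c = -2)

set_option maxHeartbeats 4000000 in
theorem RootSum.commutator (R : Type*) [CommRing R] {r s u : RootName m} (h : RootSum Y r s u) :
    ∃ c : R, RootSum.IsConst Y c ∧
      ((∀ t t', nameMatrix R Y r t * nameMatrix R Y s t' =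
          nameMatrix R Y u (c * t * t') * nameMatrix R Y s t' * nameMatrix R Y r t) ∨
        (Y = .B ∨ Y = .C) ∧ ∃ v, (RootSum Y r u v ∨ RootSum Y u s v) ∧
          (∀ w, ¬ RootSum Y u v w ∧ ¬ RootSum Y v u w) ∧
          ∃ e : R → R → R, (∀ t t', e (-t) (-t') = - e t t') ∧
            ∀ t t', nameMatrix R Y r t * nameMatrix R Y s t' =
              nameMatrix R Y u (c * t * t') * nameMatrix R Y v (e t t') * nameMatrix R Y s t' *
                nameMatrix R Y r t) := by
  cases h with
  | @diff_diff _ i j l hij hjl =>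
    refine ⟨1, .inl rfl, .inl fun t t' => ?_⟩
    have hil := hij.trans hjl
    cases Y <;> simp [-Matrix.smul_single, smul_sub, smul_add, nameMatrix, rootVector,
      rootVectorSq, unitPP, unitNN, mul_add, add_mul, mul_sub, sub_mul, hij.ne,
      hjl.ne', hil.ne, hil.ne'] <;> module
  | @diff_sum _ i j l hY hij hjl =>
    refine ⟨1, .inl rfl, .inl fun t t' => ?_⟩
    cases Y <;> first | exact absurd rfl hY | skip
    all_goals
      simp [-Matrix.smul_single, smul_sub, smul_add, nameMatrix, rootVector, rootVectorSq,
        unitPP, unitNN, unitPN, mul_add, add_mul, mul_sub, sub_mul, hij.ne, hjl.ne,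
        hjl.ne']
      module
  | @diff_sum' _ i j l hY hil hlj =>
    have hij := hil.trans hlj
    cases Y <;> first | exact absurd rfl hY | skip
    case C =>
      refine ⟨1, .inl rfl, .inl fun t t' => ?_⟩
      simp [-Matrix.smul_single, smul_sub, smul_add, nameMatrix, rootVector, rootVectorSq,
        unitPP, unitNN, unitPN, mul_add, add_mul, mul_sub, sub_mul, hij.ne, hlj.ne,
        hlj.ne']
      module
    all_goals
      refine ⟨-1, .inr (.inl rfl), .inl fun t t' => ?_⟩
      simp [-Matrix.smul_single, smul_sub, smul_add, nameMatrix, rootVector, rootVectorSq,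
        unitPP, unitNN, unitPN, mul_add, add_mul, mul_sub, sub_mul, hij.ne, hlj.ne,
        hlj.ne']
      module
  | @diff_sum'' _ i j l hY hli hij =>
    refine ⟨1, .inl rfl, .inl fun t t' => ?_⟩
    have hlj := hli.trans hij
    cases Y <;> first | exact absurd rfl hY | skip
    all_goals
      simp [-Matrix.smul_single, smul_sub, smul_add, nameMatrix, rootVector, rootVectorSq,
        unitPP, unitNN, unitPN, mul_add, add_mul, mul_sub, sub_mul, hij.ne, hlj.ne,
        hlj.ne']
      module
  | @diff_sum_long i j hij =>
    refine ⟨2, .inr (.inr ⟨.inr rfl, .inl rfl⟩), .inl fun t t' => ?_⟩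
    simp [-Matrix.smul_single, smul_sub, smul_add, nameMatrix, rootVector, rootVectorSq,
      unitPP, unitNN, unitPN, mul_add, add_mul, mul_sub, sub_mul, hij.ne, hij.ne']
    module
  | @diff_long i j hij =>
    refine ⟨1, .inl rfl, .inr ⟨.inr rfl, .long i, .inl (.diff_sum_long hij), ?_,
      fun t t' => t ^ 2 * t', fun t t' => by ring, fun t t' => ?_⟩⟩
    · rintro w
      constructor <;> rintro ⟨⟩
    · simp [-Matrix.smul_single, smul_sub, smul_add, nameMatrix, rootVector, rootVectorSq,
        unitPP, unitNN, unitPN, mul_add, add_mul, mul_sub, sub_mul, hij.ne]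
      module
  | @diff_short i j hij =>
    refine ⟨1, .inl rfl, .inr ⟨.inl rfl, .sum i j, .inr (.short_short hij), ?_,
      fun t t' => t * t' ^ 2, fun t t' => by ring, fun t t' => ?_⟩⟩
    · rintro w
      constructor <;> rintro ⟨⟩
    · simp [-Matrix.smul_single, smul_sub, smul_add, nameMatrix, rootVector, rootVectorSq,
        unitPP, unitNN, unitPN, unitPZ, unitZN, mul_add, add_mul, mul_sub, sub_mul, hij.ne]
      module
  | @short_short i j hij =>
    refine ⟨-2, .inr (.inr ⟨.inl rfl, .inr rfl⟩), .inl fun t t' => ?_⟩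
    simp [-Matrix.smul_single, smul_sub, smul_add, nameMatrix, rootVector, rootVectorSq,
      unitPN, unitPZ, unitZN, mul_add, add_mul, mul_sub, sub_mul]
    module

end Matrices

/-! ### Root elements and pattern subgroups -/

section PatternGroups

variable {K : Type*} [Field K] {Y : Family} {n : ℕ}

/-- The root element `x_β(t)` as an element of `UY_n`. -/
def rootElt (β : PosRoot Y n) (t : K) : UY K Y n :=
  ⟨rootElement β t, Subgroup.subset_closure ⟨β, t, rfl⟩⟩

theorem UY_ext {g h : UY K Y n}
    (H : ((g : GL (Idx (Y.dim n)) K) : Matrix (Idx (Y.dim n)) (Idx (Y.dim n)) K) =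
      ((h : GL (Idx (Y.dim n)) K) : Matrix (Idx (Y.dim n)) (Idx (Y.dim n)) K)) : g = h :=
  Subtype.ext (Units.ext H)

theorem coe_rootElt (β : PosRoot Y n) (t : K) :
    ((rootElt β t : GL (Idx (Y.dim n)) K) : Matrix (Idx (Y.dim n)) (Idx (Y.dim n)) K) =
      nameMatrix K Y β.1 t := rfl

theorem rootElt_add (β : PosRoot Y n) (t s : K) :
    rootElt β (t + s) = rootElt β t * rootElt β s := by
  apply UY_ext
  rw [Subgroup.coe_mul, Units.val_mul]
  simp only [coe_rootElt, nameMatrix]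
  obtain ⟨h1, h2, h3, h4⟩ := rootVector_relations K β
  simp only [mul_add, add_mul, smul_mul_assoc, mul_smul_comm, h1, h2, h3, h4,
    mul_one, one_mul, smul_zero]
  module

@[simp]
theorem rootElt_zero (β : PosRoot Y n) : rootElt β (0 : K) = 1 := by
  apply UY_ext
  simp [coe_rootElt, nameMatrix]

theorem rootElt_neg (β : PosRoot Y n) (t : K) : rootElt β (-t) = (rootElt β t)⁻¹ := by
  rw [eq_inv_iff_mul_eq_one, ← rootElt_add]
  simp

theorem mem_rootSubgroup {β : PosRoot Y n} {g : UY K Y n} :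
    g ∈ rootSubgroup K β ↔ ∃ t, g = rootElt β t := by
  constructor
  · intro hg
    induction hg using Subgroup.closure_induction with
    | mem g hg =>
      obtain ⟨t, ht⟩ := hg
      exact ⟨t, Subtype.ext ht⟩
    | one => exact ⟨0, by simp⟩
    | mul g h _ _ hg hh =>
      obtain ⟨t, rfl⟩ := hg
      obtain ⟨s, rfl⟩ := hh
      exact ⟨t + s, (rootElt_add β t s).symm⟩
    | inv g _ hg =>
      obtain ⟨t, rfl⟩ := hg
      exact ⟨-t, (rootElt_neg β t).symm⟩
  · rintro ⟨t, rfl⟩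
    exact Subgroup.subset_closure ⟨t, rfl⟩

theorem rootElt_mem_rootSubgroup (β : PosRoot Y n) (t : K) : rootElt β t ∈ rootSubgroup K β :=
  mem_rootSubgroup.2 ⟨t, rfl⟩

theorem rootElt_mem_patternSubgroup {S : Set (PosRoot Y n)} {β : PosRoot Y n} (hβ : β ∈ S)
    (t : K) : rootElt β t ∈ patternSubgroup K S :=
  (le_iSup₂_of_le (f := fun α (_ : α ∈ S) => rootSubgroup K α) β hβ le_rfl)
    (rootElt_mem_rootSubgroup β t)

theorem patternSubgroup_le {S : Set (PosRoot Y n)} {H : Subgroup (UY K Y n)} :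
    patternSubgroup K S ≤ H ↔ ∀ β ∈ S, ∀ t, rootElt β t ∈ H := by
  constructor
  · exact fun h β hβ t => h (rootElt_mem_patternSubgroup hβ t)
  · refine fun h => iSup₂_le fun β hβ g hg => ?_
    obtain ⟨t, rfl⟩ := mem_rootSubgroup.1 hg
    exact h β hβ t

theorem patternSubgroup_mono {S T : Set (PosRoot Y n)} (h : S ⊆ T) :
    patternSubgroup K S ≤ patternSubgroup K T :=
  patternSubgroup_le.2 fun _ hβ t => rootElt_mem_patternSubgroup (h hβ) t

theorem patternSubgroup_univ : patternSubgroup K (Set.univ : Set (PosRoot Y n)) = ⊤ := by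
  rw [eq_top_iff]
  rintro ⟨g, hg⟩ -
  induction hg using Subgroup.closure_induction with
  | mem g hg =>
    obtain ⟨β, t, rfl⟩ := hg
    exact rootElt_mem_patternSubgroup (Set.mem_univ β) t
  | one => exact one_mem _
  | mul g h hg' hh' hg hh => exact mul_mem hg hh
  | inv g hg' hg => exact inv_mem hg

theorem commute_rootElt {β γ : PosRoot Y n} (h : ∀ δ, ¬ IsSum β γ δ) (t s : K) :
    Commute (rootElt β t) (rootElt γ s) := by
  apply UY_ext
  rw [Subgroup.coe_mul, Units.val_mul, Subgroup.coe_mul, Units.val_mul]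
  refine commute_nameMatrix β.2 γ.2 (fun u hu => ?_) (fun u hu => ?_) t s
  · exact h ⟨u, hu.isPositive β.2 γ.2⟩ (isSum_iff.2 (.inl hu))
  · exact h ⟨u, hu.isPositive γ.2 β.2⟩ (isSum_iff.2 (.inr hu))

/-- The condition on the characteristic for the given type, in terms of the field. -/
def Family.GoodChar (Y : Family) (K : Type*) [Field K] : Prop :=
  Y = .B ∨ Y = .C → (2 : K) ≠ 0

theorem RootSum.IsConst.ne_zero {c : K} (hY : Y.GoodChar K) (h : RootSum.IsConst Y c) : c ≠ 0 := by
  rcases h with rfl | rfl | ⟨h, rfl | rfl⟩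
  · exact one_ne_zero
  · exact neg_ne_zero.2 one_ne_zero
  · exact hY h
  · exact neg_ne_zero.2 (hY h)

/-- The commutator relations: up to a factor `y t s` that involves only sums of at least three
roots, the commutator of `x_β(t)` and `x_γ(s)` is `x_{β+γ}(c t s)`. If this factor is not trivial,
then it changes to its inverse when the signs of `t` and `s` are changed, and `2` is invertible. -/
theorem RootSum.commutator_rootElt (hY : Y.GoodChar K) {β γ δ : PosRoot Y n}
    (h : RootSum Y β.1 γ.1 δ.1) :
    ∃ c : K, c ≠ 0 ∧ ∃ y : K → K → UY K Y n,
      (∀ t s, rootElt β t * rootElt γ s =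
        rootElt δ (c * t * s) * y t s * rootElt γ s * rootElt β t) ∧
      (∀ t s, y t s ∈ patternSubgroup K {ε | IsSum β δ ε ∨ IsSum γ δ ε}) ∧
      (∀ t s r, Commute (y t s) (rootElt δ r)) ∧
      ((∀ t s, y t s = 1) ∨ (2 : K) ≠ 0 ∧ ∀ t s, y (-t) (-s) = (y t s)⁻¹) := by
  obtain ⟨c, hc, h' | ⟨hBC, v, hv, hv', e, he, h'⟩⟩ := h.commutator K
  · refine ⟨c, hc.ne_zero hY, fun _ _ => 1, fun t s => ?_, fun t s => one_mem _,
      fun t s r => Commute.one_left _, .inl fun t s => rfl⟩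
    apply UY_ext
    simpa [coe_rootElt] using h' t s
  · have hvp : Y.IsPositive v := by
      rcases hv with hv | hv
      · exact hv.isPositive β.2 δ.2
      · exact hv.isPositive δ.2 γ.2
    obtain ⟨ε, rfl⟩ : ∃ ε : PosRoot Y n, ε.1 = v := ⟨⟨v, hvp⟩, rfl⟩
    refine ⟨c, hc.ne_zero hY, fun t s => rootElt ε (e t s), fun t s => ?_, fun t s => ?_,
      fun t s r => commute_rootElt (fun ε' hε => ?_) _ _, .inr ⟨hY hBC, fun t s => ?_⟩⟩
    · apply UY_ext
      simpa [coe_rootElt] using h' t s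
    · refine rootElt_mem_patternSubgroup ?_ _
      rcases hv with hv | hv
      exacts [.inl (isSum_iff.2 (.inl hv)), .inr (isSum_iff.2 (.inr hv))]
    · rcases isSum_iff.1 hε with h | h
      exacts [(hv' _).2 h, (hv' _).1 h]
    · simp only [he, rootElt_neg]

/-- The leading term of the commutator relation, for summands in either order. -/
theorem IsSum.commutator (hY : Y.GoodChar K) {β γ δ : PosRoot Y n} (h : IsSum β γ δ) :
    ∃ c : K, c ≠ 0 ∧ ∃ y : K → K → UY K Y n,
      (∀ t s, rootElt β t * rootElt γ s =
        rootElt δ (c * t * s) * y t s * rootElt γ s * rootElt β t) ∧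
      ∀ t s, y t s ∈ patternSubgroup K {ε | IsSum β δ ε ∨ IsSum γ δ ε} := by
  rcases isSum_iff.1 h with h | h
  · obtain ⟨c, hc, y, h1, h2, -⟩ := h.commutator_rootElt hY
    exact ⟨c, hc, y, h1, h2⟩
  · obtain ⟨c, hc, y, h1, h2, h3, -⟩ := h.commutator_rootElt hY
    refine ⟨-c, neg_ne_zero.2 hc, fun t s => (y s t)⁻¹, fun t s => ?_, fun t s => ?_⟩
    · have := h1 s t
      rw [show -c * t * s = -(c * s * t) by ring, rootElt_neg, ← (h3 s t _).inv_inv.eq,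
        mul_assoc _ (rootElt γ s), this]
      group
    · simpa only [or_comm] using inv_mem (h2 s t)

/-- A subgroup that contains all commutators of elements of `X_β` and `X_γ` contains
`X_{β+γ}`. -/
theorem IsSum.rootElt_mem (hY : Y.GoodChar K) {β γ δ : PosRoot Y n} (h : IsSum β γ δ)
    {N : Subgroup (UY K Y n)}
    (hN : ∀ t s, rootElt β t * rootElt γ s * (rootElt β t)⁻¹ * (rootElt γ s)⁻¹ ∈ N) (t : K) :
    rootElt δ t ∈ N := by
  wlog h' : RootSum Y β.1 γ.1 δ.1 generalizing β γ
  · refine this h.symm (fun t s => ?_) ((isSum_iff.1 h).resolve_left h')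
    simpa [mul_assoc] using inv_mem (hN s t)
  obtain ⟨c, hc, y, h1, -, h3, h4⟩ := h'.commutator_rootElt hY
  have h5 : ∀ t s, rootElt δ (c * t * s) * y t s ∈ N := by
    intro t s
    have := hN t s
    rwa [h1, mul_inv_cancel_right, mul_inv_cancel_right] at this
  rcases h4 with h4 | ⟨h2, h4⟩
  · have := h5 (t / c) 1
    rwa [h4, mul_one, mul_one, mul_div_cancel₀ _ hc] at this
  · -- The factors `y` of the commutators for `(t, s)` and `(-t, -s)` cancel.
    have := mul_mem (h5 (t / (c * 2)) 1) (h5 (-(t / (c * 2))) (-1))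
    have h6 : c * (t / (c * 2)) * 1 + c * -(t / (c * 2)) * -1 = t := by
      field_simp
      ring
    rwa [h4, mul_assoc, ← mul_assoc (y _ _), (h3 _ _ _).eq, mul_assoc _ (y _ _), mul_inv_cancel,
      mul_one (rootElt _ _), ← rootElt_add, h6] at this

theorem rootElt_conj_mem (hY : Y.GoodChar K) {A : Set (PosRoot Y n)} (hA : IsClosedPattern A)
    {β : PosRoot Y n} (hβ : Normalizes {β} A) (t : K) {g : UY K Y n}
    (hg : g ∈ patternSubgroup K A) :
    rootElt β t * g * (rootElt β t)⁻¹ ∈ patternSubgroup K A := by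
  suffices patternSubgroup K A ≤
      (patternSubgroup K A).comap (MulAut.conj (rootElt β t)).toMonoidHom from this hg
  refine patternSubgroup_le.2 fun γ hγ s => ?_
  change rootElt β t * rootElt γ s * (rootElt β t)⁻¹ ∈ patternSubgroup K A
  by_cases h : ∃ δ, IsSum β γ δ
  · obtain ⟨δ, h⟩ := h
    obtain ⟨c, -, y, h1, h2⟩ := h.commutator hY
    have hδ : δ ∈ A := hβ β rfl γ hγ δ h
    rw [h1, mul_inv_cancel_right]
    refine mul_mem (mul_mem (rootElt_mem_patternSubgroup hδ _)
      (patternSubgroup_mono ?_ (h2 t s))) (rootElt_mem_patternSubgroup hγ _)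
    rintro ε (hε | hε)
    exacts [hβ β rfl δ hδ ε hε, hA γ hγ δ hδ ε hε]
  · rw [(commute_rootElt (not_exists.1 h) t s).eq, mul_inv_cancel_right]
    exact rootElt_mem_patternSubgroup hγ _

theorem patternSubgroup_le_normalizer (hY : Y.GoodChar K) {A B : Set (PosRoot Y n)}
    (hA : IsClosedPattern A) (hB : Normalizes B A) :
    patternSubgroup K B ≤ Subgroup.normalizer (patternSubgroup K A : Set (UY K Y n)) := by
  refine patternSubgroup_le.2 fun β hβ t => Subgroup.mem_normalizer_iff.2 fun g => ⟨fun hg => ?_,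
    fun hg => ?_⟩
  · exact rootElt_conj_mem hY hA (fun β' hβ' => hβ' ▸ hB β hβ) t hg
  · have := rootElt_conj_mem hY hA (β := β) (fun β' hβ' => hβ' ▸ hB β hβ) (-t) hg
    rw [rootElt_neg] at this
    simpa [mul_assoc] using this

theorem Normalizes.isClosedPattern {A : Set (PosRoot Y n)} (hA : Normalizes Set.univ A) :
    IsClosedPattern A := fun α _ β hβ γ h => hA α trivial β hβ γ h

theorem normal_patternSubgroup (hY : Y.GoodChar K) {A : Set (PosRoot Y n)}
    (hA : Normalizes Set.univ A) : (patternSubgroup K A).Normal :=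
  Subgroup.normalizer_eq_top_iff.1 (top_le_iff.1
    (patternSubgroup_univ.symm.trans_le (patternSubgroup_le_normalizer hY hA.isClosedPattern hA)))

/-- The product of the root elements `x_β(f(β))` for `β` in a list of roots. -/
def listProd (L : List (PosRoot Y n)) (f : PosRoot Y n → K) : UY K Y n :=
  (L.map fun β => rootElt β (f β)).prod

@[simp]
theorem listProd_nil (f : PosRoot Y n → K) : listProd [] f = 1 := rfl

@[simp]
theorem listProd_cons (β : PosRoot Y n) (L : List (PosRoot Y n)) (f : PosRoot Y n → K) :
    listProd (β :: L) f = rootElt β (f β) * listProd L f := by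
  simp [listProd]

theorem listProd_congr {L : List (PosRoot Y n)} {f g : PosRoot Y n → K}
    (h : ∀ β ∈ L, f β = g β) : listProd L f = listProd L g := by
  unfold listProd
  congr 1
  exact List.map_congr_left fun β hβ => by rw [h β hβ]

/-- Let `Q ⊆ A` be closed patterns. Then `P(A)` is the product of the root subgroups for
`A \ Q`, in the order of increasing heights, and of `P(Q)`: each of these root subgroups normalizes
the product of the following factors. -/
theorem exists_listProd_mul (hY : Y.GoodChar K) {Q : Set (PosRoot Y n)} (hQ : IsClosedPattern Q)
    (L : List (PosRoot Y n)) (hL : L.Pairwise fun β γ => β.height ≤ γ.height) (hL' : L.Nodup)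
    (hLQ : ∀ β ∈ L, β ∉ Q) (hA : IsClosedPattern (Q ∪ {β | β ∈ L})) {g : UY K Y n}
    (hg : g ∈ patternSubgroup K (Q ∪ {β | β ∈ L})) :
    ∃ f : PosRoot Y n → K, ∃ s ∈ patternSubgroup K Q, g = listProd L f * s := by
  induction L generalizing g with
  | nil => exact ⟨0, g, by simpa using hg, by simp⟩
  | cons β L ih =>
    rw [List.pairwise_cons] at hL
    rw [List.nodup_cons] at hL'
    have hmem : ∀ γ ∈ Q ∪ {γ | γ ∈ β :: L}, γ = β ∨ γ ∈ Q ∪ {γ | γ ∈ L} := by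
      rintro γ (h | h)
      · exact .inr (.inl h)
      · rcases List.mem_cons.1 h with h | h
        exacts [.inl h, .inr (.inr h)]
    have hsub : Q ∪ {γ | γ ∈ L} ⊆ Q ∪ {γ | γ ∈ β :: L} :=
      Set.union_subset_union_right _ fun γ hγ => List.mem_cons_of_mem _ hγ
    have hA' : IsClosedPattern (Q ∪ {γ | γ ∈ L}) := by
      intro γ hγ γ' hγ' δ h
      refine (hmem δ (hA γ (hsub hγ) γ' (hsub hγ') δ h)).resolve_left ?_
      rintro rfl
      have h1 := h.height_lt
      have h2 := h.symm.height_lt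
      have h3 : ∀ γ ∈ Q ∪ {γ | γ ∈ L}, γ.height < δ.height → γ ∈ Q := by
        rintro γ (hγ | hγ) hlt
        exacts [hγ, absurd (hL.1 γ hγ) hlt.not_ge]
      exact hLQ δ List.mem_cons_self (hQ γ (h3 γ hγ h1) γ' (h3 γ' hγ' h2) δ h)
    have hnorm : Normalizes {β} (Q ∪ {γ | γ ∈ L}) := by
      rintro _ rfl γ hγ δ h
      refine (hmem δ (hA _ (.inr List.mem_cons_self) γ (hsub hγ) δ h)).resolve_left ?_
      rintro rfl
      exact h.height_lt.false
    have hle : rootSubgroup K β ≤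
        Subgroup.normalizer (patternSubgroup K (Q ∪ {γ | γ ∈ L}) : Set (UY K Y n)) := by
      refine le_trans (fun h hh => ?_) (patternSubgroup_le_normalizer hY hA' hnorm)
      obtain ⟨t, rfl⟩ := mem_rootSubgroup.1 hh
      exact rootElt_mem_patternSubgroup (Set.mem_singleton β) t
    have hg' : g ∈ rootSubgroup K β ⊔ patternSubgroup K (Q ∪ {γ | γ ∈ L}) := by
      refine patternSubgroup_le.2 (fun γ hγ t => ?_) hg
      rcases hmem γ hγ with rfl | hγ
      · exact Subgroup.mem_sup_left (rootElt_mem_rootSubgroup _ t)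
      · exact Subgroup.mem_sup_right (rootElt_mem_patternSubgroup hγ t)
    rw [← SetLike.mem_coe, Subgroup.coe_mul_of_left_le_normalizer_right _ _ hle] at hg'
    obtain ⟨x, hx, g', hg', rfl⟩ := hg'
    obtain ⟨t, rfl⟩ := mem_rootSubgroup.1 hx
    obtain ⟨f, s, hs, rfl⟩ := ih hL.2 hL'.2 (fun γ hγ => hLQ γ (List.mem_cons_of_mem _ hγ)) hA' hg'
    classical
    refine ⟨Function.update f β t, s, hs, ?_⟩
    have : listProd L (Function.update f β t) = listProd L f := listProd_congr fun γ hγ => by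
      rw [Function.update_of_ne]
      rintro rfl
      exact hL'.1 hγ
    rw [listProd_cons, this, Function.update_self, mul_assoc]

/-- The elements of a set of roots, in the order of increasing heights. -/
theorem exists_sorted_list (A : Set (PosRoot Y n)) :
    ∃ L : List (PosRoot Y n), L.Pairwise (fun β γ => β.height ≤ γ.height) ∧ L.Nodup ∧
      ∀ β, β ∈ L ↔ β ∈ A := by
  classical
  let l := (Set.toFinite A).toFinset.toList
  let r : PosRoot Y n → PosRoot Y n → Prop := fun β γ => β.height ≤ γ.height
  have : Std.Total r := ⟨fun β γ => le_total _ _⟩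
  have : IsTrans _ r := ⟨fun β γ δ h h' => le_trans h h'⟩
  refine ⟨l.insertionSort r, List.pairwise_insertionSort r l, ?_, fun β => ?_⟩
  · exact (List.perm_insertionSort r l).nodup_iff.2 (Finset.nodup_toList _)
  · rw [(List.perm_insertionSort r l).mem_iff]
    simp [l]

end PatternGroups

/-! ### The projection of the source group onto the root subgroup -/

section Entries

variable {R : Type*} [CommRing R] {Y : Family} {m : ℕ}

/-- The row of the matrix entry of `g` that detects the coefficient of `x_a(t)` in `g`. -/
def RootName.row : RootName m → Idx m
  | .diff i _ => .inl i
  | .sum k _ => .inl k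
  | .short k => .inl k
  | .long k => .inl k

/-- The column of the matrix entry of `g` that detects the coefficient of `x_a(t)` in `g`. -/
def RootName.col : RootName m → Idx m
  | .diff _ j => .inl j
  | .sum _ i => .inr (.inr i)
  | .short _ => .inr (.inl ())
  | .long k => .inr (.inr k)

/-- An initial segment of the indices that contains the row but not the column of the entry
belonging to `a`. -/
def RootName.Low : RootName m → Idx m → Prop
  | .diff _ j, .inl s => s < j
  | .sum _ i, .inl s => s < i
  | .short k, .inl s => s ≤ k
  | .long _, .inl _ => True
  | _, .inr _ => False

/-- The block shape of the matrices in the source group of the root named `a`: block upper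
triangular, the row of `a` is trivial on the initial segment of indices, and the column of `a` is
trivial on the complementary segment. -/
structure IsSourceMatrix (a : RootName m) (g : Matrix (Idx m) (Idx m) R) : Prop where
  block : ∀ c d, ¬ a.Low c → a.Low d → g c d = 0
  row : ∀ d, a.Low d → g a.row d = (1 : Matrix (Idx m) (Idx m) R) a.row d
  col : ∀ c, ¬ a.Low c → g c a.col = (1 : Matrix (Idx m) (Idx m) R) c a.col

theorem RootName.low_row {a : RootName m} (ha : Y.IsPositive a) : a.Low a.row := by
  cases a <;> cases Y <;> simp_all [Family.IsPositive, RootName.Low, RootName.row]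

theorem RootName.not_low_col (a : RootName m) : ¬ a.Low a.col := by
  cases a <;> simp [RootName.Low, RootName.col]

theorem IsSourceMatrix.one (a : RootName m) :
    IsSourceMatrix a (1 : Matrix (Idx m) (Idx m) R) where
  block c d hc hd := Matrix.one_apply_ne (by rintro rfl; exact hc hd)
  row _ _ := rfl
  col _ _ := rfl

theorem IsSourceMatrix.mul {a : RootName m} (ha : Y.IsPositive a)
    {g h : Matrix (Idx m) (Idx m) R} (hg : IsSourceMatrix a g) (hh : IsSourceMatrix a h) :
    IsSourceMatrix a (g * h) where
  block c d hc hd := by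
    rw [Matrix.mul_apply]
    refine Finset.sum_eq_zero fun e _ => ?_
    by_cases he : a.Low e
    · simp [hg.block c e hc he]
    · simp [hh.block e d he hd]
  row d hd := by
    rw [Matrix.mul_apply, Finset.sum_eq_single a.row, hg.row _ (RootName.low_row ha), hh.row d hd]
    · simp
    · intro e _ hne
      by_cases he : a.Low e
      · simp [hg.row e he, Matrix.one_apply_ne (Ne.symm hne)]
      · simp [hh.block e d he hd]
    · simp
  col c hc := by
    rw [Matrix.mul_apply, Finset.sum_eq_single a.col, hh.col _ a.not_low_col, hg.col c hc]
    · simp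
    · intro e _ hne
      by_cases he : a.Low e
      · simp [hg.block c e hc he]
      · simp [hh.col e he, Matrix.one_apply_ne hne]
    · simp

theorem IsSourceMatrix.entry_mul {a : RootName m} (ha : Y.IsPositive a)
    {g h : Matrix (Idx m) (Idx m) R} (hg : IsSourceMatrix a g) (hh : IsSourceMatrix a h) :
    (g * h) a.row a.col = g a.row a.col + h a.row a.col := by
  have hne : a.row ≠ a.col := fun h => a.not_low_col (h ▸ RootName.low_row ha)
  rw [Matrix.mul_apply, Finset.sum_eq_add a.row a.col hne, hg.row _ (RootName.low_row ha),
    hh.col _ a.not_low_col]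
  · simp [add_comm]
  · rintro e _ ⟨h1, h2⟩
    by_cases he : a.Low e
    · simp [hg.row e he, Matrix.one_apply_ne (Ne.symm h1)]
    · simp [hh.col e he, Matrix.one_apply_ne h2]
  · simp
  · simp

/-- The positions at which the matrix `x_r(t)` may differ from the identity matrix. -/
inductive RootName.Supp : RootName m → Idx m → Idx m → Prop
  | diff (i j : Fin m) : Supp (.diff i j) (.inl i) (.inl j)
  | diff' (i j : Fin m) : Supp (.diff i j) (.inr (.inr j)) (.inr (.inr i))
  | sum (i j : Fin m) : Supp (.sum i j) (.inl i) (.inr (.inr j))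
  | sum' (i j : Fin m) : Supp (.sum i j) (.inl j) (.inr (.inr i))
  | short (i : Fin m) : Supp (.short i) (.inl i) (.inr (.inl ()))
  | short' (i : Fin m) : Supp (.short i) (.inr (.inl ())) (.inr (.inr i))
  | short'' (i : Fin m) : Supp (.short i) (.inl i) (.inr (.inr i))
  | long (i : Fin m) : Supp (.long i) (.inl i) (.inr (.inr i))

theorem single_apply_eq_zero {ι : Type*} [DecidableEq ι] {P : ι → ι → Prop} {i j : ι} (h : P i j)
    {c d : ι} (hcd : ¬ P c d) (x : R) : Matrix.single i j x c d = 0 :=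
  Matrix.single_apply_of_ne i j x c d (by rintro ⟨rfl, rfl⟩; exact hcd h)

theorem nameMatrix_apply_of_not_supp {r : RootName m} {c d : Idx m} (h : ¬ r.Supp c d) (t : R) :
    nameMatrix R Y r t c d = (1 : Matrix (Idx m) (Idx m) R) c d := by
  suffices rootVector R Y r c d = 0 ∧ rootVectorSq R r c d = 0 by
    simp [nameMatrix, this.1, this.2]
  rcases r with ⟨i, j⟩ | ⟨i, j⟩ | i | i
  · have h1 := single_apply_eq_zero (.diff i j) h (1 : R)
    have h2 := single_apply_eq_zero (.diff' i j) h (1 : R)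
    cases Y <;> simp [rootVector, rootVectorSq, unitPP, unitNN, h1, h2]
  · have h1 := single_apply_eq_zero (.sum i j) h (1 : R)
    have h2 := single_apply_eq_zero (.sum' i j) h (1 : R)
    cases Y <;> simp [rootVector, rootVectorSq, unitPN, h1, h2]
  · have h1 := single_apply_eq_zero (.short i) h (2 : R)
    have h2 := single_apply_eq_zero (.short' i) h (1 : R)
    have h3 := single_apply_eq_zero (.short'' i) h (1 : R)
    cases Y <;> simp [rootVector, rootVectorSq, unitPZ, unitZN, unitPN, h1, h2, h3]
  · have h1 := single_apply_eq_zero (.long i) h (1 : R)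
    cases Y <;> simp [rootVector, rootVectorSq, unitPN, h1]

theorem isSourceMatrix_nameMatrix {a r : RootName m} (ha : Y.IsPositive a) (hr : Y.IsPositive r)
    (h : r ∉ armNames a) (t : R) : IsSourceMatrix a (nameMatrix R Y r t) := by
  have hr' : match r with
      | .diff i j => i < j
      | .sum i j => i < j
      | .short _ => Y = .B
      | .long _ => Y = .C := by
    cases r <;> cases Y <;> first | exact hr | exact hr.elim | rfl
  have ha' : match a with
      | .diff i j => i < j
      | .sum i j => i < j
      | .short _ => Y = .B
      | .long _ => Y = .C := by
    cases a <;> cases Y <;> first | exact ha | exact ha.elim | rfl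
  constructor
  · intro c d hc hd
    have hne : c ≠ d := by rintro rfl; exact hc hd
    rw [nameMatrix_apply_of_not_supp, Matrix.one_apply_ne hne]
    intro hs
    cases hs <;> cases a <;> simp [RootName.Low] at hc hd hr' <;> omega
  · intro d hd
    refine nameMatrix_apply_of_not_supp (fun hs => ?_) t
    generalize hc : a.row = c at hs
    cases hs <;> cases a <;> simp [RootName.Low, RootName.row, armNames] at hc hd h hr' <;> grind
  · intro c hc
    refine nameMatrix_apply_of_not_supp (fun hs => ?_) t
    generalize hd : a.col = d at hs
    cases hs <;> cases a <;>
      simp [RootName.Low, RootName.col, armNames] at hc hd h hr' ha' <;> grind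

/-- The entry of `x_a(1)` that belongs to `a`. -/
def RootName.scale (R : Type*) [CommRing R] : RootName m → R
  | .short _ => 2
  | _ => 1

theorem nameMatrix_apply_row_col_of_ne {a r : RootName m} (ha : Y.IsPositive a)
    (hr : Y.IsPositive r) (hne : r ≠ a) (t : R) : nameMatrix R Y r t a.row a.col = 0 := by
  have hne' : a.row ≠ a.col := fun h => a.not_low_col (h ▸ RootName.low_row ha)
  rw [nameMatrix_apply_of_not_supp, Matrix.one_apply_ne hne']
  intro hs
  generalize hc : a.row = c at hs
  generalize hd : a.col = d at hs
  cases hs <;> cases a <;> simp [RootName.row, RootName.col] at hc hd hne <;>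
    cases Y <;> simp_all [Family.IsPositive] <;> omega

theorem nameMatrix_apply_row_col_self {a : RootName m} (ha : Y.IsPositive a) (t : R) :
    nameMatrix R Y a t a.row a.col = a.scale R * t := by
  cases a <;> cases Y <;>
    simp_all [Family.IsPositive, RootName.row, RootName.col, RootName.scale, nameMatrix,
      rootVector, rootVectorSq, unitPP, unitPN, unitNN, unitPZ, unitZN, Matrix.one_apply,
      Matrix.single_apply, mul_comm] <;> grind

end Entries

section Projection

variable {K : Type*} [Field K] {Y : Family} {n : ℕ}

/-- The matrix of an element of `UY_n`. -/
def UY.mat (g : UY K Y n) : Matrix (Idx (Y.dim n)) (Idx (Y.dim n)) K :=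
  ((g : GL (Idx (Y.dim n)) K) : Matrix (Idx (Y.dim n)) (Idx (Y.dim n)) K)

theorem UY.mat_mul (g h : UY K Y n) : UY.mat (g * h) = UY.mat g * UY.mat h := rfl

variable {α : PosRoot Y n}

theorem isSourceMatrix_of_mem {g : UY K Y n} (hg : g ∈ sourceGroup K α) :
    IsSourceMatrix α.1 (UY.mat g) := by
  let H : Subgroup (UY K Y n) :=
    { carrier := {g | IsSourceMatrix α.1 (UY.mat g) ∧ IsSourceMatrix α.1 (UY.mat g⁻¹)}
      one_mem' := ⟨IsSourceMatrix.one _, by rw [inv_one]; exact IsSourceMatrix.one _⟩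
      mul_mem' := fun {g h} hg hh => ⟨hg.1.mul α.2 hh.1, by
        rw [mul_inv_rev]; exact hh.2.mul α.2 hg.2⟩
      inv_mem' := fun {g} hg => ⟨hg.2, by rw [inv_inv]; exact hg.1⟩ }
  have key : ∀ β ∈ source α, ∀ t : K, IsSourceMatrix α.1 (UY.mat (rootElt β t)) :=
    fun β hβ t => isSourceMatrix_nameMatrix α.2 β.2 hβ t
  have : sourceGroup K α ≤ H := patternSubgroup_le.2 fun β hβ t => ⟨key β hβ t, by
    rw [← rootElt_neg]; exact key β hβ _⟩
  exact (this hg).1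

theorem RootName.scale_ne_zero (hY : Y.GoodChar K) : α.1.scale K ≠ 0 := by
  obtain ⟨a, ha⟩ := α
  cases a <;> first
    | exact one_ne_zero
    | (cases Y <;> first | exact ha.elim | exact hY (.inl rfl))

/-- The coefficient of `x_α(t)` in an element of the source group. -/
def sourceCoeff (α : PosRoot Y n) (g : sourceGroup K α) : K :=
  (α.1.scale K)⁻¹ * UY.mat (g : UY K Y n) α.1.row α.1.col

theorem sourceCoeff_mul (g h : sourceGroup K α) :
    sourceCoeff α (g * h) = sourceCoeff α g + sourceCoeff α h := by
  rw [sourceCoeff, Subgroup.coe_mul, UY.mat_mul,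
    (isSourceMatrix_of_mem g.2).entry_mul α.2 (isSourceMatrix_of_mem h.2), mul_add]
  rfl

theorem sourceCoeff_rootElt (hY : Y.GoodChar K) (t : K) (h : rootElt α t ∈ sourceGroup K α) :
    sourceCoeff α ⟨rootElt α t, h⟩ = t := by
  rw [sourceCoeff]
  change _ * nameMatrix K Y α.1 t _ _ = t
  rw [nameMatrix_apply_row_col_self α.2, inv_mul_cancel_left₀ (RootName.scale_ne_zero hY)]

theorem sourceCoeff_eq_zero {g : sourceGroup K α}
    (hg : (g : UY K Y n) ∈ patternSubgroup K (source α \ {α})) : sourceCoeff α g = 0 := by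
  let f : sourceGroup K α →* Multiplicative K :=
    { toFun := fun g => .ofAdd (sourceCoeff α g)
      map_one' := by
        have := sourceCoeff_mul (1 : sourceGroup K α) 1
        rw [mul_one, left_eq_add] at this
        rw [this]
        rfl
      map_mul' := fun g h => by rw [sourceCoeff_mul]; rfl }
  have : patternSubgroup K (source α \ {α}) ≤ f.ker.map (sourceGroup K α).subtype := by
    refine patternSubgroup_le.2 fun β hβ t => ?_
    refine ⟨⟨rootElt β t, rootElt_mem_patternSubgroup hβ.1 t⟩, ?_, rfl⟩
    change Multiplicative.ofAdd (_ * nameMatrix K Y β.1 t _ _) = 1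
    rw [nameMatrix_apply_row_col_of_ne α.2 β.2 (fun h => hβ.2 (Subtype.ext h)), mul_zero]
    rfl
  obtain ⟨g', h1, h2⟩ := this hg
  have h3 : g' = g := Subtype.ext h2
  rw [← h3]
  exact h1

/-- The projection of the source group onto the root subgroup. -/
def rootProj (α : PosRoot Y n) : sourceGroup K α →* rootSubgroup K α where
  toFun g := ⟨rootElt α (sourceCoeff α g), rootElt_mem_rootSubgroup _ _⟩
  map_one' := by
    have := sourceCoeff_mul (1 : sourceGroup K α) 1
    rw [mul_one, left_eq_add] at this
    exact Subtype.ext ((congrArg (rootElt α) this).trans (rootElt_zero α))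
  map_mul' g h := Subtype.ext
    ((congrArg (rootElt α) (sourceCoeff_mul g h)).trans (rootElt_add α _ _))

theorem isRootProjection_rootProj (hY : Y.GoodChar K) :
    IsRootProjection α (rootProj (K := K) α) := by
  refine ⟨fun u hu => ?_, fun u hu => Subtype.ext ?_⟩
  · obtain ⟨t, ht⟩ := mem_rootSubgroup.1 hu
    obtain ⟨u, hu'⟩ := u
    obtain rfl : u = rootElt α t := ht
    exact congrArg (rootElt α) (sourceCoeff_rootElt hY t hu')
  · change rootElt α (sourceCoeff α u) = 1
    rw [sourceCoeff_eq_zero hu, rootElt_zero]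

end Projection

/-! ### Irreducible representations of finite groups -/

section Representations

variable {G : Type*} [Group G]

theorem isIrreducible_iff {V : Type*} [AddCommGroup V] [Module ℂ V] {ρ : Representation ℂ G V} :
    ρ.IsIrreducible ↔ Nontrivial V ∧
      ∀ W : Submodule ℂ V, (∀ g, ∀ w ∈ W, ρ g w ∈ W) → W = ⊥ ∨ W = ⊤ := by
  constructor
  · intro h
    refine ⟨?_, fun W hW => ?_⟩
    · by_contra hV
      rw [not_nontrivial_iff_subsingleton] at hV
      have : Subsingleton (Subrepresentation ρ) :=
        Subrepresentation.toSubmodule_injective.subsingleton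
      exact not_subsingleton _ this
    · have := eq_bot_or_eq_top (⟨W, fun g w hw => hW g w hw⟩ : Subrepresentation ρ)
      exact this.imp (congrArg Subrepresentation.toSubmodule) (congrArg Subrepresentation.toSubmodule)
  · rintro ⟨hV, h⟩
    have : Nontrivial (Subrepresentation ρ) :=
      ⟨⊥, ⊤, fun h => bot_ne_top (congrArg Subrepresentation.toSubmodule h)⟩
    refine ⟨fun W => ?_⟩
    exact (h W.toSubmodule fun g w hw => W.apply_mem_toSubmodule g hw).imp
      (fun h => Subrepresentation.ext h) (fun h => Subrepresentation.ext h)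

/-- The character of an irreducible representation on an arbitrary finite-dimensional space belongs
to `Irr G`, as witnessed by a representation on some `ℂ ^ d` with the same scalars. -/
theorem exists_fin_representation {V : Type*} [AddCommGroup V] [Module ℂ V]
    [FiniteDimensional ℂ V] (ρ : Representation ℂ G V) (hρ : ρ.IsIrreducible) :
    ∃ (d : ℕ) (ρ' : Representation ℂ G (Fin d → ℂ)), ρ'.IsIrreducible ∧
      ρ'.character = ρ.character ∧ ∀ g (c : ℂ), ρ g = c • 1 → ρ' g = c • 1 := by
  let e := (Module.finBasis ℂ V).equivFun
  let ρ' : Representation ℂ G (Fin (Module.finrank ℂ V) → ℂ) :=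
    { toFun := fun g => e.conj (ρ g)
      map_one' := by rw [map_one]; exact LinearEquiv.conj_id e
      map_mul' := fun g h => by rw [map_mul]; exact LinearEquiv.conj_comp e _ _ }
  refine ⟨_, ρ', ?_, ?_, ?_⟩
  · rw [isIrreducible_iff] at hρ ⊢
    obtain ⟨hV, hρ⟩ := hρ
    refine ⟨e.symm.toEquiv.nontrivial, fun W hW => ?_⟩
    have := hρ (W.comap e.toLinearMap) fun g w hw => by
      have := hW g _ hw
      simpa [ρ', LinearEquiv.conj_apply] using this
    rcases this with h | h
    · left
      rw [eq_bot_iff]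
      intro w hw
      have h1 : e.symm w ∈ W.comap e.toLinearMap := by simpa using hw
      rw [h, Submodule.mem_bot] at h1
      simpa using h1
    · right
      rw [eq_top_iff]
      intro w _
      have h1 : e.symm w ∈ W.comap e.toLinearMap := h ▸ trivial
      simpa using h1
  · ext g
    exact LinearMap.trace_conj' _ _
  · intro g c h
    change e.conj (ρ g) = _
    rw [h, map_smul]
    congr 1
    exact LinearEquiv.conj_id e

section FiniteDim

variable {V : Type*} [AddCommGroup V] [Module ℂ V] [FiniteDimensional ℂ V]
  {ρ : Representation ℂ G V}

/-- Schur's lemma. -/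
theorem eq_smul_one_of_commute (hρ : ρ.IsIrreducible) {f : Module.End ℂ V}
    (hf : ∀ g, Commute f (ρ g)) : ∃ c : ℂ, f = c • 1 := by
  obtain ⟨hV, h⟩ := isIrreducible_iff.1 hρ
  obtain ⟨c, hc⟩ := Module.End.exists_eigenvalue f
  refine ⟨c, ?_⟩
  have := h (f.eigenspace c) fun g w hw => by
    rw [Module.End.mem_eigenspace_iff] at hw ⊢
    rw [← Module.End.mul_apply, (hf g).eq, Module.End.mul_apply, hw, map_smul]
  rcases this with h | h
  · exact absurd h hc
  · ext v
    have hv : v ∈ f.eigenspace c := h ▸ trivial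
    simpa using Module.End.mem_eigenspace_iff.1 hv

theorem character_one_pos (hρ : ρ.IsIrreducible) : ∃ d : ℕ, 0 < d ∧ ρ.character 1 = d := by
  obtain ⟨hV, -⟩ := isIrreducible_iff.1 hρ
  exact ⟨Module.finrank ℂ V, Module.finrank_pos, ρ.char_one⟩

theorem character_one_ne_zero (hρ : ρ.IsIrreducible) : ρ.character 1 ≠ 0 := by
  obtain ⟨d, h1, h2⟩ := character_one_pos hρ
  rw [h2]
  exact_mod_cast h1.ne'

omit [FiniteDimensional ℂ V] in
theorem character_of_eq_smul_one {g : G} {c : ℂ} (h : ρ g = c • 1) :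
    ρ.character g = c * ρ.character 1 := by
  rw [Representation.character, h, map_smul, Representation.character, map_one ρ, smul_eq_mul]

omit [FiniteDimensional ℂ V] in
theorem norm_eq_one_of_eq_smul_one [Finite G] (hρ : ρ.IsIrreducible) {g : G} {c : ℂ}
    (h : ρ g = c • 1) : ‖c‖ = 1 := by
  obtain ⟨hV, -⟩ := isIrreducible_iff.1 hρ
  have h1 : ρ (g ^ orderOf g) = 1 := by rw [pow_orderOf_eq_one, map_one]
  rw [map_pow, h, smul_pow, one_pow] at h1
  obtain ⟨v, hv⟩ := exists_ne (0 : V)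
  have h2 : c ^ orderOf g • v = (1 : ℂ) • v := by simpa using LinearMap.congr_fun h1 v
  exact Complex.norm_eq_one_of_pow_eq_one (smul_left_injective ℂ hv h2) (orderOf_pos g).ne'

theorem eq_one_of_sum_eq_card {s : Multiset ℝ} (h : ∀ x ∈ s, x ≤ 1) (hs : s.sum = s.card) :
    ∀ x ∈ s, x = 1 := by
  induction s using Multiset.induction with
  | empty => simp
  | cons a s ih =>
    have h1 : a ≤ 1 := h a (Multiset.mem_cons_self a s)
    have h2 : s.sum ≤ s.card := by
      simpa using Multiset.sum_le_card_nsmul s 1 fun x hx => h x (Multiset.mem_cons_of_mem hx)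
    rw [Multiset.sum_cons, Multiset.card_cons, Nat.cast_add, Nat.cast_one] at hs
    intro x hx
    rcases Multiset.mem_cons.1 hx with rfl | hx
    · linarith
    · exact ih (fun x hx => h x (Multiset.mem_cons_of_mem hx)) (by linarith) x hx

/-- If a sum of `d` complex numbers of absolute value `1` has absolute value `d`, then all summands
coincide. -/
theorem eq_of_norm_sum_eq_card {s : Multiset ℂ} (h : ∀ z ∈ s, ‖z‖ = 1) (hs : ‖s.sum‖ = s.card)
    (h0 : s ≠ 0) : ∃ u, ∀ z ∈ s, z = u := by
  have hpos : (0 : ℝ) < s.card := by exact_mod_cast Multiset.card_pos.2 h0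
  set c : ℂ := (starRingEnd ℂ) (s.sum / s.card) with hc
  have hcn : ‖c‖ = 1 := by simp [hc, hs, hpos.ne']
  have h1 : ((s.map fun z => (c * z).re).sum : ℝ) = s.card := by
    have h2 : (s.map fun z => (c * z).re).sum = (c * s.sum).re := by
      clear_value c
      clear h hs h0 hpos hc
      induction s using Multiset.induction with
      | empty => simp
      | cons a s ih =>
        rw [Multiset.map_cons, Multiset.sum_cons, Multiset.sum_cons, ih, mul_add, Complex.add_re]
    have h3 : c * s.sum = (s.card : ℂ) := by
      have h4 : (s.card : ℂ) ≠ 0 := by exact_mod_cast hpos.ne'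
      rw [hc, map_div₀, Complex.conj_natCast, div_mul_eq_mul_div, Complex.conj_mul', hs]
      field_simp
      norm_cast
    rw [h2, h3, Complex.natCast_re]
  have key : ∀ z ∈ s, c * z = 1 := by
    intro z hz
    have hn : ‖c * z‖ = 1 := by rw [norm_mul, hcn, h z hz, one_mul]
    have hre : (c * z).re = 1 := by
      refine eq_one_of_sum_eq_card (s := s.map fun z => (c * z).re) ?_ (by simpa using h1) _
        (Multiset.mem_map_of_mem _ hz)
      intro x hx
      obtain ⟨w, hw, rfl⟩ := Multiset.mem_map.1 hx
      exact (Complex.re_le_norm _).trans (by rw [norm_mul, hcn, h w hw, one_mul])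
    have h5 := Complex.sq_norm (c * z)
    rw [hn, Complex.normSq_apply, hre] at h5
    refine Complex.ext (by simpa using hre) ?_
    have : (c * z).im * (c * z).im = 0 := by linarith
    simpa using this
  have hc0 : c ≠ 0 := by rw [← norm_ne_zero_iff, hcn]; exact one_ne_zero
  exact ⟨c⁻¹, fun z hz => (eq_inv_of_mul_eq_one_right (key z hz))⟩

open Polynomial in
/-- An automorphism of finite order of a complex vector space is scalar if the absolute value of its
trace is the dimension. -/
theorem eq_smul_one_of_norm_trace {f : Module.End ℂ V} {N : ℕ} (hN : N ≠ 0) (hf : f ^ N = 1)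
    (ht : ‖LinearMap.trace ℂ V f‖ = Module.finrank ℂ V) (hV : Nontrivial V) :
    ∃ c : ℂ, f = c • 1 := by
  have hsplit : f.charpoly.Splits := IsAlgClosed.splits _
  have hcard : f.charpoly.roots.card = Module.finrank ℂ V := by
    rw [← hsplit.natDegree_eq_card_roots, LinearMap.charpoly_natDegree]
  obtain ⟨c, hc⟩ := eq_of_norm_sum_eq_card (s := f.charpoly.roots) (fun z hz => by
      have hz' := (Module.End.hasEigenvalue_iff_isRoot_charpoly f z).2 (isRoot_of_mem_roots hz)
      obtain ⟨v, hv⟩ := hz'.exists_hasEigenvector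
      have h1 : f.HasEigenvector z v := hv
      have h2 := h1.pow_apply N
      rw [hf, Module.End.one_apply] at h2
      have h3 : z ^ N • v = (1 : ℂ) • v := by rw [one_smul, ← h2]
      exact Complex.norm_eq_one_of_pow_eq_one (smul_left_injective ℂ hv.2 h3) hN)
    (by rw [← Module.End.trace_eq_sum_roots_charpoly_of_splits hsplit, ht, hcard])
    (by
      rw [← Multiset.card_pos, hcard]
      exact Module.finrank_pos)
  refine ⟨c, ?_⟩
  have hchar : f.charpoly = (X - C c) ^ Module.finrank ℂ V := by
    rw [hsplit.eq_prod_roots_of_monic f.charpoly_monic, Multiset.eq_replicate.2 ⟨hcard, hc⟩]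
    simp
  have hnil : IsNilpotent (f - algebraMap ℂ _ c) := by
    refine ⟨Module.finrank ℂ V, ?_⟩
    have := f.aeval_self_charpoly
    rwa [hchar, map_pow, map_sub, aeval_X, aeval_C] at this
  have hss : f.IsSemisimple := by
    refine Module.End.isSemisimple_of_squarefree_aeval_eq_zero (p := X ^ N - C 1)
      (separable_X_pow_sub_C 1 (by exact_mod_cast hN) one_ne_zero).squarefree ?_
    simp [hf]
  have := Module.End.eq_zero_of_isNilpotent_isSemisimple hnil
    (Module.End.isSemisimple_sub_algebraMap_iff.2 hss)
  rw [sub_eq_zero] at this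
  rw [this, Algebra.algebraMap_eq_smul_one]

/-- An element of the center of a character acts as a scalar: the trace is a sum of as many roots of
unity as the degree says, so if its absolute value is the degree, then they all coincide; and the
matrix is diagonalizable. -/
theorem mem_charCenter_iff [Finite G] (hρ : ρ.IsIrreducible) {g : G} :
    g ∈ charCenter ρ.character ↔ ∃ c : ℂ, ρ g = c • 1 := by
  constructor
  · intro h
    refine eq_smul_one_of_norm_trace (orderOf_pos g).ne' (f := ρ g)
      (by rw [← map_pow, pow_orderOf_eq_one, map_one]) ?_ (isIrreducible_iff.1 hρ).1
    have h' : ((‖ρ.character g‖ : ℝ) : ℂ) = ρ.character 1 := h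
    rw [ρ.char_one] at h'
    exact_mod_cast h'
  · rintro ⟨c, hc⟩
    obtain ⟨d, -, hd⟩ := character_one_pos hρ
    change ((‖ρ.character g‖ : ℝ) : ℂ) = _
    rw [character_of_eq_smul_one hc, norm_mul, norm_eq_one_of_eq_smul_one hρ hc, hd]
    simp

theorem mem_charKernel_iff [Finite G] (hρ : ρ.IsIrreducible) {g : G} :
    g ∈ charKernel ρ.character ↔ ρ g = 1 := by
  constructor
  · intro h
    have h' : ρ.character g = ρ.character 1 := h
    obtain ⟨d, -, hd⟩ := character_one_pos hρ
    obtain ⟨c, hc⟩ := (mem_charCenter_iff hρ (g := g)).1 (by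
      change ((‖ρ.character g‖ : ℝ) : ℂ) = _
      rw [h', hd]
      simp)
    rw [character_of_eq_smul_one hc] at h'
    rw [hc, mul_right_cancel₀ (character_one_ne_zero hρ) (h'.trans (one_mul _).symm), one_smul]
  · intro h
    change ρ.character g = ρ.character 1
    rw [Representation.character, h, Representation.character, map_one ρ]

end FiniteDim
end Representations

/-! ### Clifford theory for a linear character of a normal subgroup -/

section Clifford

variable {G : Type*} [Group G] {V : Subgroup G} [V.Normal]

/-- `H` is the inertia group of the linear character `ν` of the normal subgroup `V`. -/
def IsInertia (ν : V →* ℂ) (H : Subgroup G) : Prop :=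
  ∀ g, g ∈ H ↔ ∀ v : V, ν (MulAut.conjNormal g v) = ν v

variable {M : Type*} [AddCommGroup M] [Module ℂ M]

/-- The projection onto the subspace on which `V` acts by the linear character `ν`. -/
noncomputable def charProj [Fintype V] (ν : V →* ℂ) (ρ : Representation ℂ G M) : Module.End ℂ M :=
  (Fintype.card V : ℂ)⁻¹ • ∑ v : V, ν v⁻¹ • ρ v

variable [Fintype V] {ν : V →* ℂ} {H : Subgroup G} {ρ : Representation ℂ G M}

omit [V.Normal] [Fintype V] in
theorem map_inv_mul_self (ν : V →* ℂ) (v : V) : ν v⁻¹ * ν v = 1 := by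
  rw [← map_mul, inv_mul_cancel, map_one]

omit [V.Normal] in
theorem charProj_mul (v : V) : charProj ν ρ * ρ v = ν v • charProj ν ρ := by
  rw [charProj, smul_mul_assoc, smul_comm]
  congr 1
  rw [Finset.sum_mul, Finset.smul_sum]
  refine Fintype.sum_equiv (Equiv.mulRight v) _ _ fun w => ?_
  rw [Equiv.coe_mulRight, smul_mul_assoc, ← map_mul, Subgroup.coe_mul, smul_smul, mul_inv_rev,
    map_mul ν, ← mul_assoc, mul_comm (ν v), map_inv_mul_self, one_mul]

omit [V.Normal] in
theorem mul_charProj (v : V) : ρ v * charProj ν ρ = ν v • charProj ν ρ := by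
  rw [charProj, mul_smul_comm, smul_comm]
  congr 1
  rw [Finset.mul_sum, Finset.smul_sum]
  refine Fintype.sum_equiv (Equiv.mulLeft v) _ _ fun w => ?_
  rw [Equiv.coe_mulLeft, mul_smul_comm, ← map_mul, Subgroup.coe_mul, smul_smul, mul_inv_rev,
    map_mul ν, mul_comm (ν w⁻¹), ← mul_assoc, mul_comm (ν v), map_inv_mul_self, one_mul]

omit [V.Normal] in
theorem charProj_apply_of_forall {m : M} (h : ∀ v : V, ρ v m = ν v • m) :
    charProj ν ρ m = m := by
  have hc : (Fintype.card V : ℂ) ≠ 0 := by exact_mod_cast Fintype.card_ne_zero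
  rw [charProj, LinearMap.smul_apply, LinearMap.sum_apply]
  simp only [LinearMap.smul_apply, h, smul_smul, map_inv_mul_self, one_smul, Finset.sum_const,
    Finset.card_univ]
  rw [← Nat.cast_smul_eq_nsmul ℂ, smul_smul, inv_mul_cancel₀ hc, one_smul]

omit [V.Normal] in
theorem charProj_apply_charProj (m : M) : charProj ν ρ (charProj ν ρ m) = charProj ν ρ m :=
  charProj_apply_of_forall fun v => LinearMap.congr_fun (mul_charProj v) m

omit [V.Normal] in
theorem charProj_mul_self : charProj ν ρ * charProj ν ρ = charProj ν ρ :=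
  LinearMap.ext charProj_apply_charProj

theorem charProj_comm (hH : IsInertia ν H) {h : G} (hh : h ∈ H) :
    ρ h * charProj ν ρ = charProj ν ρ * ρ h := by
  rw [charProj, mul_smul_comm, smul_mul_assoc]
  congr 1
  rw [Finset.mul_sum, Finset.sum_mul]
  refine Fintype.sum_equiv (MulAut.conjNormal h).toEquiv _ _ fun v => ?_
  change _ = ν (MulAut.conjNormal h v)⁻¹ • ρ (MulAut.conjNormal h v) * ρ h
  rw [mul_smul_comm, smul_mul_assoc, ← map_inv, (hH h).1 hh, ← map_mul, ← map_mul,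
    MulAut.conjNormal_apply, inv_mul_cancel_right]

theorem charProj_mul_mul_charProj (hH : IsInertia ν H) {g : G} (hg : g ∉ H) :
    charProj ν ρ * ρ g * charProj ν ρ = 0 := by
  have hg' : g⁻¹ ∉ H := fun h => hg (by simpa using inv_mem h)
  rw [hH, not_forall] at hg'
  obtain ⟨v, hv⟩ := hg'
  have h1 : ρ v * (ρ g * charProj ν ρ) = ν (MulAut.conjNormal g⁻¹ v) • (ρ g * charProj ν ρ) := by
    rw [← mul_smul_comm, ← mul_charProj, ← mul_assoc, ← mul_assoc, ← map_mul, ← map_mul,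
      MulAut.conjNormal_apply]
    congr 2
    group
  have h2 : ν v • (charProj ν ρ * (ρ g * charProj ν ρ)) =
      ν (MulAut.conjNormal g⁻¹ v) • (charProj ν ρ * (ρ g * charProj ν ρ)) := by
    rw [← smul_mul_assoc, ← charProj_mul, mul_assoc, h1, mul_smul_comm]
  rw [← sub_eq_zero, ← sub_smul, smul_eq_zero, sub_eq_zero] at h2
  rw [mul_assoc]
  exact h2.resolve_left (Ne.symm hv)

omit [V.Normal] in
/-- The trace of `ρ(h)` on the range of the projection `charProj ν ρ`. -/
theorem trace_mul_charProj (h : G) : LinearMap.trace ℂ M (ρ h * charProj ν ρ) =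
    (Fintype.card V : ℂ)⁻¹ * ∑ v : V, ν v⁻¹ * ρ.character (h * v) := by
  rw [charProj, mul_smul_comm, map_smul, Finset.mul_sum, map_sum, smul_eq_mul]
  congr 1
  refine Finset.sum_congr rfl fun v _ => ?_
  rw [mul_smul_comm, map_smul, smul_eq_mul, ← map_mul]
  rfl

variable [Fintype G]

/-- If the conjugates of the projection `charProj ν ρ` add up to a multiple of the identity, then
the character of `ρ` is induced from the inertia group. -/
theorem character_eq_induced (hH : IsInertia ν H)
    (hsum : ∑ x : G, ρ x * charProj ν ρ * ρ x⁻¹ = (Nat.card H : ℂ) • 1) :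
    ρ.character =
      induced H fun h => LinearMap.trace ℂ M (ρ h * charProj ν ρ) := by
  have hcard : (Nat.card H : ℂ) ≠ 0 := by exact_mod_cast Nat.card_pos.ne'
  ext g
  rw [induced, finsum_eq_sum_of_fintype, eq_inv_mul_iff_mul_eq₀ hcard]
  have h1 : (Nat.card H : ℂ) * ρ.character g =
      LinearMap.trace ℂ M (ρ g * ∑ x : G, ρ x * charProj ν ρ * ρ x⁻¹) := by
    rw [hsum, mul_smul_comm, mul_one, map_smul, smul_eq_mul]
    rfl
  rw [h1, Finset.mul_sum, map_sum]
  refine Finset.sum_congr rfl fun x _ => ?_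
  have h2 : LinearMap.trace ℂ M (ρ g * (ρ x * charProj ν ρ * ρ x⁻¹)) =
      LinearMap.trace ℂ M (ρ (x⁻¹ * g * x) * charProj ν ρ) := by
    rw [← mul_assoc, LinearMap.trace_mul_comm, ← mul_assoc, ← mul_assoc, ← map_mul, ← map_mul]
  rw [h2]
  split_ifs with hx
  · rfl
  · rw [← charProj_mul_self, ← mul_assoc, LinearMap.trace_mul_comm, ← mul_assoc,
      charProj_mul_mul_charProj hH hx, map_zero]

omit [V.Normal] [Fintype G] in
/-- If `τ` is the representation of `H` on the range of the projection, then its character is the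
trace on that range. -/
theorem trace_mul_charProj_eq {N : Type*} [AddCommGroup N] [Module ℂ N] [FiniteDimensional ℂ N]
    [FiniteDimensional ℂ M]
    {τ : Representation ℂ H N} {i : N →ₗ[ℂ] M} {q : M →ₗ[ℂ] N} (hqi : ∀ n, q (i n) = n)
    (hiq : ∀ m, i (q m) = charProj ν ρ m) (hτ : ∀ (h : H) n, ρ h (i n) = i (τ h n)) (h : H) :
    LinearMap.trace ℂ M (ρ h * charProj ν ρ) = τ.character h := by
  have h1 : ρ h * charProj ν ρ = (i ∘ₗ τ h) ∘ₗ q := by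
    ext m
    simp [← hiq, hτ]
  have h2 : q ∘ₗ (i ∘ₗ τ h) = τ h := by
    ext n
    simp [hqi]
  rw [h1, LinearMap.trace_comp_comm', h2]
  rfl

/-- The Clifford correspondence, from the group to the inertia group: an irreducible representation
whose restriction to `V` contains `ν` is induced from an irreducible representation of the inertia
group in which `V` acts by `ν`. -/
theorem exists_inertia_representation [FiniteDimensional ℂ M] (hH : IsInertia ν H) (hVH : V ≤ H)
    (hρ : ρ.IsIrreducible) (he : charProj ν ρ ≠ 0) :
    ∃ (d : ℕ) (τ : Representation ℂ H (Fin d → ℂ)), τ.IsIrreducible ∧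
      (∀ v : V, τ ⟨v, hVH v.2⟩ = ν v • 1) ∧ ρ.character = induced H τ.character := by
  classical
  -- The sum is scalar by Schur's lemma; multiplication by the projection determines the scalar.
  have hsum : ∑ x : G, ρ x * charProj ν ρ * ρ x⁻¹ = (Nat.card H : ℂ) • 1 := by
    obtain ⟨c, hc⟩ := eq_smul_one_of_commute hρ (f := ∑ x : G, ρ x * charProj ν ρ * ρ x⁻¹) (by
      intro g
      change _ * _ = _ * _
      rw [Finset.sum_mul, Finset.mul_sum]
      refine Fintype.sum_equiv (Equiv.mulLeft g⁻¹) _ _ fun x => ?_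
      rw [Equiv.coe_mulLeft, ← mul_assoc, ← mul_assoc, ← map_mul, mul_inv_cancel_left, mul_assoc,
        ← map_mul, mul_inv_rev, inv_inv])
    have h1 : (∑ x : G, ρ x * charProj ν ρ * ρ x⁻¹) * charProj ν ρ =
        (Nat.card H : ℂ) • charProj ν ρ := by
      have h2 : ∀ x : G, ρ x * charProj ν ρ * ρ x⁻¹ * charProj ν ρ =
          if x ∈ H then charProj ν ρ else 0 := by
        intro x
        split_ifs with hx
        · rw [mul_assoc, charProj_comm hH (inv_mem hx), mul_assoc, ← mul_assoc (charProj ν ρ),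
            charProj_mul_self, ← charProj_comm hH (inv_mem hx), ← mul_assoc, ← map_mul,
            mul_inv_cancel, map_one, one_mul]
        · rw [mul_assoc, mul_assoc, ← mul_assoc (charProj ν ρ),
            charProj_mul_mul_charProj hH (fun h => hx (by simpa using inv_mem h)), mul_zero]
      rw [Finset.sum_mul, Finset.sum_congr rfl fun x _ => h2 x, ← Finset.sum_filter,
        Finset.sum_const, ← Nat.cast_smul_eq_nsmul ℂ, Nat.card_eq_fintype_card,
        Fintype.card_subtype]
    rw [hc, smul_mul_assoc, one_mul, ← sub_eq_zero, ← sub_smul, smul_eq_zero] at h1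
    rw [hc, sub_eq_zero.1 (h1.resolve_right he)]
  let N : Submodule ℂ M := LinearMap.range (charProj ν ρ)
  have hN : ∀ m ∈ N, charProj ν ρ m = m := by
    rintro _ ⟨m, rfl⟩
    exact charProj_apply_charProj m
  have hNH : ∀ h ∈ H, ∀ m ∈ N, ρ h m ∈ N := by
    rintro h hh _ ⟨m, rfl⟩
    exact ⟨ρ h m, (LinearMap.congr_fun (charProj_comm hH hh) m).symm⟩
  let τ : Representation ℂ H N :=
    { toFun := fun h => (ρ h).restrict (hNH h h.2)
      map_one' := by ext; simp
      map_mul' := fun _ _ => by ext; simp }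
  have hτ : τ.IsIrreducible := by
    rw [isIrreducible_iff]
    refine ⟨?_, fun N' hN' => ?_⟩
    · obtain ⟨m, hm⟩ : ∃ m, charProj ν ρ m ≠ 0 := by
        by_contra! h
        exact he (LinearMap.ext h)
      exact ⟨⟨⟨_, m, rfl⟩, 0, fun h => hm (congrArg Subtype.val h)⟩⟩
    · rw [or_iff_not_imp_left]
      intro hne
      obtain ⟨n, hn, hn0⟩ := N'.ne_bot_iff.1 hne
      -- The vectors all of whose translates are projected into `N'` form a subrepresentation.
      let W : Submodule ℂ M := ⨅ g : G, (N'.map N.subtype).comap (charProj ν ρ * ρ g)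
      have hW : ∀ m, m ∈ W ↔ ∀ g, charProj ν ρ (ρ g m) ∈ N'.map N.subtype := fun m => by
        simp [W, Submodule.mem_iInf]
      have hWtop : W = ⊤ := by
        refine ((isIrreducible_iff.1 hρ).2 W fun g w hw => ?_).resolve_left ?_
        · rw [hW] at hw ⊢
          intro g'
          have := hw (g' * g)
          rwa [map_mul] at this
        · rw [← ne_eq, Submodule.ne_bot_iff]
          refine ⟨n, (hW _).2 fun g => ?_, fun h => hn0 (Subtype.ext h)⟩
          by_cases hg : g ∈ H
          · rw [hN _ (hNH g hg n n.2)]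
            exact ⟨τ ⟨g, hg⟩ n, hN' ⟨g, hg⟩ n hn, rfl⟩
          · have := LinearMap.congr_fun (charProj_mul_mul_charProj hH hg (ρ := ρ)) n
            simp only [Module.End.mul_apply, hN n n.2, LinearMap.zero_apply] at this
            rw [this]
            exact zero_mem _
      rw [eq_top_iff]
      intro m _
      have hm : (m : M) ∈ W := hWtop ▸ trivial
      have := (hW _).1 hm 1
      rw [map_one, Module.End.one_apply, hN m m.2] at this
      obtain ⟨m', h1, h2⟩ := this
      rwa [← Subtype.ext h2]
  obtain ⟨d, τ', h1, h2, h3⟩ := exists_fin_representation τ hτ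
  refine ⟨d, τ', h1, fun v => h3 _ _ ?_, ?_⟩
  · ext m
    have := LinearMap.congr_fun (mul_charProj (ν := ν) (ρ := ρ) v) m
    simp only [Module.End.mul_apply, hN m m.2, LinearMap.smul_apply] at this
    exact this
  · rw [h2, character_eq_induced hH hsum]
    congr 1
    ext h
    exact trace_mul_charProj_eq (i := N.subtype) (q := (charProj ν ρ).codRestrict N fun m => ⟨m, rfl⟩)
      (fun n => Subtype.ext (hN n n.2)) (fun m => rfl) (fun h n => rfl) h

/-- The Clifford correspondence, from the inertia group to the group: an irreducible representation
of the inertia group in which `V` acts by `ν` induces an irreducible representation. It is realized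
on the coinduced module, and its character determines the original one. -/
theorem exists_induced_representation {N : Type*} [AddCommGroup N] [Module ℂ N]
    [FiniteDimensional ℂ N] (hH : IsInertia ν H) (hVH : V ≤ H) (τ : Representation ℂ H N)
    (hτ : τ.IsIrreducible) (hτν : ∀ v : V, τ ⟨v, hVH v.2⟩ = ν v • 1) :
    ∃ (d : ℕ) (ρ : Representation ℂ G (Fin d → ℂ)), ρ.IsIrreducible ∧
      ρ.character = induced H τ.character ∧
      (∀ h : H, τ.character h =
        (Fintype.card V : ℂ)⁻¹ * ∑ v : V, ν v⁻¹ * induced H τ.character (h * v)) ∧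
      ∀ (v : V) (c : ℂ), (∀ g, ν (MulAut.conjNormal g v) = c) → ρ v = c • 1 := by
  classical
  let M := Representation.coindV H.subtype τ
  let ρ : Representation ℂ G M := Representation.coind H.subtype τ
  have hM : ∀ (f : M) (h : H) (g : G), f.1 (h * g) = τ h (f.1 g) := fun f h g => f.2 h g
  have hρ : ∀ (f : M) (x g : G), (ρ g f).1 x = f.1 (x * g) := fun f x g => rfl
  have hVact : ∀ (v : V) (f : M) (x : G), (ρ v f).1 x = ν (MulAut.conjNormal x v) • f.1 x := by
    intro v f x
    have h1 := hM f ⟨MulAut.conjNormal x v, hVH (MulAut.conjNormal x v).2⟩ x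
    rw [hτν, MulAut.conjNormal_apply, inv_mul_cancel_right] at h1
    exact h1
  let ev : G → M →ₗ[ℂ] N := fun x => LinearMap.proj x ∘ₗ M.subtype
  have hc : (Fintype.card V : ℂ) ≠ 0 := by exact_mod_cast Fintype.card_ne_zero
  -- On the coinduced module, the projection is the restriction of functions to `H`.
  have hproj : ∀ (f : M) (x : G), (charProj ν ρ f).1 x = if x ∈ H then f.1 x else 0 := by
    intro f x
    have h1 : (charProj ν ρ f).1 x =
        ((Fintype.card V : ℂ)⁻¹ * ∑ v : V, ν v⁻¹ * ν (MulAut.conjNormal x v)) • f.1 x := by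
      change ev x (charProj ν ρ f) = _
      rw [charProj, LinearMap.smul_apply, map_smul, LinearMap.sum_apply, map_sum, mul_smul,
        Finset.sum_smul]
      congr 1
      refine Finset.sum_congr rfl fun v _ => ?_
      rw [LinearMap.smul_apply, map_smul, mul_smul]
      exact congrArg _ (hVact v f x)
    rw [h1]
    split_ifs with hx
    · simp only [(hH x).1 hx, map_inv_mul_self, Finset.sum_const, Finset.card_univ, nsmul_eq_mul,
        mul_one, inv_mul_cancel₀ hc, one_smul]
    · let φ : V →* ℂ :=
        { toFun := fun v => ν v⁻¹ * ν (MulAut.conjNormal x v)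
          map_one' := by simp
          map_mul' := fun v w => by simp only [mul_inv_rev, map_mul]; ring }
      have hφ : φ ≠ 1 := by
        intro h
        refine hx ((hH x).2 fun v => ?_)
        have h2 : ν v⁻¹ * ν (MulAut.conjNormal x v) = 1 := DFunLike.congr_fun h v
        rw [← mul_one (ν v), ← h2, ← mul_assoc, mul_comm (ν v), map_inv_mul_self, one_mul]
      have h2 : ∑ v : V, ν v⁻¹ * ν (MulAut.conjNormal x v) = 0 := sum_hom_units_eq_zero φ hφ
      rw [h2, mul_zero, zero_smul]
  -- The embedding of `N` as the space of the functions that are supported on `H`.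
  let i : N →ₗ[ℂ] M :=
    { toFun := fun n => ⟨fun x => if hx : x ∈ H then τ ⟨x, hx⟩ n else 0, fun h x => by
        beta_reduce
        by_cases hx : x ∈ H
        · have h1 : H.subtype h * x ∈ H := mul_mem h.2 hx
          rw [dif_pos hx, dif_pos h1, ← Module.End.mul_apply, ← map_mul]
          rfl
        · have h1 : H.subtype h * x ∉ H := fun h' => hx ((H.mul_mem_cancel_left h.2).1 h')
          rw [dif_neg hx, dif_neg h1, map_zero]⟩
      map_add' := fun n n' => by
        ext x
        by_cases hx : x ∈ H <;> simp [hx]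
      map_smul' := fun c n => by
        ext x
        by_cases hx : x ∈ H <;> simp [hx] }
  have hi : ∀ (n : N) (x : G) (hx : x ∈ H), (i n).1 x = τ ⟨x, hx⟩ n := fun n x hx => dif_pos hx
  have hi' : ∀ (n : N) (x : G), x ∉ H → (i n).1 x = 0 := fun n x hx => dif_neg hx
  have hqi : ∀ n, ev 1 (i n) = n := by
    intro n
    change (i n).1 1 = n
    rw [hi n 1 (one_mem H)]
    exact LinearMap.congr_fun (map_one τ) n
  have hiq : ∀ f, i (ev 1 f) = charProj ν ρ f := by
    intro f
    ext x
    rw [hproj]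
    split_ifs with hx
    · rw [hi _ x hx]
      change τ ⟨x, hx⟩ (f.1 1) = _
      rw [← hM, mul_one]
    · rw [hi' _ x hx]
  have hτi : ∀ (h : H) (n : N), ρ h (i n) = i (τ h n) := by
    intro h n
    ext x
    rw [hρ]
    by_cases hx : x ∈ H
    · rw [hi _ x hx, hi _ _ (mul_mem hx h.2), ← Module.End.mul_apply, ← map_mul]
      rfl
    · rw [hi' _ x hx, hi' _ _ fun h' => hx ((H.mul_mem_cancel_right h.2).1 h')]
  have hsum : ∑ x : G, ρ x * charProj ν ρ * ρ x⁻¹ = (Nat.card H : ℂ) • 1 := by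
    ext f x
    change ev x ((∑ g : G, ρ g * charProj ν ρ * ρ g⁻¹) f) = (Nat.card H : ℂ) • f.1 x
    rw [LinearMap.sum_apply, map_sum]
    have h1 : ∀ g : G, ev x ((ρ g * charProj ν ρ * ρ g⁻¹) f) = if x * g ∈ H then f.1 x else 0 := by
      intro g
      change (ρ g (charProj ν ρ (ρ g⁻¹ f))).1 x = _
      rw [hρ, hproj, hρ, mul_inv_cancel_right]
    rw [Finset.sum_congr rfl fun g _ => h1 g, Nat.card_eq_fintype_card, Fintype.card_subtype,
      Nat.cast_smul_eq_nsmul ℂ, ← Finset.sum_const, Finset.sum_filter]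
    exact Fintype.sum_equiv (Equiv.mulLeft x) _ _ fun g => rfl
  have hirr : ρ.IsIrreducible := by
    rw [isIrreducible_iff] at hτ ⊢
    obtain ⟨hN, hτ⟩ := hτ
    refine ⟨(Function.LeftInverse.injective hqi).nontrivial, fun W hW => ?_⟩
    rw [or_iff_not_imp_left]
    intro hne
    rw [← ne_eq, Submodule.ne_bot_iff] at hne
    obtain ⟨w, hw, hw0⟩ := hne
    have hcardH : (Nat.card H : ℂ) ≠ 0 := by exact_mod_cast Nat.card_pos.ne'
    have hWproj : ∀ w ∈ W, charProj ν ρ w ∈ W := by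
      intro w hw
      rw [charProj, LinearMap.smul_apply, LinearMap.sum_apply]
      exact W.smul_mem _ (W.sum_mem fun v _ => W.smul_mem _ (hW _ _ hw))
    have hsum' : ∀ f, (Nat.card H : ℂ) • f = ∑ x : G, ρ x (charProj ν ρ (ρ x⁻¹ f)) := by
      intro f
      have := LinearMap.congr_fun hsum f
      rw [LinearMap.sum_apply] at this
      exact this.symm
    have hN' : W.comap i ≠ ⊥ := by
      intro hbot
      have h1 : ∀ w ∈ W, charProj ν ρ w = 0 := by
        intro w hw
        have h2 : ev 1 w ∈ W.comap i := by
          rw [Submodule.mem_comap, hiq]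
          exact hWproj w hw
        rw [hbot, Submodule.mem_bot] at h2
        rw [← hiq, h2, map_zero]
      have h2 := hsum' w
      rw [Finset.sum_eq_zero fun x _ => by rw [h1 _ (hW _ _ hw), map_zero]] at h2
      exact hw0 ((smul_eq_zero.1 h2).resolve_left hcardH)
    have htop := (hτ (W.comap i) fun h n hn => by
      rw [Submodule.mem_comap] at hn ⊢
      rw [← hτi]
      exact hW _ _ hn).resolve_left hN'
    rw [eq_top_iff]
    intro f _
    have h1 : (Nat.card H : ℂ) • f ∈ W := by
      rw [hsum']
      refine W.sum_mem fun x _ => hW _ _ ?_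
      rw [← hiq]
      have : ev 1 (ρ x⁻¹ f) ∈ W.comap i := htop ▸ trivial
      exact this
    exact (Submodule.smul_mem_iff _ hcardH).1 h1
  obtain ⟨d, ρ', h1, h2, h3⟩ := exists_fin_representation ρ hirr
  have h4 : ∀ h : H, LinearMap.trace ℂ M (ρ h * charProj ν ρ) = τ.character h :=
    trace_mul_charProj_eq hqi hiq hτi
  have h5 : ρ.character = induced H τ.character := by
    rw [character_eq_induced hH hsum]
    congr 1
    ext h
    exact h4 h
  refine ⟨d, ρ', h1, h2.trans h5, fun h => ?_, fun v c hv => h3 _ _ ?_⟩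
  · rw [← h4, trace_mul_charProj, h5]
  · ext f x
    rw [hVact, hv]
    rfl

end Clifford

/-! ### The source group as an inertia group -/

section Inertia

variable {K : Type*} [Field K] {Y : Family} {n : ℕ} {α : PosRoot Y n}

attribute [local irreducible] rootElt rootProj

theorem patternSubgroup_le_ker {M : Type*} [Monoid M] {φ : UY K Y n →* M}
    {N : Set (PosRoot Y n)} : patternSubgroup K N ≤ φ.ker ↔ ∀ δ ∈ N, ∀ t, φ (rootElt δ t) = 1 :=
  patternSubgroup_le

/-- Modulo a normal pattern that contains the sum of two roots, their root elements commute. -/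
theorem commute_map_rootElt (hY : Y.GoodChar K) {M : Type*} [Monoid M] {φ : UY K Y n →* M}
    {N : Set (PosRoot Y n)} (hN : Normalizes Set.univ N) (hφ : patternSubgroup K N ≤ φ.ker)
    {β γ : PosRoot Y n} (h : ∀ δ, IsSum β γ δ → δ ∈ N) (t s : K) :
    Commute (φ (rootElt β t)) (φ (rootElt γ s)) := by
  by_cases hsum : ∃ δ, IsSum β γ δ
  · obtain ⟨δ, hδ⟩ := hsum
    obtain ⟨c, -, y, h1, h2⟩ := hδ.commutator hY
    have h3 : φ (rootElt δ (c * t * s)) = 1 := hφ (rootElt_mem_patternSubgroup (h δ hδ) _)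
    have h4 : φ (y t s) = 1 := by
      refine hφ (patternSubgroup_mono ?_ (h2 t s))
      rintro ε (hε | hε)
      exacts [hN β trivial δ (h δ hδ) ε hε, hN γ trivial δ (h δ hδ) ε hε]
    change _ * _ = _ * _
    rw [← map_mul, h1, map_mul, map_mul, map_mul, h3, h4, one_mul, one_mul]
  · exact (commute_rootElt (not_exists.1 hsum) t s).map φ

/-- Modulo `k(α)`, the commutator of root elements for two roots with sum `α` is a nontrivial
element of the root subgroup of `α`. -/
theorem map_rootElt_mul_rootElt (hY : Y.GoodChar K) {M : Type*} [Monoid M] {φ : UY K Y n →* M}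
    (hφ : patternSubgroup K (kPattern α) ≤ φ.ker) {β γ : PosRoot Y n} (h : IsSum β γ α) :
    ∃ c : K, c ≠ 0 ∧ ∀ t s, φ (rootElt β t) * φ (rootElt γ s) =
      φ (rootElt α (c * t * s)) * φ (rootElt γ s) * φ (rootElt β t) := by
  obtain ⟨c, hc, y, h1, h2⟩ := h.commutator hY
  refine ⟨c, hc, fun t s => ?_⟩
  have h4 : φ (y t s) = 1 := by
    refine hφ (patternSubgroup_mono ?_ (h2 t s))
    rintro ε (hε | hε)
    exacts [mem_kPattern_of_isSum hε.symm, mem_kPattern_of_isSum hε.symm]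
  rw [← map_mul, h1, map_mul, map_mul, map_mul, h4, mul_one]

theorem commute_map_of_forall_rootElt {M : Type*} [Monoid M] {φ : UY K Y n →* M} {x : M}
    (h : ∀ β (t : K), Commute x (φ (rootElt β t))) (g : UY K Y n) : Commute x (φ g) := by
  have hg : g ∈ patternSubgroup K (Set.univ : Set (PosRoot Y n)) := by
    rw [patternSubgroup_univ]
    trivial
  let C : Subgroup (UY K Y n) :=
    { carrier := {g | Commute x (φ g)}
      one_mem' := by
        change Commute x (φ 1)
        rw [map_one]
        exact Commute.one_right x
      mul_mem' := fun {g h} hg hh => by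
        change Commute x (φ (g * h))
        rw [map_mul]
        exact Commute.mul_right hg hh
      inv_mem' := fun {g} hg => by
        change Commute x (φ g⁻¹)
        have hu : Commute x ((Units.map φ (toUnits g) : Mˣ) : M) := hg
        have := hu.units_inv_right
        rwa [← map_inv, ← map_inv] at this }
  exact (patternSubgroup_le (H := C)).2 (fun β _ t => h β t) hg

/-- Modulo `P(k(α))`, the root subgroup of `α` is central. -/
theorem commute_map_rootElt_self (hY : Y.GoodChar K) {M : Type*} [Monoid M] {φ : UY K Y n →* M}
    (hφ : patternSubgroup K (kPattern α) ≤ φ.ker) (t : K) (g : UY K Y n) :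
    Commute (φ (rootElt α t)) (φ g) :=
  commute_map_of_forall_rootElt (fun _ s => commute_map_rootElt hY normalizes_kPattern hφ
    (fun _ h => mem_kPattern_of_isSum h) t s) g

variable (K) in
/-- The group `P({α} ∪ ℓ(α) ∪ k(α))`. -/
def hookGroup (α : PosRoot Y n) : Subgroup (UY K Y n) :=
  patternSubgroup K ({α} ∪ leg α ∪ kPattern α)

theorem normal_hookGroup (hY : Y.GoodChar K) : (hookGroup K α).Normal :=
  normal_patternSubgroup hY normalizes_hook_kPattern

theorem normal_kGroup (hY : Y.GoodChar K) : (patternSubgroup K (kPattern α)).Normal :=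
  normal_patternSubgroup hY normalizes_kPattern

theorem kGroup_le_hookGroup : patternSubgroup K (kPattern α) ≤ hookGroup K α :=
  patternSubgroup_mono Set.subset_union_right

theorem rootElt_mem_hookGroup (t : K) : rootElt α t ∈ hookGroup K α :=
  rootElt_mem_patternSubgroup (.inl (.inl rfl)) t

theorem rootElt_leg_mem_hookGroup {γ : PosRoot Y n} (hγ : γ ∈ leg α) (t : K) :
    rootElt γ t ∈ hookGroup K α :=
  rootElt_mem_patternSubgroup (.inl (.inr hγ)) t

theorem hookGroup_le_sourceGroup : hookGroup K α ≤ sourceGroup K α := by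
  refine patternSubgroup_mono ?_
  rw [Set.union_assoc]
  refine Set.union_subset ?_ (leg_union_kPattern_subset.trans Set.sdiff_subset)
  rintro _ rfl
  exact notMem_arm_self

/-- The linear character of `P({α} ∪ ℓ(α) ∪ k(α))` that belongs to a linear character of the root
subgroup of `α`. -/
def hookChar (l : rootSubgroup K α →* ℂ) : hookGroup K α →* ℂ :=
  l.comp ((rootProj α).comp (Subgroup.inclusion hookGroup_le_sourceGroup))

variable {l : rootSubgroup K α →* ℂ}

theorem hookChar_apply (v : hookGroup K α) :
    hookChar l v = l (rootProj α ⟨v, hookGroup_le_sourceGroup v.2⟩) := rfl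

/-- The value of a linear character of the root subgroup of `α` at `x_α(t)`. -/
def rootVal (l : rootSubgroup K α →* ℂ) (t : K) : ℂ :=
  l ⟨rootElt α t, rootElt_mem_rootSubgroup α t⟩

theorem rootVal_eq {l : rootSubgroup K α →* ℂ} {t : K} {x : rootSubgroup K α}
    (h : (x : UY K Y n) = rootElt α t) : l x = rootVal l t :=
  congrArg l (Subtype.ext h)

theorem exists_rootVal_ne_one (hl : l ≠ 1) {c : K} (hc : c ≠ 0) : ∃ t, rootVal l (c * t) ≠ 1 := by
  by_contra! h
  refine hl (MonoidHom.ext fun x => ?_)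
  obtain ⟨t, ht⟩ := mem_rootSubgroup.1 x.2
  have := h (c⁻¹ * t)
  rwa [mul_inv_cancel_left₀ hc, ← rootVal_eq ht] at this

theorem hookChar_rootElt (hY : Y.GoodChar K) (t : K) (h : rootElt α t ∈ hookGroup K α) :
    hookChar l ⟨rootElt α t, h⟩ = rootVal l t := by
  rw [hookChar_apply]
  refine rootVal_eq ?_
  rw [(isRootProjection_rootProj hY).1 _ (rootElt_mem_rootSubgroup α t)]

theorem hookChar_eq_one (hY : Y.GoodChar K) {v : hookGroup K α}
    (hv : (v : UY K Y n) ∈ patternSubgroup K (kPattern α)) : hookChar l v = 1 := by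
  rw [hookChar_apply, (isRootProjection_rootProj hY).2, map_one]
  exact patternSubgroup_mono (Set.subset_union_right.trans leg_union_kPattern_subset) hv

theorem hookChar_eq_of_mul_inv_mem (hY : Y.GoodChar K) {v w : hookGroup K α}
    (h : (v : UY K Y n) * (w : UY K Y n)⁻¹ ∈ patternSubgroup K (kPattern α)) :
    hookChar l v = hookChar l w := by
  have h1 : hookChar l (v * w⁻¹) = 1 := hookChar_eq_one hY h
  have h2 := map_mul (hookChar l) (v * w⁻¹) w
  rwa [inv_mul_cancel_right, h1, one_mul] at h2

/-- If `γ` is the complement of `β` in the leg, then the sum of `γ` and another root that is at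
least as high as `β` lies in `k(α)`. -/
theorem mem_kPattern_of_arm {β β' γ δ : PosRoot Y n} (hγ : γ ∈ leg α) (h : IsSum β γ α)
    (hne : β' ≠ β) (hle : β.height ≤ β'.height) (hδ : IsSum β' γ δ) : δ ∈ kPattern α := by
  refine mem_kPattern_of_height_le hγ hδ ?_ ?_
  · rintro rfl
    exact hne (hδ.symm.right_unique h.symm)
  · have h1 := h.height_add
    have h2 := hδ.height_add
    omega

/-- If `γ` is a root of the leg with complement `β`, then the sum of `β` and another root of the leg
that is at least as high as `γ` lies in `k(α)`. -/
theorem mem_kPattern_of_leg {β γ γ' δ : PosRoot Y n} (hγ' : γ' ∈ leg α) (h : IsSum β γ α)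
    (hne : γ' ≠ γ) (hle : γ.height ≤ γ'.height) (hδ : IsSum β γ' δ) : δ ∈ kPattern α := by
  refine mem_kPattern_of_height_le hγ' hδ ?_ ?_
  · rintro rfl
    exact hne (hδ.right_unique h)
  · have h1 := h.height_add
    have h2 := hδ.height_add
    omega

theorem commute_map_listProd {M : Type*} [Monoid M] {φ : UY K Y n →* M} {x : M}
    {L : List (PosRoot Y n)} (h : ∀ β ∈ L, ∀ t : K, Commute x (φ (rootElt β t)))
    (f : PosRoot Y n → K) : Commute x (φ (listProd L f)) := by
  induction L with
  | nil => simp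
  | cons β L ih =>
    rw [listProd_cons, map_mul]
    exact (h β List.mem_cons_self _).mul_right
      (ih fun γ hγ => h γ (List.mem_cons_of_mem _ hγ))

theorem inv_mul_mul_mul_comm {Q : Type*} [Group Q] {a b c v z : Q} (hc : Commute v c)
    (ha : Commute v a) (hz : Commute z a) (hb : b * v = z * v * b) :
    a⁻¹ * b * c * v = z * v * (a⁻¹ * b * c) := by
  rw [mul_assoc _ c v, ← hc.eq, ← mul_assoc, mul_assoc a⁻¹ b v, hb, ← mul_assoc, ← mul_assoc,
    mul_assoc a⁻¹ z v, ← (hz.mul_left ha).inv_right.eq]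
  simp only [mul_assoc]

/-- A product of root elements for the arm that stabilizes the linear character is trivial. The
exponents are determined one after the other, by evaluating at the root elements for the
complementary roots in the leg. -/
theorem eq_of_listProd_inv_mul (hY : Y.GoodChar K) [(hookGroup K α).Normal] (hl : l ≠ 1)
    (L : List (PosRoot Y n)) (hL : L.Pairwise fun β γ => β.height ≤ γ.height) (hL' : L.Nodup)
    (hLA : ∀ β ∈ L, β ∈ arm α) (f f' : PosRoot Y n → K)
    (hst : ∀ v : hookGroup K α,
      hookChar l (MulAut.conjNormal ((listProd L f)⁻¹ * listProd L f') v) = hookChar l v) :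
    ∀ β ∈ L, f β = f' β := by
  induction L with
  | nil => simp
  | cons β L ih =>
    rw [List.pairwise_cons] at hL
    rw [List.nodup_cons] at hL'
    have key : f β = f' β := by
      obtain ⟨γ, hγ, hsum⟩ := exists_leg_of_mem_arm (hLA β List.mem_cons_self)
      have := normal_kGroup (α := α) hY
      let φ : UY K Y n →* UY K Y n ⧸ patternSubgroup K (kPattern α) := QuotientGroup.mk' _
      have hφ : patternSubgroup K (kPattern α) ≤ φ.ker := by rw [QuotientGroup.ker_mk']
      obtain ⟨c, hc, hcomm⟩ := map_rootElt_mul_rootElt hY hφ hsum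
      by_contra hne
      have hne' : c * (f' β - f β) ≠ 0 := mul_ne_zero hc (sub_ne_zero.2 (Ne.symm hne))
      obtain ⟨s, hs⟩ := exists_rootVal_ne_one hl hne'
      have hγL : ∀ g : PosRoot Y n → K, Commute (φ (rootElt γ s)) (φ (listProd L g)) :=
        commute_map_listProd fun β' hβ' t => (commute_map_rootElt hY normalizes_kPattern hφ
          (fun δ hδ => mem_kPattern_of_arm hγ hsum (by rintro rfl; exact hL'.1 hβ')
            (hL.1 β' hβ') hδ) t s).symm
      have hαc := commute_map_rootElt_self hY hφ (c * (f' β - f β) * s)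
      let v : hookGroup K α := ⟨rootElt γ s, rootElt_leg_mem_hookGroup hγ s⟩
      let z : hookGroup K α :=
        ⟨rootElt α (c * (f' β - f β) * s), rootElt_mem_hookGroup _⟩
      set g := (listProd (β :: L) f)⁻¹ * listProd (β :: L) f' with hg
      have hg' : φ g = (φ (listProd L f))⁻¹ * φ (rootElt β (f' β - f β)) * φ (listProd L f') := by
        rw [hg, listProd_cons, listProd_cons, ← map_inv, ← map_mul, ← map_mul, sub_eq_neg_add,
          rootElt_add, rootElt_neg]
        congr 1
        group
      have h1 : φ (g * v * g⁻¹) = φ (z * v) := by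
        have e := inv_mul_mul_mul_comm (hγL f') (hγL f) (hαc _) (hcomm _ s)
        rw [← hg'] at e
        rw [map_mul φ (g * v), map_mul φ g, map_inv φ g, map_mul φ (z : UY K Y n),
          mul_inv_eq_iff_eq_mul]
        exact e
      have h2 : hookChar l (MulAut.conjNormal g v) = hookChar l (z * v) := by
        refine hookChar_eq_of_mul_inv_mem hY ?_
        rw [← QuotientGroup.ker_mk' (patternSubgroup K (kPattern α)), MonoidHom.mem_ker, map_mul,
          map_inv, MulAut.conjNormal_apply]
        exact mul_inv_eq_one.2 h1
      rw [hst, map_mul, hookChar_rootElt hY] at h2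
      have h3 : hookChar l v ≠ 0 := ((Group.isUnit v).map (hookChar l)).ne_zero
      exact hs (mul_right_cancel₀ h3 (h2.symm.trans (one_mul _).symm))
    have htail : (listProd L f)⁻¹ * listProd L f' =
        (listProd (β :: L) f)⁻¹ * listProd (β :: L) f' := by
      rw [listProd_cons, listProd_cons, key]
      group
    intro β' hβ'
    rcases List.mem_cons.1 hβ' with rfl | hβ'
    · exact key
    · refine ih hL.2 hL'.2 (fun β hβ => hLA β (List.mem_cons_of_mem _ hβ)) ?_ β' hβ'
      rw [htail]
      exact hst

theorem listProd_zero (L : List (PosRoot Y n)) : listProd L (fun _ => (0 : K)) = 1 := by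
  induction L with
  | nil => rfl
  | cons β L ih => rw [listProd_cons, ih, rootElt_zero, one_mul]

/-- The group `UY_n` is the product of the root subgroups for the arm and of the source group. -/
theorem exists_listProd_arm_mul (hY : Y.GoodChar K) {L : List (PosRoot Y n)}
    (hL : L.Pairwise fun β γ => β.height ≤ γ.height) (hL' : L.Nodup)
    (hLA : ∀ β, β ∈ L ↔ β ∈ arm α) (g : UY K Y n) :
    ∃ f : PosRoot Y n → K, ∃ s ∈ sourceGroup K α, g = listProd L f * s := by
  have h : source α ∪ {β | β ∈ L} = Set.univ := by
    ext β
    simp [source, hLA]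
  refine exists_listProd_mul hY isClosedPattern_source L hL hL'
    (fun β hβ h => h ((hLA β).1 hβ)) ?_ ?_
  · rw [h]
    exact fun _ _ _ _ _ _ => trivial
  · rw [h, patternSubgroup_univ]
    trivial

/-- Conjugation by the source group does not change the linear character, because it extends to
the source group. -/
theorem hookChar_conj_of_mem [(hookGroup K α).Normal] {g : UY K Y n} (hg : g ∈ sourceGroup K α)
    (v : hookGroup K α) : hookChar l (MulAut.conjNormal g v) = hookChar l v := by
  let g' : sourceGroup K α := ⟨g, hg⟩
  let v' : sourceGroup K α := ⟨v, hookGroup_le_sourceGroup v.2⟩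
  let ν : sourceGroup K α →* ℂ := l.comp (rootProj α)
  change ν (g' * v' * g'⁻¹) = ν v'
  have h1 : ν g' * ν g'⁻¹ = 1 := by rw [← map_mul, mul_inv_cancel, map_one]
  rw [map_mul, map_mul, mul_right_comm, h1, one_mul]

/-- The source group is the inertia group of the linear character of
`P({α} ∪ ℓ(α) ∪ k(α))` that belongs to a nontrivial linear character of the root subgroup. -/
theorem isInertia_hookChar (hY : Y.GoodChar K) [(hookGroup K α).Normal] (hl : l ≠ 1) :
    IsInertia (hookChar l) (sourceGroup K α) := by
  refine fun g => ⟨fun hg v => hookChar_conj_of_mem hg v, fun hg => ?_⟩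
  obtain ⟨L, hL, hL', hLA⟩ := exists_sorted_list (arm α)
  obtain ⟨f, s, hs, rfl⟩ := exists_listProd_arm_mul hY hL hL' hLA g
  have h0 : ∀ β ∈ L, (fun _ => (0 : K)) β = f β := by
    refine eq_of_listProd_inv_mul hY hl L hL hL' (fun β hβ => (hLA β).1 hβ) _ f fun v => ?_
    rw [listProd_zero, inv_one, one_mul]
    have h1 := hg (MulAut.conjNormal s⁻¹ v)
    rw [hookChar_conj_of_mem (inv_mem hs)] at h1
    rw [← h1, ← MulAut.mul_apply, ← map_mul, mul_inv_cancel_right]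
  rw [← listProd_congr h0, listProd_zero, one_mul]
  exact hs

/-- Products of root elements for the arm form a transversal of the source group. -/
theorem index_sourceGroup (hY : Y.GoodChar K) (hl : l ≠ 1) :
    (sourceGroup K α).index = Nat.card K ^ (arm α).ncard := by
  classical
  have := normal_hookGroup (α := α) hY
  obtain ⟨L, hL, hL', hLA⟩ := exists_sorted_list (arm α)
  let ext : (arm α → K) → PosRoot Y n → K := fun f β => if h : β ∈ arm α then f ⟨β, h⟩ else 0
  let F : (arm α → K) → UY K Y n ⧸ sourceGroup K α := fun f => (listProd L (ext f) : UY K Y n)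
  have hF : Function.Bijective F := by
    refine ⟨fun f f' h => ?_, fun x => ?_⟩
    · have h1 := QuotientGroup.eq.1 h
      have h2 := eq_of_listProd_inv_mul hY hl L hL hL' (fun β hβ => (hLA β).1 hβ) _ _
        (hookChar_conj_of_mem h1)
      ext ⟨β, hβ⟩
      simpa [ext, hβ] using h2 β ((hLA β).2 hβ)
    · obtain ⟨g, rfl⟩ := QuotientGroup.mk_surjective x
      obtain ⟨f, s, hs, rfl⟩ := exists_listProd_arm_mul hY hL hL' hLA g
      refine ⟨fun β => f β, ?_⟩
      have h1 : listProd L (ext fun β => f β) = listProd L f :=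
        listProd_congr fun β hβ => by simp [ext, (hLA β).1 hβ]
      change ((listProd L (ext fun β => f β) : UY K Y n) : UY K Y n ⧸ sourceGroup K α) = _
      rw [h1, QuotientGroup.mk_mul_of_mem _ hs]
  rw [Subgroup.index, ← Nat.card_congr (Equiv.ofBijective F hF), Nat.card_fun, Set.ncard]
  rfl

end Inertia

/-! ### Linear characters, inflation and induction -/

section Linear

variable {G : Type*} [Group G]

theorem isIrreducible_of_finrank_eq_one {V : Type*} [AddCommGroup V] [Module ℂ V]
    (hV : Module.finrank ℂ V = 1) (ρ : Representation ℂ G V) : ρ.IsIrreducible := by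
  have := isSimpleModule_iff_finrank_eq_one.2 hV
  exact isIrreducible_iff.2
    ⟨Module.nontrivial_of_finrank_eq_succ hV, fun W _ => eq_bot_or_eq_top W⟩

theorem coe_mem_Irr (l : G →* ℂ) : ⇑l ∈ Irr G := by
  let ρ : Representation ℂ G (Fin 1 → ℂ) :=
    { toFun := fun g => l g • 1
      map_one' := by rw [map_one, one_smul]
      map_mul' := fun g h => by rw [map_mul, smul_mul_smul_comm, one_mul] }
  refine ⟨1, ρ, isIrreducible_of_finrank_eq_one (by simp) ρ, ?_⟩
  ext g
  rw [character_of_eq_smul_one (ρ := ρ) (c := l g) rfl, ρ.char_one]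
  simp

/-- The irreducible characters of a commutative group are its linear characters. -/
theorem exists_coe_eq_of_mem_Irr (hG : ∀ a b : G, a * b = b * a) {χ : G → ℂ} (hχ : χ ∈ Irr G) :
    ∃ l : G →* ℂ, ⇑l = χ := by
  obtain ⟨d, ρ, hρ, rfl⟩ := hχ
  have hs : ∀ g, ∃ c : ℂ, ρ g = c • 1 := fun g => eq_smul_one_of_commute hρ fun h => by
    change _ * _ = _ * _
    rw [← map_mul, hG, map_mul]
  choose c hc using hs
  obtain ⟨hV, h⟩ := isIrreducible_iff.1 hρ
  obtain ⟨v, hv⟩ := exists_ne (0 : Fin d → ℂ)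
  have h1 : ρ.character 1 = 1 := by
    have hspan : Submodule.span ℂ {v} = ⊤ := by
      refine (h (Submodule.span ℂ {v}) fun g w hw => ?_).resolve_left ?_
      · rw [hc]
        exact Submodule.smul_mem _ _ hw
      · rwa [Submodule.span_singleton_eq_bot]
    rw [ρ.char_one, ← finrank_top ℂ (Fin d → ℂ), ← hspan, finrank_span_singleton hv, Nat.cast_one]
  have h2 : ∀ g, ρ.character g = c g := fun g => by
    rw [character_of_eq_smul_one (hc g), h1, mul_one]
  refine ⟨⟨⟨ρ.character, h1⟩, fun a b => ?_⟩, rfl⟩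
  have h3 : ρ (a * b) = (c a * c b) • 1 := by
    rw [map_mul, hc, hc, smul_mul_smul_comm, one_mul]
  change ρ.character (a * b) = ρ.character a * ρ.character b
  rw [character_of_eq_smul_one h3, h1, mul_one, h2, h2]

theorem isIrreducible_of_forall_exists_smul {H V : Type*} [Group H] [AddCommGroup V] [Module ℂ V]
    {ρ : Representation ℂ G V} {τ : Representation ℂ H V} (hρ : ρ.IsIrreducible)
    (h : ∀ g, ∃ (k : H) (c : ℂ), ρ g = c • τ k) : τ.IsIrreducible := by
  obtain ⟨hV, hW⟩ := isIrreducible_iff.1 hρ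
  refine isIrreducible_iff.2 ⟨hV, fun W hτ => hW W fun g w hw => ?_⟩
  obtain ⟨k, c, hk⟩ := h g
  rw [hk]
  exact W.smul_mem c (hτ k w hw)

theorem induced_apply_one [Finite G] (H : Subgroup G) (φ : H → ℂ) :
    induced H φ 1 = H.index * φ 1 := by
  classical
  have := Fintype.ofFinite G
  have hc : (Nat.card H : ℂ) ≠ 0 := by exact_mod_cast Nat.card_pos.ne'
  have h1 : ∀ x : G, x⁻¹ * 1 * x = 1 := fun x => by group
  rw [induced, finsum_eq_sum_of_fintype, inv_mul_eq_iff_eq_mul₀ hc, ← mul_assoc, ← Nat.cast_mul,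
    H.card_mul_index, Nat.card_eq_fintype_card]
  have h2 : ∀ x : G, (if h : x⁻¹ * 1 * x ∈ H then φ ⟨x⁻¹ * 1 * x, h⟩ else 0) = φ 1 := fun x => by
    rw [dif_pos (by rw [h1]; exact one_mem H)]
    exact congrArg φ (Subtype.ext (h1 x))
  rw [Finset.sum_congr rfl fun x _ => (by convert h2 x), Finset.sum_const, Finset.card_univ, nsmul_eq_mul]

/-- The irreducible representations of `G ⧸ N`, twisted by a linear character `ν` of `G`, are the
irreducible representations of `G` on which `N` acts by the restriction of `ν`. -/
theorem exists_twisted_inflation {N : Subgroup G} [N.Normal] (ν : G →* ℂ) {μ : G ⧸ N → ℂ}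
    (hμ : μ ∈ Irr (G ⧸ N)) :
    ∃ (d : ℕ) (τ : Representation ℂ G (Fin d → ℂ)), τ.IsIrreducible ∧
      (∀ v ∈ N, τ v = ν v • 1) ∧ τ.character = fun g : G => μ g * ν g := by
  obtain ⟨d, σ, hσ, rfl⟩ := hμ
  let τ : Representation ℂ G (Fin d → ℂ) :=
    { toFun := fun g => ν g • σ g
      map_one' := by rw [map_one, one_smul, QuotientGroup.mk_one, map_one]
      map_mul' := fun g h => by rw [map_mul, QuotientGroup.mk_mul, map_mul, smul_mul_smul_comm] }
  refine ⟨d, τ, isIrreducible_of_forall_exists_smul hσ fun x => ?_, fun v hv => ?_, ?_⟩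
  · obtain ⟨g, rfl⟩ := QuotientGroup.mk_surjective x
    refine ⟨g, ν g⁻¹, ?_⟩
    change _ = ν g⁻¹ • ν g • σ g
    rw [smul_smul, ← map_mul, inv_mul_cancel, map_one, one_smul]
  · change ν v • σ v = _
    rw [(QuotientGroup.eq_one_iff v).2 hv, map_one]
  · ext g
    change LinearMap.trace ℂ _ (ν g • σ g) = _
    rw [map_smul, smul_eq_mul, mul_comm]
    rfl

theorem exists_twisted_deflation {N : Subgroup G} [N.Normal] (ν : G →* ℂ) {d : ℕ}
    {τ : Representation ℂ G (Fin d → ℂ)} (hτ : τ.IsIrreducible) (hN : ∀ v ∈ N, τ v = ν v • 1) :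
    ∃ μ ∈ Irr (G ⧸ N), τ.character = fun g : G => μ g * ν g := by
  have hν : ∀ g, ν g * ν g⁻¹ = 1 := fun g => by rw [← map_mul, mul_inv_cancel, map_one]
  let τ' : Representation ℂ G (Fin d → ℂ) :=
    { toFun := fun g => ν g⁻¹ • τ g
      map_one' := by rw [inv_one, map_one, one_smul, map_one]
      map_mul' := fun g h => by
        rw [mul_inv_rev, map_mul, map_mul, smul_mul_smul_comm, mul_comm (ν h⁻¹)] }
  have hker : N ≤ τ'.ker := fun v hv => by
    rw [MonoidHom.mem_ker]
    change ν v⁻¹ • τ v = 1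
    rw [hN v hv, smul_smul, mul_comm, hν, one_smul]
  let σ : Representation ℂ (G ⧸ N) (Fin d → ℂ) := QuotientGroup.lift N τ' hker
  have h1 : ∀ g : G, τ g = ν g • σ g := fun g => by
    change τ g = ν g • ν g⁻¹ • τ g
    rw [smul_smul, hν, one_smul]
  refine ⟨σ.character, ⟨d, σ, ?_, rfl⟩, ?_⟩
  · exact isIrreducible_of_forall_exists_smul hτ fun g => ⟨g, ν g, h1 g⟩
  · ext g
    rw [Representation.character, h1, map_smul, smul_eq_mul, mul_comm]
    rfl

end Linear

/-! ### Single root characters -/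

section SingleRoot

variable {K : Type*} [Field K] {Y : Family} {n : ℕ} {α : PosRoot Y n}

attribute [local irreducible] rootElt rootProj

/-- If a homomorphism sends the root elements for `β` to elements that commute with its image, then
it is trivial on the root subgroups of all positive roots `β + γ`. -/
theorem map_rootElt_eq_one_of_commute (hY : Y.GoodChar K) {M : Type*} [Monoid M]
    {φ : UY K Y n →* M} {β γ δ : PosRoot Y n} (h : IsSum β γ δ)
    (hβ : ∀ t g, Commute (φ (rootElt β t)) (φ g)) (t : K) : φ (rootElt δ t) = 1 := by
  refine h.rootElt_mem hY (N := φ.ker) (fun t s => ?_) t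
  rw [MonoidHom.mem_ker, mul_assoc, map_mul, map_mul φ (rootElt β t), (hβ t _).eq, ← map_mul,
    ← map_mul, ← map_one φ]
  congr 1
  group

variable {V : Type*} [AddCommGroup V] [Module ℂ V] [FiniteDimensional ℂ V]
  {ρ : Representation ℂ (UY K Y n) V}

theorem mem_rootSupport_iff [Finite K] (hρ : ρ.IsIrreducible) {β : PosRoot Y n} :
    β ∈ rootSupport ρ.character ↔
      (∀ t, ∃ c : ℂ, ρ (rootElt β t) = c • 1) ∧ ¬ ∀ t, ρ (rootElt β t) = 1 := by
  have hmem : ∀ s : Set (UY K Y n), (rootSubgroup K β : Set (UY K Y n)) ⊆ s ↔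
      ∀ t, rootElt β t ∈ s := fun s => by
    refine ⟨fun h t => h (rootElt_mem_rootSubgroup β t), fun h g hg => ?_⟩
    obtain ⟨t, rfl⟩ := mem_rootSubgroup.1 hg
    exact h t
  rw [rootSupport, Set.mem_ofPred_eq, hmem, hmem]
  simp only [mem_charCenter_iff hρ, mem_charKernel_iff hρ]

theorem commute_of_eq_smul_one {A : Type*} [Ring A] [Algebra ℂ A] {a : A} {c : ℂ}
    (h : a = c • 1) (b : A) : Commute a b := by
  rw [h]
  exact (Commute.one_left b).smul_left c

/-- An irreducible character that is supported at `α` only is trivial on `P(k(α))`: the set `k(α)`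
is built by adding either sums of roots or roots that become central. -/
theorem patternSubgroup_kPattern_le_ker [Finite K] (hY : Y.GoodChar K) (hρ : ρ.IsIrreducible)
    (h : rootSupport ρ.character = {α}) : patternSubgroup K (kPattern α) ≤ ρ.ker := by
  have hz : ∀ β, (∀ t, ∃ c : ℂ, ρ (rootElt β t) = c • 1) → β ≠ α → ∀ t, ρ (rootElt β t) = 1 := by
    intro β hβ hne
    by_contra h'
    have hβ' := (mem_rootSupport_iff hρ).2 ⟨hβ, h'⟩
    rw [h] at hβ'
    exact hne hβ'
  have hα : α ∈ rootSupport ρ.character := by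
    rw [h]
    rfl
  have hsum : ∀ β γ δ, IsSum β γ δ → (∀ t, ∃ c : ℂ, ρ (rootElt β t) = c • 1) →
      ∀ t, ρ (rootElt δ t) = 1 := by
    refine fun β γ δ hδ hβ => map_rootElt_eq_one_of_commute hY hδ fun t g => ?_
    obtain ⟨c, hc⟩ := hβ t
    exact commute_of_eq_smul_one hc _
  have hone : ∀ β, (∀ t, ρ (rootElt β t) = 1) → ∀ t, ∃ c : ℂ, ρ (rootElt β t) = c • 1 :=
    fun β hβ t => ⟨1, by rw [hβ, one_smul]⟩
  have hn : ∀ i, ∀ β ∈ nStep α i, ∀ t, ∃ c : ℂ, ρ (rootElt β t) = c • 1 := by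
    intro i
    induction i with
    | zero =>
      rintro _ rfl
      exact ((mem_rootSupport_iff hρ).1 hα).1
    | succ i ih =>
      rintro δ ⟨β, hβ, γ, hδ⟩
      exact hone δ (hsum β γ δ hδ (ih β hβ))
  have hk : ∀ i, ∀ β ∈ kStep α i, ∀ t, ρ (rootElt β t) = 1 := by
    intro i
    induction i with
    | zero =>
      intro δ hδ
      obtain ⟨i, β, hβ, γ, hsδ⟩ := Set.mem_iUnion.1 hδ
      exact hsum β γ δ hsδ (hn i β hβ)
    | succ i ih =>
      rintro β (⟨⟨hβ, -⟩, hne⟩ | hβ)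
      · refine hz β (fun t => eq_smul_one_of_commute hρ fun g => ?_) hne
        exact commute_map_of_forall_rootElt (fun γ s => commute_map_rootElt hY (normalizes_kStep i)
          (patternSubgroup_le_ker.2 ih) (hβ γ) t s) g
      · exact ih β hβ
  refine patternSubgroup_le_ker.2 fun β hβ => ?_
  obtain ⟨i, hi⟩ := Set.mem_iUnion.1 hβ
  exact hk i β hi

omit [FiniteDimensional ℂ V] in
theorem smul_one_injective [Nontrivial V] :
    Function.Injective fun c : ℂ => (c • 1 : Module.End ℂ V) :=
  smul_left_injective ℂ one_ne_zero

/-- The irreducible characters in `Irr(UY_n)_α` are those of the representations that are trivial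
on `P(k(α))` and on which the root subgroup of `α` acts by a nontrivial linear character. -/
theorem rootSupport_eq_iff [Finite K] (hY : Y.GoodChar K) (hρ : ρ.IsIrreducible) :
    rootSupport ρ.character = {α} ↔ patternSubgroup K (kPattern α) ≤ ρ.ker ∧
      ∃ l : rootSubgroup K α →* ℂ, l ≠ 1 ∧ ∀ t, ρ (rootElt α t) = rootVal l t • 1 := by
  obtain ⟨hV, -⟩ := isIrreducible_iff.1 hρ
  constructor
  · intro h
    refine ⟨patternSubgroup_kPattern_le_ker hY hρ h, ?_⟩
    have hα : α ∈ rootSupport ρ.character := by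
      rw [h]
      rfl
    obtain ⟨h1, h2⟩ := (mem_rootSupport_iff hρ).1 hα
    have h3 : ∀ x : rootSubgroup K α, ∃ c : ℂ, ρ x = c • 1 := fun x => by
      obtain ⟨t, ht⟩ := mem_rootSubgroup.1 x.2
      rw [ht]
      exact h1 t
    choose c hc using h3
    let l : rootSubgroup K α →* ℂ :=
      { toFun := c
        map_one' := smul_one_injective (V := V) (by
          change c 1 • (1 : Module.End ℂ V) = (1 : ℂ) • 1
          rw [← hc, OneMemClass.coe_one, map_one, one_smul])
        map_mul' := fun x y => smul_one_injective (V := V) (by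
          change c (x * y) • (1 : Module.End ℂ V) = (c x * c y) • 1
          rw [← hc, Subgroup.coe_mul, map_mul, hc, hc, smul_mul_smul_comm, one_mul]) }
    have hl : ∀ t, ρ (rootElt α t) = rootVal l t • 1 := fun t =>
      hc ⟨rootElt α t, rootElt_mem_rootSubgroup α t⟩
    refine ⟨l, ?_, hl⟩
    intro hl1
    refine h2 fun t => ?_
    rw [hl, hl1, rootVal, MonoidHom.one_apply, one_smul]
  · rintro ⟨hk, l, hl, hρl⟩
    have hα : ¬ ∀ t, ρ (rootElt α t) = 1 := by
      intro h
      obtain ⟨t, ht⟩ := exists_rootVal_ne_one hl one_ne_zero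
      rw [one_mul] at ht
      refine ht (smul_one_injective (V := V) ?_)
      change rootVal l t • (1 : Module.End ℂ V) = (1 : ℂ) • 1
      rw [← hρl, h, one_smul]
    have hsum : ∀ β γ δ, IsSum β γ δ → (∀ t, ∃ c : ℂ, ρ (rootElt β t) = c • 1) →
        ∀ t, ρ (rootElt δ t) = 1 := by
      refine fun β γ δ hδ hβ => map_rootElt_eq_one_of_commute hY hδ fun t g => ?_
      obtain ⟨c, hc⟩ := hβ t
      exact commute_of_eq_smul_one hc _
    ext β
    rw [mem_rootSupport_iff hρ, Set.mem_singleton_iff]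
    constructor
    · rintro ⟨h1, h2⟩
      by_contra hne
      have hβ : β ∉ kPattern α := fun hβ => h2 fun t =>
        hk (rootElt_mem_patternSubgroup hβ t)
      obtain ⟨γ, δ, hδ, hδk⟩ := exists_isSum_notMem_kPattern hβ hne
      refine of_notMem_kPattern (p := fun β => ¬ ∀ t, ρ (rootElt β t) = 1) hα ?_ hδk
        (hsum β γ δ hδ h1)
      exact fun β γ δ hδ h3 h4 => h3 (hsum β γ δ hδ fun t => ⟨1, by rw [h4, one_smul]⟩)
    · rintro rfl
      exact ⟨fun t => ⟨_, hρl t⟩, hα⟩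

variable {l : rootSubgroup K α →* ℂ}

omit [FiniteDimensional ℂ V] in
/-- The character vanishes at a nontrivial product of root elements for the leg: conjugation by a
root element for the arm complement of the lowest root in the product multiplies the value by a
root of unity. -/
theorem character_listProd_eq_zero (hY : Y.GoodChar K)
    (hk : patternSubgroup K (kPattern α) ≤ ρ.ker) (hl : l ≠ 1)
    (hρl : ∀ t, ρ (rootElt α t) = rootVal l t • 1) (L : List (PosRoot Y n))
    (hL : L.Pairwise fun β γ => β.height ≤ γ.height) (hL' : L.Nodup) (hLA : ∀ γ ∈ L, γ ∈ leg α)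
    {f : PosRoot Y n → K} (hf : ∃ γ ∈ L, f γ ≠ 0) : ρ.character (listProd L f) = 0 := by
  induction L with
  | nil => simp at hf
  | cons γ L ih =>
    rw [List.pairwise_cons] at hL
    rw [List.nodup_cons] at hL'
    by_cases h0 : f γ = 0
    · rw [listProd_cons, h0, rootElt_zero, one_mul]
      refine ih hL.2 hL'.2 (fun γ hγ => hLA γ (List.mem_cons_of_mem _ hγ)) ?_
      obtain ⟨γ', hγ', hne⟩ := hf
      rcases List.mem_cons.1 hγ' with rfl | hγ'
      exacts [(hne h0).elim, ⟨γ', hγ', hne⟩]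
    · obtain ⟨β, -, hsum⟩ := exists_arm_of_mem_leg (hLA γ List.mem_cons_self)
      obtain ⟨c, hc, hcomm⟩ := map_rootElt_mul_rootElt hY hk hsum
      obtain ⟨t, ht⟩ := exists_rootVal_ne_one hl (mul_ne_zero hc h0)
      have hβL : Commute (ρ (rootElt β t)) (ρ (listProd L f)) :=
        commute_map_listProd (fun γ' hγ' s => commute_map_rootElt hY normalizes_kPattern hk
          (fun δ hδ => mem_kPattern_of_leg (hLA γ' (List.mem_cons_of_mem _ hγ')) hsum
            (by rintro rfl; exact hL'.1 hγ') (hL.1 γ' hγ') hδ) t s) f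
      have h1 : ρ (rootElt β t * listProd (γ :: L) f) =
          rootVal l (c * f γ * t) • ρ (listProd (γ :: L) f * rootElt β t) := by
        rw [listProd_cons, map_mul, map_mul, ← mul_assoc, hcomm, hρl, mul_right_comm c,
          smul_one_mul, smul_mul_assoc, smul_mul_assoc, mul_assoc _ (ρ (rootElt β t)), hβL.eq,
          map_mul, map_mul, mul_assoc (ρ (rootElt γ (f γ)))]
      have h3 : ρ.character (listProd (γ :: L) f) =
          rootVal l (c * f γ * t) * ρ.character (listProd (γ :: L) f) := by
        conv_lhs => rw [← ρ.char_conj _ (rootElt β t), Representation.character, map_mul, h1,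
          smul_mul_assoc, ← map_mul, mul_inv_cancel_right, map_smul, smul_eq_mul]
        rfl
      have h5 : (rootVal l (c * f γ * t) - 1) * ρ.character (listProd (γ :: L) f) = 0 := by
        rw [sub_mul, ← h3, one_mul, sub_self]
      exact (mul_eq_zero.1 h5).resolve_left (sub_ne_zero.2 ht)

/-- The group `P({α} ∪ ℓ(α) ∪ k(α))` is the product of the root subgroups for the leg, of the root
subgroup of `α`, and of `P(k(α))`. -/
theorem exists_listProd_leg_mul (hY : Y.GoodChar K) {L : List (PosRoot Y n)}
    (hL : L.Pairwise fun β γ => β.height ≤ γ.height) (hL' : L.Nodup)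
    (hLA : ∀ γ, γ ∈ L ↔ γ ∈ leg α) {v : UY K Y n} (hv : v ∈ hookGroup K α) :
    ∃ f : PosRoot Y n → K, ∃ t, ∃ z ∈ patternSubgroup K (kPattern α),
      v = listProd L f * (rootElt α t * z) := by
  have hk : IsClosedPattern (kPattern α) :=
    fun β _ γ hγ δ h => normalizes_kPattern β trivial γ hγ δ h
  have hkα : IsClosedPattern (kPattern α ∪ {β | β ∈ [α]}) := by
    rintro β hβ γ (hγ | hγ) δ h
    · exact .inl (normalizes_kPattern β trivial γ hγ δ h)
    · obtain rfl := List.mem_singleton.1 hγ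
      exact .inl (mem_kPattern_of_isSum h.symm)
  have heq : kPattern α ∪ {β | β ∈ [α]} ∪ {γ | γ ∈ L} = {α} ∪ leg α ∪ kPattern α := by
    ext γ
    simp only [Set.mem_union, Set.mem_ofPred_eq, hLA, List.mem_singleton, Set.mem_singleton_iff]
    tauto
  have hleg : ∀ γ ∈ L, γ ∉ kPattern α ∪ {β | β ∈ [α]} := by
    rintro γ hγ (h | h)
    · obtain ⟨-, β, hβ⟩ := mem_leg_iff_isSum.1 ((hLA γ).1 hγ)
      exact notMem_kPattern_of_isSum hβ h
    · exact ((hLA γ).1 hγ).2 (.inl (List.mem_singleton.1 h))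
  have hclosed : IsClosedPattern (kPattern α ∪ {β | β ∈ [α]} ∪ {γ | γ ∈ L}) := by
    rw [heq]
    exact fun β _ γ hγ δ h => normalizes_hook_kPattern β trivial γ hγ δ h
  have hv' : v ∈ patternSubgroup K (kPattern α ∪ {β | β ∈ [α]} ∪ {γ | γ ∈ L}) := by
    rwa [heq]
  obtain ⟨f, z, hz, rfl⟩ := exists_listProd_mul hY hkα L hL hL' hleg hclosed hv'
  obtain ⟨f', z', hz', rfl⟩ := exists_listProd_mul hY hk [α] (List.pairwise_singleton _ _)
    (List.nodup_singleton _) (by simpa using notMem_kPattern_self) hkα hz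
  exact ⟨f, f' α, z', hz', by rw [listProd_cons, listProd_nil, mul_one]⟩

omit [FiniteDimensional ℂ V] in
/-- At each element of `P({α} ∪ ℓ(α) ∪ k(α))`, either the character vanishes or the representation
acts by the linear character. -/
theorem character_eq_zero_or_eq_hookChar_smul_one (hY : Y.GoodChar K)
    (hk : patternSubgroup K (kPattern α) ≤ ρ.ker) (hl : l ≠ 1)
    (hρl : ∀ t, ρ (rootElt α t) = rootVal l t • 1) (v : hookGroup K α) :
    ρ.character v = 0 ∨ ρ v = hookChar l v • 1 := by
  obtain ⟨v, hv⟩ := v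
  obtain ⟨L, hL, hL', hLA⟩ := exists_sorted_list (leg α)
  obtain ⟨f, t, z, hz, rfl⟩ := exists_listProd_leg_mul hY hL hL' hLA hv
  have h1 : ρ (rootElt α t * z) = rootVal l t • 1 := by
    rw [map_mul, hρl, hk hz, mul_one]
  by_cases hf : ∃ γ ∈ L, f γ ≠ 0
  · left
    have h2 := character_listProd_eq_zero hY hk hl hρl L hL hL' (fun γ hγ => (hLA γ).1 hγ) hf
    rw [Representation.character, map_mul, h1, mul_smul_comm, mul_one, map_smul]
    exact smul_eq_zero_of_right _ h2
  · right
    push Not at hf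
    have h2 : listProd L f = 1 := (listProd_congr hf).trans (listProd_zero L)
    let x : hookGroup K α := ⟨rootElt α t, rootElt_mem_hookGroup t⟩
    let y : hookGroup K α := ⟨z, kGroup_le_hookGroup hz⟩
    have h3 : (⟨listProd L f * (rootElt α t * z), hv⟩ : hookGroup K α) = x * y :=
      Subtype.ext ((congrArg (· * _) h2).trans (one_mul _))
    rw [h3, map_mul, hookChar_rootElt hY, hookChar_eq_one hY (v := y) hz, mul_one]
    exact h1

theorem charProj_hookChar_ne_zero [Fintype (hookGroup K α)] [(hookGroup K α).Normal]
    (hY : Y.GoodChar K) (hρ : ρ.IsIrreducible)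
    (hk : patternSubgroup K (kPattern α) ≤ ρ.ker) (hl : l ≠ 1)
    (hρl : ∀ t, ρ (rootElt α t) = rootVal l t • 1) : charProj (hookChar l) ρ ≠ 0 := by
  intro h0
  have h1 : ∀ v : hookGroup K α, ∃ m : ℕ, (v = 1 → m = 1) ∧
      hookChar l v⁻¹ * ρ.character v = m * ρ.character 1 := by
    intro v
    by_cases hv : ρ.character v = 0
    · refine ⟨0, ?_, by rw [hv, mul_zero, Nat.cast_zero, zero_mul]⟩
      rintro rfl
      exact (character_one_ne_zero hρ hv).elim
    · refine ⟨1, fun _ => rfl, ?_⟩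
      have h2 := (character_eq_zero_or_eq_hookChar_smul_one hY hk hl hρl v).resolve_left hv
      rw [character_of_eq_smul_one h2, ← mul_assoc, map_inv_mul_self, Nat.cast_one]
  choose m hm1 hm using h1
  have h2 := trace_mul_charProj (ρ := ρ) (ν := hookChar l) 1
  rw [h0, mul_zero, map_zero] at h2
  have hc : (Fintype.card (hookGroup K α) : ℂ)⁻¹ ≠ 0 :=
    inv_ne_zero (by exact_mod_cast Fintype.card_ne_zero)
  have h3 := (mul_eq_zero.1 h2.symm).resolve_left hc
  simp only [one_mul, hm, ← Finset.sum_mul, ← Nat.cast_sum] at h3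
  have h4 := (mul_eq_zero.1 h3).resolve_right (character_one_ne_zero hρ)
  have h5 := Finset.sum_eq_zero_iff.1 (Nat.cast_eq_zero.1 h4) 1 (Finset.mem_univ _)
  rw [hm1 1 rfl] at h5
  exact one_ne_zero h5

end SingleRoot

/-! ### Single root characters and the source group -/

section Psi

variable {K : Type*} [Field K] {Y : Family} {n : ℕ} {α : PosRoot Y n}

attribute [local irreducible] rootElt rootProj

theorem Family.PrimeOK.goodChar {p : ℕ} (hp : Y.PrimeOK p) [CharP K p] : Y.GoodChar K := by
  rintro (rfl | rfl) h
  all_goals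
    have h1 : ((2 : ℕ) : K) = 0 := by exact_mod_cast h
    have h2 := Nat.le_of_dvd two_pos ((CharP.cast_eq_zero_iff K p 2).1 h1)
    exact (show 2 < p from hp).not_ge h2

theorem finite_UY [Finite K] : Finite (UY K Y n) := by
  have : Finite (GL (Idx (Y.dim n)) K) := inferInstance
  infer_instance

theorem mul_comm_rootSubgroup (a b : rootSubgroup K α) : a * b = b * a := by
  obtain ⟨s, hs⟩ := mem_rootSubgroup.1 a.2
  obtain ⟨t, ht⟩ := mem_rootSubgroup.1 b.2
  refine Subtype.ext ?_
  rw [Subgroup.coe_mul, Subgroup.coe_mul, hs, ht, ← rootElt_add, ← rootElt_add, add_comm]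

theorem normal_sourceKernel (hY : Y.GoodChar K) : (sourceKernel K α).Normal :=
  (normal_hookGroup hY).subgroupOf _

variable [(sourceKernel K α).Normal] {l : rootSubgroup K α →* ℂ}

/-- The characters induced from the source group are single root characters. The last statement
recovers the character of the source group. -/
theorem exists_representation_Psi [Finite K] (hY : Y.GoodChar K) {μ : TBar K α → ℂ}
    (hμ : μ ∈ Irr (TBar K α)) (hl : l ≠ 1) :
    ∃ (d : ℕ) (ρ : Representation ℂ (UY K Y n) (Fin d → ℂ)), ρ.IsIrreducible ∧
      ρ.character = Psi α (rootProj α) (μ, l) ∧ patternSubgroup K (kPattern α) ≤ ρ.ker ∧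
      (∀ t, ρ (rootElt α t) = rootVal l t • 1) ∧
      ∀ s : sourceGroup K α, μ s * l (rootProj α s) = (Nat.card (hookGroup K α) : ℂ)⁻¹ *
        ∑ᶠ v : hookGroup K α, hookChar l v⁻¹ * Psi α (rootProj α) (μ, l) (s * v) := by
  have := finite_UY (K := K) (Y := Y) (n := n)
  have := Fintype.ofFinite (UY K Y n)
  have := Fintype.ofFinite (hookGroup K α)
  have := normal_hookGroup (α := α) hY
  obtain ⟨d, τ, hτ, hτν, hτc⟩ := exists_twisted_inflation (l.comp (rootProj α)) hμ
  have hind : induced (sourceGroup K α) τ.character = Psi α (rootProj α) (μ, l) := by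
    rw [hτc]
    rfl
  obtain ⟨d', ρ, hρ, hρc, hrec, hρν⟩ := exists_induced_representation
    (isInertia_hookChar hY hl) hookGroup_le_sourceGroup τ hτ fun v => hτν _ v.2
  rw [hind] at hρc hrec
  refine ⟨d', ρ, hρ, hρc, fun v hv => ?_, fun t => ?_, fun s => ?_⟩
  · have h1 := hρν ⟨v, kGroup_le_hookGroup hv⟩ 1 fun g => hookChar_eq_one hY
      ((normal_kGroup hY).conj_mem v hv g)
    rw [one_smul] at h1
    exact h1
  · refine hρν ⟨rootElt α t, rootElt_mem_hookGroup t⟩ _ fun g => ?_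
    rw [← hookChar_rootElt hY t (rootElt_mem_hookGroup t)]
    have := normal_kGroup (α := α) hY
    refine hookChar_eq_of_mul_inv_mem hY ?_
    rw [MulAut.conjNormal_apply, ← QuotientGroup.eq_one_iff]
    have h1 := commute_map_rootElt_self (φ := QuotientGroup.mk' (patternSubgroup K (kPattern α))) hY
      (by rw [QuotientGroup.ker_mk']) t g
    rw [QuotientGroup.mk_mul, QuotientGroup.mk_mul, QuotientGroup.mk_mul]
    change QuotientGroup.mk' _ g * QuotientGroup.mk' _ (rootElt α t) * (QuotientGroup.mk' _ g)⁻¹ *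
      (QuotientGroup.mk' _ (rootElt α t))⁻¹ = 1
    rw [← h1.eq, mul_inv_cancel_right, mul_inv_cancel]
  · have h1 := hrec s
    rw [hτc] at h1
    rw [finsum_eq_sum_of_fintype, Nat.card_eq_fintype_card]
    exact h1

theorem mapsTo_Psi [Finite K] (hY : Y.GoodChar K) {μ : TBar K α → ℂ}
    (hμ : μ ∈ Irr (TBar K α)) (hl : l ≠ 1) :
    Psi α (rootProj α) (μ, l) ∈ singleRootIrr K α := by
  obtain ⟨d, ρ, hρ, hρc, hk, hρl, -⟩ := exists_representation_Psi hY hμ hl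
  rw [← hρc]
  exact ⟨⟨d, ρ, hρ, rfl⟩, (rootSupport_eq_iff hY hρ).2 ⟨hk, l, hl, hρl⟩⟩

theorem Psi_injective [Finite K] (hY : Y.GoodChar K) {μ μ' : TBar K α → ℂ}
    {l' : rootSubgroup K α →* ℂ} (hμ : μ ∈ Irr (TBar K α)) (hμ' : μ' ∈ Irr (TBar K α)) (hl : l ≠ 1)
    (hl' : l' ≠ 1) (h : Psi α (rootProj α) (μ, l) = Psi α (rootProj α) (μ', l')) :
    μ = μ' ∧ l = l' := by
  obtain ⟨d, ρ, hρ, hρc, -, hρl, hμρ⟩ := exists_representation_Psi hY hμ hl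
  obtain ⟨d', ρ', -, hρc', -, hρl', hμρ'⟩ := exists_representation_Psi hY hμ' hl'
  have hcc : ρ.character = ρ'.character := hρc.trans (h.trans hρc'.symm)
  have hll : l = l' := by
    refine MonoidHom.ext fun x => ?_
    obtain ⟨t, ht⟩ := mem_rootSubgroup.1 x.2
    rw [rootVal_eq ht, rootVal_eq ht]
    have h1 := congrFun hcc (rootElt α t)
    rw [character_of_eq_smul_one (hρl t), character_of_eq_smul_one (hρl' t), ← hcc] at h1
    exact mul_right_cancel₀ (character_one_ne_zero hρ) h1
  subst hll
  refine ⟨funext fun x => ?_, rfl⟩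
  obtain ⟨s, rfl⟩ := QuotientGroup.mk_surjective x
  have h1 := hμρ s
  rw [h, ← hμρ' s] at h1
  exact mul_right_cancel₀ ((Group.isUnit (rootProj α s)).map l).ne_zero h1

theorem exists_Psi_eq [Finite K] (hY : Y.GoodChar K) {χ : UY K Y n → ℂ}
    (hχ : χ ∈ singleRootIrr K α) :
    ∃ μ ∈ Irr (TBar K α), ∃ l : rootSubgroup K α →* ℂ, l ≠ 1 ∧
      Psi α (rootProj α) (μ, l) = χ := by
  have := finite_UY (K := K) (Y := Y) (n := n)
  have := Fintype.ofFinite (UY K Y n)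
  have := Fintype.ofFinite (hookGroup K α)
  have := normal_hookGroup (α := α) hY
  obtain ⟨⟨d, ρ, hρ, rfl⟩, hs⟩ := hχ
  obtain ⟨hk, l, hl, hρl⟩ := (rootSupport_eq_iff hY hρ).1 hs
  obtain ⟨d', τ, hτ, hτν, hρτ⟩ := exists_inertia_representation (isInertia_hookChar hY hl)
    hookGroup_le_sourceGroup hρ (charProj_hookChar_ne_zero hY hρ hk hl hρl)
  obtain ⟨μ, hμ, hμτ⟩ := exists_twisted_deflation (N := sourceKernel K α) (l.comp (rootProj α)) hτ
    fun v hv => hτν ⟨v, hv⟩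
  refine ⟨μ, hμ, l, hl, ?_⟩
  rw [hρτ, hμτ]
  rfl

theorem Psi_apply_one [Finite K] (hY : Y.GoodChar K) (μ : TBar K α → ℂ) (hl : l ≠ 1) :
    Psi α (rootProj α) (μ, l) 1 = (Nat.card K : ℂ) ^ (arm α).ncard * μ 1 := by
  have := finite_UY (K := K) (Y := Y) (n := n)
  rw [Psi, induced_apply_one, index_sourceGroup hY hl, Nat.cast_pow]
  congr 1
  change μ 1 * l (rootProj α 1) = μ 1
  rw [map_one, map_one, mul_one]

omit [(sourceKernel K α).Normal] in
/-- The nontrivial irreducible characters of the commutative root subgroup are its nontrivial linear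
characters. -/
theorem mem_Irr_rootSubgroup_sdiff {χ : rootSubgroup K α → ℂ} :
    χ ∈ Irr (rootSubgroup K α) \ {1} ↔ ∃ l : rootSubgroup K α →* ℂ, l ≠ 1 ∧ ⇑l = χ := by
  constructor
  · rintro ⟨h, hne⟩
    obtain ⟨l, rfl⟩ := exists_coe_eq_of_mem_Irr mul_comm_rootSubgroup h
    refine ⟨l, ?_, rfl⟩
    rintro rfl
    exact hne rfl
  · rintro ⟨l, hl, rfl⟩
    exact ⟨coe_mem_Irr l, fun h => hl (DFunLike.coe_injective h)⟩

end Psi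


end ClassicalUnipotent

theorem theorem1p1 (Y : Family) (n : ℕ) (hn : Y.RankOK n)
    (p : ℕ) (hp : Y.PrimeOK p) (K : Type*) [Field K] [Finite K] [CharP K p]
    (α : PosRoot Y n) :
    IsArm α (arm α) ∧
    IsClosedPattern (source α) ∧
    IsNormalPattern (leg α ∪ kPattern α) (source α) ∧
    ∃ (_ : (sourceKernel K α).Normal) (π : sourceGroup K α →* rootSubgroup K α),
      IsRootProjection α π ∧
      Set.BijOn (Psi α π) (Irr (TBar K α) ×ˢ (Irr (rootSubgroup K α) \ {1}))
        (singleRootIrr K α) ∧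
      ∀ μ ∈ Irr (TBar K α), ∀ l ∈ Irr (rootSubgroup K α) \ {1},
        Psi α π (μ, l) 1 = (Nat.card K : ℂ) ^ (arm α).ncard * μ 1 := by
  have hY : Y.GoodChar K := hp.goodChar
  have hnormal := normal_sourceKernel (K := K) (α := α) hY
  refine ⟨isArm_arm, isClosedPattern_source, isNormalPattern_leg_union_kPattern, hnormal,
    rootProj α, isRootProjection_rootProj hY, ⟨?_, ?_, ?_⟩, ?_⟩
  · rintro ⟨μ, l⟩ ⟨hμ, hl⟩
    obtain ⟨l, hl₁, rfl⟩ := mem_Irr_rootSubgroup_sdiff.1 hl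
    exact mapsTo_Psi hY hμ hl₁
  · rintro ⟨μ, l⟩ ⟨hμ, hl⟩ ⟨μ', l'⟩ ⟨hμ', hl'⟩ h
    obtain ⟨l, hl₁, rfl⟩ := mem_Irr_rootSubgroup_sdiff.1 hl
    obtain ⟨l', hl₁', rfl⟩ := mem_Irr_rootSubgroup_sdiff.1 hl'
    obtain ⟨rfl, rfl⟩ := Psi_injective hY hμ hμ' hl₁ hl₁' h
    rfl
  · intro χ hχ
    obtain ⟨μ, hμ, l, hl, rfl⟩ := exists_Psi_eq hY hχ
    exact ⟨(μ, l), ⟨hμ, mem_Irr_rootSubgroup_sdiff.2 ⟨l, hl, rfl⟩⟩, rfl⟩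
  · intro μ _ l hl
    obtain ⟨l, hl₁, rfl⟩ := mem_Irr_rootSubgroup_sdiff.1 hl
    exact Psi_apply_one hY μ hl₁
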